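/- **Oscillation inequality.** Let $d\ge 2$ and consider the lattice $\mathbb Z^d$ with its nearest-neighbour edges $E_d$ and graph distance; write $x\sim y$ if $\{x,y\}\in E_d$, and $B(x,\rho)$ for the closed ball with centre $x$ and radius $\rho$ in the graph distance. For positive edge weights $\omega=\{\omega(e)\in(0,\infty):e\in E_d\}$ and a positive function $\theta:\mathbb Z^d\to(0,\infty)$ (which may depend on $\omega$), put $$\mu(x)=\sum_{y\sim x}\omega(x,y),\qquad \nu(x)=\sum_{y\sim x}\frac1{\omega(x,y)},\qquad (\mathcal L_\theta^\omega f)(x)=\frac1{\theta(x)}\sum_{y\sim x}\omega(x,y)\,(f(y)-f(x)).$$ For a finite non-empty $B\subset\mathbb Z^d$ and $s\in(0,\infty)$ let $\|f\|_{s,B}=\big(\frac1{|B|}\sum_{x\in B}|f(x)|^s\big)^{1/s}$ and $\|f\|_{s,B,\theta}=\big(\frac1{\theta(B)}\sum_{x\in B}|f(x)|^s\theta(x)\big)^{1/s}$ with $\theta(B)=\sum_{x\in B}\theta(x)$; for $s=\infty$ both denote $\max_{B}|f|$. For $t_0\in\mathbb R$, $x_0\in\mathbb Z^d$ and real $n\geq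 1$ let $B(n)=B(x_0,n)$ and $Q(n)=[t_0-n^2,t_0]\times B(x_0,n)$ (and likewise with $n/4$, $n/2$ in place of $n$), let $\operatorname{osc}_Q u=\max_Q u-\min_Q u$, and, for $p,q,r\in(1,\infty]$, set $$A_1(n)=\|1/\theta\|_{1,B(n)}^2\,\|\theta\|_{r,B(n)}^2\,\|\nu\|_{q,B(n)},\qquad A_3(n)=\|1/\theta\|_{1,B(n/4)}\,\|\theta\|_{1,B(n/2)},$$ $$A_2(n)=\|1\vee(\mu/\theta)\|_{p,B(n),\theta}\,\|1\vee\nu\|_{q,B(n)}\,\|1\vee\theta\|_{r,B(n)}^2\,\|1\vee(1/\theta)\|_{1,B(n)}.$$ There exists $N_3=N_3(d)$ such that for all $p,q,r\in(1,\infty]$ with $$\frac1r+\frac1p\,\frac{r-1}{r}+\frac1q<\frac2d$$ there exists a function $\gamma:(0,\infty)^6\to(0,1)$, depending only on $d,p,q,r$, which is continuous and (strictly) increasing in all components, such that the following holds for all $\omega$, $\theta$, $t_0$, $x_0$ as above and all real $n\ge \max(1,N_3)$. If $u:\mathbb R\times\mathbb Z^d\to\mathbb R$ satisfies $\partial_t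 u-\mathcal L_\theta^\omega u=0$ on $Q(n)$ (with one-sided time derivatives at $t_0-n^2$ and $t_0$), then $$\operatorname{osc}_{Q(n/4)}u\;\le\;\gamma\big(A_1(n),A_2(n),A_3(n),\|\mu\|_{1,B(n)},\|\theta\|_{1,B(n)},\|1/\theta\|_{1,B(n)}\big)\;\operatorname{osc}_{Q(n)}u.$$ -/

import Mathlib

open scoped ENNReal

/-- The hypercubic lattice with its nearest-neighbour edges. -/
def latticeGraph (d : ℕ) : SimpleGraph (Fin d → ℤ) where
  Adj x y := ∑ i, |x i - y i| = 1
  symm := ⟨fun x y h => by simpa only [abs_sub_comm] using h⟩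
  loopless := ⟨fun x h => by simp at h⟩

theorem latticeGraph_abs_sub_le_length {d : ℕ} {x y : Fin d → ℤ}
    (w : (latticeGraph d).Walk x y) : ∑ i, |x i - y i| ≤ w.length := by
  induction w with
  | nil => simp
  | @cons a b c h w ih =>
    have h1 : ∑ i, |a i - b i| = 1 := h
    have h2 : ∑ i, |a i - c i| ≤ ∑ i, |a i - b i| + ∑ i, |b i - c i| := by
      rw [← Finset.sum_add_distrib]
      exact Finset.sum_le_sum fun i _ => abs_sub_le _ _ _
    rw [SimpleGraph.Walk.length_cons]
    push_cast
    linarith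

theorem latticeGraph_exists_walk {d : ℕ} (m : ℕ) : ∀ x y : Fin d → ℤ,
    ∑ i, |x i - y i| = m → ∃ w : (latticeGraph d).Walk x y, w.length = m := by
  induction m with
  | zero =>
    intro x y h
    have h0 : x = y := by
      funext i
      have h1 := (Finset.sum_eq_zero_iff_of_nonneg
        (fun i _ => abs_nonneg (x i - y i))).1 (by simpa using h) i (Finset.mem_univ i)
      exact sub_eq_zero.1 (abs_eq_zero.1 h1)
    subst h0
    exact ⟨SimpleGraph.Walk.nil, rfl⟩
  | succ m ih =>
    intro x y h
    have hne : ∃ i, x i ≠ y i := by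
      by_contra hcon
      push Not at hcon
      have : ∑ i, |x i - y i| = 0 := Finset.sum_eq_zero fun i _ => by simp [hcon i]
      push_cast at h
      omega
    obtain ⟨i, hi⟩ := hne
    have hs : ∃ s : ℤ, |s| = 1 ∧ |x i + s - y i| + 1 = |x i - y i| := by
      rcases lt_or_gt_of_ne hi with hlt | hgt
      · refine ⟨1, by simp, ?_⟩
        rw [abs_of_nonpos (by omega), abs_of_nonpos (by omega)]
        ring
      · refine ⟨-1, by simp, ?_⟩
        rw [abs_of_nonneg (by omega), abs_of_nonneg (by omega)]
        ring
    obtain ⟨s, hs1, hs2⟩ := hs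
    set z : Fin d → ℤ := Function.update x i (x i + s) with hz
    have hrest : ∀ j ∈ Finset.univ.erase i, z j = x j := fun j hj => by
      rw [hz, Function.update_of_ne (Finset.ne_of_mem_erase hj)]
    have hzi : z i = x i + s := by rw [hz, Function.update_self]
    have hadj : (latticeGraph d).Adj x z := by
      change ∑ j, |x j - z j| = 1
      rw [← Finset.add_sum_erase _ _ (Finset.mem_univ i), hzi,
        Finset.sum_eq_zero (fun j hj => by rw [hrest j hj]; simp)]
      simpa using hs1
    have hdist : ∑ j, |z j - y j| = m := by
      have e1 := Finset.add_sum_erase Finset.univ (fun j => |z j - y j|) (Finset.mem_univ i)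
      have e2 := Finset.add_sum_erase Finset.univ (fun j => |x j - y j|) (Finset.mem_univ i)
      have e3 : ∑ j ∈ Finset.univ.erase i, |z j - y j|
          = ∑ j ∈ Finset.univ.erase i, |x j - y j| :=
        Finset.sum_congr rfl fun j hj => by rw [hrest j hj]
      simp only [hzi] at e1
      push_cast at h
      omega
    obtain ⟨w, hw⟩ := ih z y hdist
    exact ⟨SimpleGraph.Walk.cons hadj w, by simp [hw]⟩

/-- The graph distance of the lattice is the `ℓ¹` distance. -/
theorem latticeGraph_dist {d : ℕ} (x y : Fin d → ℤ) :
    ((latticeGraph d).dist x y : ℤ) = ∑ i, |x i - y i| := by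
  have hnn : 0 ≤ ∑ i, |x i - y i| := Finset.sum_nonneg fun i _ => abs_nonneg _
  obtain ⟨w, hw⟩ := latticeGraph_exists_walk (∑ i, |x i - y i|).toNat x y
    (by rw [Int.toNat_of_nonneg hnn])
  have h1 : (latticeGraph d).dist x y ≤ w.length := SimpleGraph.dist_le w
  obtain ⟨w', hw'⟩ := SimpleGraph.Reachable.exists_walk_length_eq_dist ⟨w⟩
  have h2 := latticeGraph_abs_sub_le_length w'
  omega

theorem latticeGraph_ball_finite {d : ℕ} (x : Fin d → ℤ) (r : ℝ) :
    {y : Fin d → ℤ | ((latticeGraph d).dist x y : ℝ) ≤ r}.Finite := by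
  refine (Set.finite_Icc (fun i => x i - ⌊r⌋) (fun i => x i + ⌊r⌋)).subset fun y hy => ?_
  have h1 : ((latticeGraph d).dist x y : ℤ) ≤ ⌊r⌋ := Int.le_floor.2 (by simpa using hy)
  rw [latticeGraph_dist] at h1
  have h2 : ∀ i, |x i - y i| ≤ ⌊r⌋ := fun i =>
    (Finset.single_le_sum (f := fun i => |x i - y i|)
      (fun i _ => abs_nonneg _) (Finset.mem_univ i)).trans h1
  exact ⟨fun i => by have := abs_le.1 (h2 i); dsimp only; omega,
    fun i => by have := abs_le.1 (h2 i); dsimp only; omega⟩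

/-- The closed ball `B(x, r)` in the graph distance, as a finite set. -/
noncomputable def latticeBall {d : ℕ} (x : Fin d → ℤ) (r : ℝ) : Finset (Fin d → ℤ) :=
  (latticeGraph_ball_finite x r).toFinset

theorem mem_latticeBall {d : ℕ} {x y : Fin d → ℤ} {r : ℝ} :
    y ∈ latticeBall x r ↔ ((latticeGraph d).dist x y : ℝ) ≤ r := by
  simp [latticeBall]

noncomputable instance latticeGraph_locallyFinite (d : ℕ) : (latticeGraph d).LocallyFinite :=
  fun x => ((latticeGraph_ball_finite x 1).subset fun y hy => by
    have h1 : ∑ i, |x i - y i| = 1 := hy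
    have h2 := latticeGraph_dist x y
    rw [h1] at h2
    have h3 : (latticeGraph d).dist x y = 1 := by exact_mod_cast h2
    simp [h3]).fintype

/-- `μ^ω(x) = ∑_{y ∼ x} ω(x, y)`. Only the values of `ω` on edges matter. -/
noncomputable def condMu {d : ℕ} (ω : Sym2 (Fin d → ℤ) → ℝ) (x : Fin d → ℤ) : ℝ :=
  ∑ y ∈ (latticeGraph d).neighborFinset x, ω s(x, y)

/-- `ν^ω(x) = ∑_{y ∼ x} 1 / ω(x, y)`. -/
noncomputable def condNu {d : ℕ} (ω : Sym2 (Fin d → ℤ) → ℝ) (x : Fin d → ℤ) : ℝ :=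
  ∑ y ∈ (latticeGraph d).neighborFinset x, 1 / ω s(x, y)

/-- The generator `L_θ^ω` of the random walk with conductances `ω` and speed measure `θ`. -/
noncomputable def generator {d : ℕ} (ω : Sym2 (Fin d → ℤ) → ℝ) (θ : (Fin d → ℤ) → ℝ)
    (f : (Fin d → ℤ) → ℝ) (x : Fin d → ℤ) : ℝ :=
  1 / θ x * ∑ y ∈ (latticeGraph d).neighborFinset x, ω s(x, y) * (f y - f x)

/-- The space-averaged norm `‖f‖_{p,B}`, for `p ∈ (0, ∞]`. -/
noncomputable def avgNorm {V : Type*} (p : ℝ≥0∞) (B : Finset V) (f : V → ℝ) : ℝ :=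
  if p = ∞ then ⨆ x : B, |f x|
  else (1 / (B.card : ℝ) * ∑ x ∈ B, |f x| ^ p.toReal) ^ (1 / p.toReal)

/-- The weighted space-averaged norm `‖f‖_{p,B,φ}`, for `p ∈ (0, ∞]` and a positive weight `φ`. -/
noncomputable def avgNormW {V : Type*} (p : ℝ≥0∞) (B : Finset V) (φ f : V → ℝ) : ℝ :=
  if p = ∞ then ⨆ x : B, |f x|
  else (1 / (∑ x ∈ B, φ x) * ∑ x ∈ B, |f x| ^ p.toReal * φ x) ^ (1 / p.toReal)

/-- `A₁(n) = ‖1/θ‖²_{1,B(n)} ‖θ‖²_{r,B(n)} ‖ν‖_{q,B(n)}`, with `B(n) = B(x₀, n)`. -/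
noncomputable def coeffA1 {d : ℕ} (q r : ℝ≥0∞) (ω : Sym2 (Fin d → ℤ) → ℝ)
    (θ : (Fin d → ℤ) → ℝ) (x₀ : Fin d → ℤ) (n : ℝ) : ℝ :=
  avgNorm 1 (latticeBall x₀ n) (fun x => 1 / θ x) ^ 2 * avgNorm r (latticeBall x₀ n) θ ^ 2 *
    avgNorm q (latticeBall x₀ n) (condNu ω)

/-- `A₂(n) = ‖1 ∨ (μ/θ)‖_{p,B(n),θ} ‖1 ∨ ν‖_{q,B(n)} ‖1 ∨ θ‖²_{r,B(n)} ‖1 ∨ (1/θ)‖_{1,B(n)}`. -/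
noncomputable def coeffA2 {d : ℕ} (p q r : ℝ≥0∞) (ω : Sym2 (Fin d → ℤ) → ℝ)
    (θ : (Fin d → ℤ) → ℝ) (x₀ : Fin d → ℤ) (n : ℝ) : ℝ :=
  avgNormW p (latticeBall x₀ n) θ (fun x => max 1 (condMu ω x / θ x)) *
    avgNorm q (latticeBall x₀ n) (fun x => max 1 (condNu ω x)) *
    avgNorm r (latticeBall x₀ n) (fun x => max 1 (θ x)) ^ 2 *
    avgNorm 1 (latticeBall x₀ n) (fun x => max 1 (1 / θ x))

/-- `A₃(n) = ‖1/θ‖_{1,B(n/4)} ‖θ‖_{1,B(n/2)}`. -/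
noncomputable def coeffA3 {d : ℕ} (θ : (Fin d → ℤ) → ℝ) (x₀ : Fin d → ℤ) (n : ℝ) : ℝ :=
  avgNorm 1 (latticeBall x₀ (n / 4)) (fun x => 1 / θ x) * avgNorm 1 (latticeBall x₀ (n / 2)) θ

/-- The space-time cylinder `Q(n) = [t₀ - n², t₀] × B(x₀, n)`. -/
def cylinder {d : ℕ} (t₀ : ℝ) (x₀ : Fin d → ℤ) (n : ℝ) : Set (ℝ × (Fin d → ℤ)) :=
  Set.Icc (t₀ - n ^ 2) t₀ ×ˢ (latticeBall x₀ n : Set (Fin d → ℤ))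

/-- `∂_t u - L_θ^ω u = 0` on `Q(n)`; at the two end points of the time interval the time
derivative is one-sided. -/
def IsCaloricOnCylinder {d : ℕ} (ω : Sym2 (Fin d → ℤ) → ℝ) (θ : (Fin d → ℤ) → ℝ)
    (t₀ : ℝ) (x₀ : Fin d → ℤ) (n : ℝ) (u : ℝ → (Fin d → ℤ) → ℝ) : Prop :=
  ∀ t x, (t, x) ∈ cylinder t₀ x₀ n →
    HasDerivWithinAt (fun s => u s x) (generator ω θ (u t) x) (Set.Icc (t₀ - n ^ 2) t₀) t

/-- The oscillation of `u` on `Q`. For a solution on a cylinder the supremum and the infimum are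
attained, because `u` is continuous in time and the ball is finite. -/
noncomputable def oscOn {V : Type*} (Q : Set (ℝ × V)) (u : ℝ → V → ℝ) : ℝ :=
  sSup ((fun z : ℝ × V => u z.1 z.2) '' Q) - sInf ((fun z : ℝ × V => u z.1 z.2) '' Q)

/-! The proof is De Giorgi's method, applied to the logarithm of a positive solution. Conductances
and speed measure are divided by the number of points of B(n), giving a kernel `a` and a measure `m`
with energy 𝓔. A bound on A₂(n) then yields two functional inequalities, recorded in
`IsDeGiorgiKernel`: a flux bound ∑ f(x) ∑ a(x,y) ≤ M ‖f‖_{L^P(m)} with P conjugate to p, and a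
Sobolev inequality ‖f²‖_{L^s(m)} ≤ M n² 𝓔(f) with s = (1 - 1/r) / (1 - 2/d + 1/q) for f supported
well inside B(n). The condition on p, q, r says exactly that P < s, and this gap drives the
iteration behind the local maximum principle `exists_local_max_threshold`.

Map u affinely, with either sign, to v with values in [exp(-Λ), 1]. For one of the two signs v ≥ 1/2
on at least half of the cut-off mass at time t₀ - n²/8. The function g = -log v / Λ is a subsolution
with values in [0, 1], and testing the equation with η²/v (`IsSolutionOn.log_energy_le`) has two
consequences: the η²m-weighted sum of g grows by at most O(1/Λ), and the energy of g integrated over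
time is O(1/Λ). By the first, {g ≤ 3/4} keeps a fixed share of the mass at all later times
(`IsSolutionOn.persistence`), hence a fixed share of the points. So 4g - 3 has a positive part which
vanishes on a set of positive density; a Poincaré inequality bounds it by the energy
(`exists_excessNorm_le`), and by the second consequence it is small in space-time mean once Λ is
large. The local maximum principle turns this into g ≤ 7/8 on Q(n/4), that is v ≥ exp(-7Λ/8)
(`exists_growth_of_positivity`).

Thus the range of u on Q(n/4) loses a fraction exp(-7Λ/8) - exp(-Λ) at one end, and Λ depends only
on d, p, q, r and the bound on A₂(n). A continuous monotone majorant of the reciprocals of these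
fractions, plus the sum of all six arguments, gives γ. -/

/-! ### Algebraic energy inequalities on finite weighted graphs -/

/-- Hölder's inequality in its log-convex form. -/
theorem sum_rpow_mul_rpow_one_sub_le {ι : Type*} (s : Finset ι) {a : ℝ} (ha0 : 0 ≤ a) (ha1 : a ≤ 1)
    {f g : ι → ℝ} (hf : ∀ i ∈ s, 0 ≤ f i) (hg : ∀ i ∈ s, 0 ≤ g i) :
    ∑ i ∈ s, f i ^ a * g i ^ (1 - a) ≤ (∑ i ∈ s, f i) ^ a * (∑ i ∈ s, g i) ^ (1 - a) := by
  rcases ha0.eq_or_lt with rfl | ha0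
  · simp
  rcases ha1.eq_or_lt with rfl | ha1
  · simp
  have hb : 0 < 1 - a := by linarith
  have hpq : (1 / a).HolderConjugate (1 / (1 - a)) := by
    refine Real.holderConjugate_iff.2 ⟨?_, ?_⟩
    · rw [lt_div_iff₀ ha0]; linarith
    · simp
  have h := Real.inner_le_Lp_mul_Lq_of_nonneg s hpq (f := fun i => f i ^ a)
    (g := fun i => g i ^ (1 - a)) (fun i hi => Real.rpow_nonneg (hf i hi) _)
    (fun i hi => Real.rpow_nonneg (hg i hi) _)
  simp only [one_div_one_div] at h
  refine h.trans_eq ?_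
  congr 2
  · refine Finset.sum_congr rfl fun i hi => ?_
    rw [← Real.rpow_mul (hf i hi), mul_one_div_cancel ha0.ne', Real.rpow_one]
  · refine Finset.sum_congr rfl fun i hi => ?_
    rw [← Real.rpow_mul (hg i hi), mul_one_div_cancel hb.ne', Real.rpow_one]

/-- The Dirichlet form of a kernel `a` on a finite set, summed over ordered pairs. -/
def dirichletForm {V : Type*} (K : Finset V) (a : V → V → ℝ) (f : V → ℝ) : ℝ :=
  ∑ x ∈ K, ∑ y ∈ K, a x y * (f x - f y) ^ 2

theorem dirichletForm_nonneg {V : Type*} {K : Finset V} {a : V → V → ℝ}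
    (ha : ∀ x y, 0 ≤ a x y) (f : V → ℝ) : 0 ≤ dirichletForm K a f :=
  Finset.sum_nonneg fun x _ => Finset.sum_nonneg fun y _ => mul_nonneg (ha x y) (sq_nonneg _)

/-- Summation by parts: exchange x and y in the double sum and average the two forms. The factor 1/2
compensates for counting every edge twice. -/
theorem sum_mul_laplacian_eq {V : Type*} (K : Finset V) {a : V → V → ℝ}
    (hsymm : ∀ x y, a x y = a y x) (ψ f : V → ℝ) :
    ∑ x ∈ K, ψ x * ∑ y ∈ K, a x y * (f y - f x) =
      -(1 / 2) * ∑ x ∈ K, ∑ y ∈ K, a x y * ((ψ x - ψ y) * (f x - f y)) := by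
  have h1 : ∑ x ∈ K, ψ x * ∑ y ∈ K, a x y * (f y - f x) =
      ∑ x ∈ K, ∑ y ∈ K, ψ x * (a x y * (f y - f x)) := by simp only [Finset.mul_sum]
  have h2 : ∑ x ∈ K, ∑ y ∈ K, ψ x * (a x y * (f y - f x)) =
      ∑ x ∈ K, ∑ y ∈ K, ψ y * (a x y * (f x - f y)) := by
    rw [Finset.sum_comm]
    refine Finset.sum_congr rfl fun x _ => Finset.sum_congr rfl fun y _ => ?_
    rw [hsymm]
  have h3 : ∑ x ∈ K, ∑ y ∈ K, ψ x * (a x y * (f y - f x)) +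
      ∑ x ∈ K, ∑ y ∈ K, ψ y * (a x y * (f x - f y)) =
      -∑ x ∈ K, ∑ y ∈ K, a x y * ((ψ x - ψ y) * (f x - f y)) := by
    simp only [← Finset.sum_add_distrib, ← Finset.sum_neg_distrib]
    refine Finset.sum_congr rfl fun x _ => Finset.sum_congr rfl fun y _ => ?_
    ring
  linarith

/-- The algebraic form of the Caccioppoli inequality for truncations. -/
theorem sum_sq_mul_posPart_mul_laplacian_le {V : Type*} (K : Finset V) {a : V → V → ℝ}
    (hsymm : ∀ x y, a x y = a y x) (ha : ∀ x y, 0 ≤ a x y) (η g : V → ℝ) (k : ℝ) :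
    ∑ x ∈ K, 2 * η x ^ 2 * max (g x - k) 0 * ∑ y ∈ K, a x y * (g y - g x) ≤
      -dirichletForm K a (fun x => η x * max (g x - k) 0) +
        ∑ x ∈ K, ∑ y ∈ K,
          a x y * ((η x - η y) ^ 2 * (max (g x - k) 0 * max (g y - k) 0)) := by
  set w : V → ℝ := fun x => max (g x - k) 0 with hw
  have hw0 : ∀ x, 0 ≤ w x := fun x => le_max_right _ _
  -- Either `w x = 0`, or `w x = g x - k` while `w y ≥ g y - k`; so `g` may be replaced by its
  -- truncation.
  have hstep : ∀ x y, w x * (g y - g x) ≤ w x * (w y - w x) := by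
    intro x y
    rcases le_total (g x - k) 0 with h | h
    · have : w x = 0 := max_eq_right h
      simp [this]
    · have h1 : w x = g x - k := max_eq_left h
      have h2 : g y - k ≤ w y := le_max_left _ _
      exact mul_le_mul_of_nonneg_left (by linarith) (hw0 x)
  calc ∑ x ∈ K, 2 * η x ^ 2 * w x * ∑ y ∈ K, a x y * (g y - g x)
      ≤ ∑ x ∈ K, (2 * η x ^ 2 * w x) * ∑ y ∈ K, a x y * (w y - w x) := by
        refine Finset.sum_le_sum fun x _ => ?_
        rw [Finset.mul_sum, Finset.mul_sum]
        refine Finset.sum_le_sum fun y _ => ?_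
        have := mul_le_mul_of_nonneg_left (hstep x y)
          (mul_nonneg (mul_nonneg zero_le_two (sq_nonneg (η x))) (ha x y))
        linarith
    -- With ψ = 2η²w this is the termwise identity (η_x² w_x - η_y² w_y)(w_x - w_y) = (η_x w_x - η_y
    -- w_y)² - (η_x - η_y)² w_x w_y.
    _ = _ := by
        rw [sum_mul_laplacian_eq K hsymm, dirichletForm, ← Finset.sum_neg_distrib,
          ← Finset.sum_add_distrib, Finset.mul_sum]
        refine Finset.sum_congr rfl fun x _ => ?_
        rw [Finset.mul_sum, ← Finset.sum_neg_distrib, ← Finset.sum_add_distrib]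
        refine Finset.sum_congr rfl fun y _ => ?_
        ring

theorem sq_le_two_mul_cosh_sub_one (z : ℝ) : z ^ 2 ≤ 2 * (Real.cosh z - 1) := by
  have h := Real.cosh_two_mul (z / 2)
  rw [mul_div_cancel₀ z two_ne_zero, Real.cosh_sq] at h
  have h2 : (z / 2) ^ 2 ≤ Real.sinh (z / 2) ^ 2 := by
    rw [sq_le_sq, Real.abs_sinh]
    exact Real.self_le_sinh_iff.2 (abs_nonneg _)
  nlinarith

/-- The logarithmic energy inequality on one edge. -/
theorem log_edge_inequality {α β e f : ℝ} (hα : 0 ≤ α) (hβ : 0 ≤ β) (he : 0 < e) (hf : 0 < f) :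
    α * β * (Real.log e - Real.log f) ^ 2 / 2 - 2 * (α - β) ^ 2 ≤
      -((α ^ 2 / e - β ^ 2 / f) * (e - f)) := by
  have hrw : -((α ^ 2 / e - β ^ 2 / f) * (e - f)) =
      α ^ 2 * (f / e) + β ^ 2 * (e / f) - α ^ 2 - β ^ 2 := by
    field_simp; ring
  rw [hrw]
  have h1 : 0 < f / e := div_pos hf he
  have h2 : 0 < e / f := div_pos he hf
  rcases hα.eq_or_lt with rfl | hα
  · nlinarith [mul_nonneg (sq_nonneg β) h2.le]
  rcases hβ.eq_or_lt with rfl | hβ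
  · nlinarith [mul_nonneg (sq_nonneg α) h1.le]
  -- In these variables the right-hand side is 2αβ(cosh(z + l) - cosh l). From below, 2(cosh(z + l)
  -- - 1) ≥ (z + l)² ≥ z²/2 - l². The remaining term 2αβ(cosh l - 1) equals (α - β)² and also
  -- dominates αβl², so the total error is 2(α - β)².
  set z := Real.log f - Real.log e with hz
  set l := Real.log α - Real.log β with hl
  have hez : Real.exp z = f / e := by
    rw [hz, Real.exp_sub, Real.exp_log hf, Real.exp_log he]
  have henz : Real.exp (-z) = e / f := by rw [Real.exp_neg, hez, inv_div]
  have hel : Real.exp l = α / β := by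
    rw [hl, Real.exp_sub, Real.exp_log hα, Real.exp_log hβ]
  have henl : Real.exp (-l) = β / α := by rw [Real.exp_neg, hel, inv_div]
  have hcosh : 2 * Real.cosh (z + l) = f / e * (α / β) + e / f * (β / α) := by
    rw [Real.cosh_eq, neg_add, Real.exp_add, Real.exp_add, hez, henz, hel, henl]; ring
  have hcosh' : α * β * (2 * Real.cosh (z + l)) = α ^ 2 * (f / e) + β ^ 2 * (e / f) := by
    rw [hcosh]; field_simp
  have hcl : α * β * (2 * Real.cosh l) = α ^ 2 + β ^ 2 := by
    rw [Real.cosh_eq, hel, henl]; field_simp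
  have hl2 : α * β * l ^ 2 ≤ (α - β) ^ 2 := by
    have := mul_le_mul_of_nonneg_left (sq_le_two_mul_cosh_sub_one l) (mul_pos hα hβ).le
    nlinarith
  have hzl : α * β * (z + l) ^ 2 ≤ α * β * (2 * (Real.cosh (z + l) - 1)) :=
    mul_le_mul_of_nonneg_left (sq_le_two_mul_cosh_sub_one _) (mul_pos hα hβ).le
  have hsq : α * β * (z ^ 2 / 2 - l ^ 2) ≤ α * β * (z + l) ^ 2 :=
    mul_le_mul_of_nonneg_left (by nlinarith [sq_nonneg (z + 2 * l)]) (mul_pos hα hβ).le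
  have : (Real.log e - Real.log f) ^ 2 = z ^ 2 := by rw [hz]; ring
  rw [this]
  nlinarith

/-! ### Integration in time and De Giorgi sequences -/

/-- Squaring removes the corner of the positive part, so the energy of a truncation can be
differentiated in time without smoothing. -/
theorem hasDerivAt_max_zero_sq (y : ℝ) :
    HasDerivAt (fun y : ℝ => max y 0 ^ 2) (2 * max y 0) y := by
  rcases lt_trichotomy y 0 with h | rfl | h
  · rw [max_eq_right h.le, mul_zero]
    refine (hasDerivAt_const y (0 : ℝ)).congr_of_eventuallyEq ?_
    filter_upwards [gt_mem_nhds h] with z hz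
    simp [max_eq_right hz.le]
  · rw [max_self, mul_zero, hasDerivAt_iff_isLittleO]
    simp only [max_self, smul_zero, sub_zero, ne_eq, OfNat.ofNat_ne_zero, not_false_eq_true,
      zero_pow]
    have h1 : (fun z : ℝ => max z 0 ^ 2) =O[nhds 0] fun z => z ^ 2 := by
      refine Asymptotics.isBigO_of_le _ fun z => ?_
      rw [Real.norm_eq_abs, Real.norm_eq_abs, abs_of_nonneg (sq_nonneg _),
        abs_of_nonneg (sq_nonneg _)]
      rcases le_total z 0 with hz | hz
      · rw [max_eq_right hz]; nlinarith
      · rw [max_eq_left hz]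
    refine h1.trans_isLittleO ?_
    simpa using Asymptotics.isLittleO_pow_pow (𝕜 := ℝ) (m := 1) (n := 2) one_lt_two
  · rw [max_eq_left h.le]
    have h2 : HasDerivAt (fun y : ℝ => y ^ 2) (2 * y) y := by simpa using hasDerivAt_pow 2 y
    refine h2.congr_of_eventuallyEq ?_
    filter_upwards [lt_mem_nhds h] with z hz
    simp [max_eq_left hz.le]

/-- One-sided derivatives at the end points suffice, because the fundamental theorem needs only
continuity there. -/
theorem sub_le_integral_of_hasDerivWithinAt_Icc {g g' φ : ℝ → ℝ} {a b c d : ℝ} (hac : a ≤ c)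
    (hcd : c ≤ d) (hdb : d ≤ b)
    (hder : ∀ t ∈ Set.Icc a b, HasDerivWithinAt g (g' t) (Set.Icc a b) t)
    (hφ : ContinuousOn φ (Set.Icc a b)) (hle : ∀ t ∈ Set.Icc a b, g' t ≤ φ t) :
    g d - g c ≤ ∫ t in c..d, φ t := by
  have hsub : Set.Icc c d ⊆ Set.Icc a b := Set.Icc_subset_Icc hac hdb
  refine intervalIntegral.sub_le_integral_of_hasDeriv_right_of_le hcd (g' := g')
    (fun t ht => ((hder t (hsub ht)).continuousWithinAt).mono hsub) (fun t ht => ?_)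
    ((hφ.mono hsub).integrableOn_Icc)
    (fun t ht => hle t (hsub (Set.Ioo_subset_Icc_self ht)))
  have h1 := hder t (hsub (Set.Ioo_subset_Icc_self ht))
  exact (h1.hasDerivAt (Icc_mem_nhds (hac.trans_lt ht.1) (ht.2.trans_le hdb))).hasDerivWithinAt

/-- Integration in time of a differential energy inequality, with a linear time cutoff. -/
theorem energy_time_integration {s s' t₀ c₁ c₂ : ℝ} {Φ Φ' E A : ℝ → ℝ} (hs : s < s')
    (hs' : s' ≤ t₀) (hder : ∀ t ∈ Set.Icc s t₀, HasDerivWithinAt Φ (Φ' t) (Set.Icc s t₀) t)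
    (hE : ContinuousOn E (Set.Icc s t₀)) (hA : ContinuousOn A (Set.Icc s t₀))
    (hle : ∀ t ∈ Set.Icc s t₀, Φ' t + E t ≤ c₁ * A t)
    (hΦA : ∀ t ∈ Set.Icc s t₀, Φ t ≤ c₂ * A t)
    (hΦ0 : ∀ t ∈ Set.Icc s t₀, 0 ≤ Φ t)
    (hE0 : ∀ t ∈ Set.Icc s t₀, 0 ≤ E t) (hA0 : ∀ t ∈ Set.Icc s t₀, 0 ≤ A t)
    (hc₁ : 0 ≤ c₁) (hc₂ : 0 ≤ c₂) :
    (∀ t ∈ Set.Icc s' t₀, Φ t ≤ ((t₀ - s) * c₁ + c₂) / (s' - s) * ∫ τ in s..t₀, A τ) ∧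
      ∫ τ in s'..t₀, E τ ≤ ((t₀ - s) * c₁ + c₂) / (s' - s) * ∫ τ in s..t₀, A τ := by
  set C := ((t₀ - s) * c₁ + c₂) / (s' - s) with hC
  have hss : 0 < s' - s := sub_pos.2 hs
  have hC0 : 0 ≤ C := div_nonneg (add_nonneg (mul_nonneg (by linarith) hc₁) hc₂) hss.le
  -- The cutoff is not truncated at 1: it vanishes at `s`, is at least 1 from `s'` on, and never
  -- exceeds (t₀ - s)/(s' - s). This maximum and the slope 1/(s' - s) produce the two parts of `C`.
  set ζ : ℝ → ℝ := fun t => (t - s) / (s' - s) with hζ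
  have hζ0 : ∀ t ∈ Set.Icc s t₀, 0 ≤ ζ t := fun t ht =>
    div_nonneg (sub_nonneg.2 ht.1) hss.le
  have hζc : Continuous ζ := by fun_prop
  have hζd : ∀ t, HasDerivAt ζ (1 / (s' - s)) t := fun t =>
    ((hasDerivAt_id t).sub_const s).div_const _
  have hii : ∀ {f : ℝ → ℝ}, ContinuousOn f (Set.Icc s t₀) → ∀ {a b : ℝ}, s ≤ a → a ≤ b → b ≤ t₀ →
      IntervalIntegrable f MeasureTheory.volume a b := by
    intro f hf a b ha hab hb
    refine (hf.mono ?_).intervalIntegrable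
    rw [Set.uIcc_of_le hab]
    exact Set.Icc_subset_Icc ha hb
  have hζE : ContinuousOn (fun t => ζ t * E t) (Set.Icc s t₀) := hζc.continuousOn.mul hE
  have hkey : ∀ t ∈ Set.Icc s' t₀,
      Φ t + ∫ τ in s'..t, E τ ≤ C * ∫ τ in s..t₀, A τ := by
    intro t ht
    have hst : s ≤ t := hs.le.trans ht.1
    have h1 := sub_le_integral_of_hasDerivWithinAt_Icc (g := fun t => ζ t * Φ t)
      (φ := fun t => C * A t - ζ t * E t) le_rfl hst ht.2
      (fun τ hτ => ((hζd τ).hasDerivWithinAt).mul (hder τ hτ))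
      ((continuousOn_const.mul hA).sub hζE) (fun τ hτ => by
        have e1 := mul_le_mul_of_nonneg_left (hle τ hτ) (hζ0 τ hτ)
        have e2 : ζ τ * (c₁ * A τ) ≤ (t₀ - s) / (s' - s) * (c₁ * A τ) := by
          refine mul_le_mul_of_nonneg_right ?_ (mul_nonneg hc₁ (hA0 τ hτ))
          exact div_le_div_of_nonneg_right (by linarith [hτ.2]) hss.le
        have e3 : 1 / (s' - s) * Φ τ ≤ 1 / (s' - s) * (c₂ * A τ) :=
          mul_le_mul_of_nonneg_left (hΦA τ hτ) (by positivity)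
        have e4 : C * A τ = (t₀ - s) / (s' - s) * (c₁ * A τ) + 1 / (s' - s) * (c₂ * A τ) := by
          rw [hC]; ring
        rw [e4]; linarith)
    have hζs : ζ s = 0 := by simp [hζ]
    simp only [hζs, zero_mul, sub_zero] at h1
    rw [intervalIntegral.integral_sub (hii (f := fun t => C * A t) (continuousOn_const.mul hA) le_rfl hst ht.2)
      (hii hζE le_rfl hst ht.2), intervalIntegral.integral_const_mul] at h1
    have hmem : ∀ {τ}, s ≤ τ → τ ≤ t → τ ∈ Set.Icc s t₀ := fun h1 h2 => ⟨h1, h2.trans ht.2⟩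
    have h2 : ∫ τ in s..t, A τ ≤ ∫ τ in s..t₀, A τ := by
      rw [← intervalIntegral.integral_add_adjacent_intervals (hii hA le_rfl hst ht.2)
        (hii hA hst ht.2 le_rfl)]
      linarith [intervalIntegral.integral_nonneg ht.2 (f := A) (μ := MeasureTheory.volume)
        fun τ hτ => hA0 τ ⟨hst.trans hτ.1, hτ.2⟩]
    have h3 : ∫ τ in s'..t, E τ ≤ ∫ τ in s..t, ζ τ * E τ := by
      rw [← intervalIntegral.integral_add_adjacent_intervals
        (hii hζE le_rfl hs.le (ht.1.trans ht.2)) (hii hζE hs.le ht.1 ht.2)]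
      have e1 := intervalIntegral.integral_nonneg hs.le (f := fun τ => ζ τ * E τ)
        (μ := MeasureTheory.volume) fun τ hτ =>
          mul_nonneg (hζ0 τ (hmem hτ.1 (hτ.2.trans ht.1))) (hE0 τ (hmem hτ.1 (hτ.2.trans ht.1)))
      have e2 : ∫ τ in s'..t, E τ ≤ ∫ τ in s'..t, ζ τ * E τ := by
        refine intervalIntegral.integral_mono_on ht.1 (hii hE hs.le ht.1 ht.2)
          (hii hζE hs.le ht.1 ht.2) fun τ hτ => ?_
        refine le_mul_of_one_le_left (hE0 τ (hmem (hs.le.trans hτ.1) hτ.2)) ?_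
        rw [hζ, one_le_div hss]
        linarith [hτ.1]
      linarith
    have h4 : Φ t ≤ ζ t * Φ t := by
      refine le_mul_of_one_le_left (hΦ0 t ⟨hst, ht.2⟩) ?_
      rw [hζ, one_le_div hss]
      linarith [ht.1]
    have h5 := mul_le_mul_of_nonneg_left h2 hC0
    linarith
  refine ⟨fun t ht => ?_, ?_⟩
  · have := hkey t ht
    have h0 := intervalIntegral.integral_nonneg ht.1 (f := E) (μ := MeasureTheory.volume)
      fun τ hτ => hE0 τ ⟨hs.le.trans hτ.1, hτ.2.trans ht.2⟩
    linarith
  · have := hkey t₀ ⟨hs', le_rfl⟩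
    linarith [hΦ0 t₀ ⟨hs.le.trans hs', le_rfl⟩]

/-- Fast geometric convergence of De Giorgi sequences. -/
theorem exists_deGiorgi_threshold {D b κ : ℝ} (hD : 0 < D) (hb : 0 < b) (hκ : 1 < κ) :
    ∃ δ > 0, ∀ Y : ℕ → ℝ, (∀ j, 0 ≤ Y j) → Y 0 ≤ δ →
      (∀ j, Y (j + 1) ≤ D * b ^ j * Y j ^ κ) → ∀ j, Y j ≤ δ * (1 / 16) ^ j := by
  have hκ' : 0 < κ - 1 := sub_pos.2 hκ
  -- The ratio makes b r^(κ-1) ≤ 1, and δ below is fixed by D δ^(κ-1) = r; then the bound δ r^j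
  -- reproduces itself under the recursion. The cap 1/16 provides a decay that beats the growth 8^j
  -- in the local maximum principle.
  set r : ℝ := min (1 / 16) ((1 / b) ^ (1 / (κ - 1))) with hr
  have hr0 : 0 < r := lt_min (by norm_num) (Real.rpow_pos_of_pos (by positivity) _)
  have hbr : b * r ^ (κ - 1) ≤ 1 := by
    have h1 : r ^ (κ - 1) ≤ 1 / b := by
      refine (Real.rpow_le_rpow hr0.le (min_le_right _ _) hκ'.le).trans_eq ?_
      rw [← Real.rpow_mul (by positivity), one_div_mul_cancel hκ'.ne', Real.rpow_one]
    calc b * r ^ (κ - 1) ≤ b * (1 / b) := mul_le_mul_of_nonneg_left h1 hb.le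
      _ = 1 := mul_one_div_cancel hb.ne'
  set δ : ℝ := (r / D) ^ (1 / (κ - 1)) with hδ
  have hδ0 : 0 < δ := Real.rpow_pos_of_pos (by positivity) _
  have hDδ : D * δ ^ (κ - 1) = r := by
    rw [hδ, ← Real.rpow_mul (by positivity), one_div_mul_cancel hκ'.ne', Real.rpow_one]
    field_simp
  refine ⟨δ, hδ0, fun Y hY0 hYδ hrec => ?_⟩
  have hmain : ∀ j, Y j ≤ δ * r ^ j := by
    intro j
    induction j with
    | zero => simpa using hYδ
    | succ j ih =>
      have hpow : ∀ x : ℝ, 0 < x → x ^ κ = x * x ^ (κ - 1) := fun x hx => by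
        rw [Real.rpow_sub_one hx.ne']; field_simp
      have hrj : 0 < r ^ j := pow_pos hr0 j
      have h1 : (r ^ j) ^ (κ - 1) = (r ^ (κ - 1)) ^ j := by
        rw [← Real.rpow_natCast, ← Real.rpow_mul hr0.le, mul_comm, Real.rpow_mul hr0.le,
          Real.rpow_natCast]
      calc Y (j + 1) ≤ D * b ^ j * Y j ^ κ := hrec j
        _ ≤ D * b ^ j * (δ * r ^ j) ^ κ := by
          gcongr
          exact hY0 j
        _ = δ * (D * δ ^ (κ - 1)) * r ^ j * (b * r ^ (κ - 1)) ^ j := by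
          rw [Real.mul_rpow hδ0.le hrj.le, hpow δ hδ0, hpow _ hrj, h1, mul_pow]
          ring
        _ ≤ δ * (D * δ ^ (κ - 1)) * r ^ j * 1 := by
          gcongr
          exact pow_le_one₀ (mul_nonneg hb.le (Real.rpow_nonneg hr0.le _)) hbr
        _ = δ * r ^ (j + 1) := by rw [hDδ]; ring
  intro j
  refine (hmain j).trans ?_
  gcongr
  exact min_le_left _ _

/-! ### Cutoffs and De Giorgi iteration for an abstract kernel -/

/-- The piecewise linear cutoff which is `1` for `r ≤ R'` and `0` for `R ≤ r`. -/
noncomputable def linearCutoff (R' R r : ℝ) : ℝ := max 0 (min 1 ((R - r) / (R - R')))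

theorem linearCutoff_nonneg (R' R r : ℝ) : 0 ≤ linearCutoff R' R r := le_max_left _ _

theorem linearCutoff_le_one (R' R r : ℝ) : linearCutoff R' R r ≤ 1 :=
  max_le zero_le_one (min_le_left _ _)

theorem linearCutoff_eq_one {R' R r : ℝ} (hR : R' < R) (h : r ≤ R') : linearCutoff R' R r = 1 := by
  have h1 : 1 ≤ (R - r) / (R - R') := by rw [one_le_div (sub_pos.2 hR)]; linarith
  rw [linearCutoff, min_eq_left h1, max_eq_right zero_le_one]

theorem linearCutoff_eq_zero {R' R r : ℝ} (hR : R' < R) (h : R ≤ r) : linearCutoff R' R r = 0 := by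
  have h1 : (R - r) / (R - R') ≤ 0 :=
    div_nonpos_of_nonpos_of_nonneg (by linarith) (sub_pos.2 hR).le
  exact max_eq_left ((min_le_right _ _).trans h1)

theorem linearCutoff_sub_sq_le {R' R r₁ r₂ : ℝ} (hR : R' < R) (h : |r₁ - r₂| ≤ 1) :
    (linearCutoff R' R r₁ - linearCutoff R' R r₂) ^ 2 ≤ 1 / (R - R') ^ 2 := by
  have hR' := sub_pos.2 hR
  have h1 : |linearCutoff R' R r₁ - linearCutoff R' R r₂| ≤ 1 / (R - R') := by
    rw [linearCutoff, linearCutoff]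
    refine (abs_max_sub_max_le_max _ _ _ _).trans ?_
    rw [sub_self, abs_zero, max_eq_right (abs_nonneg _)]
    refine (abs_min_sub_min_le_max _ _ _ _).trans ?_
    rw [sub_self, abs_zero, max_eq_right (abs_nonneg _), ← sub_div, abs_div, abs_of_pos hR']
    refine div_le_div_of_nonneg_right ?_ hR'.le
    rwa [sub_sub_sub_cancel_left, abs_sub_comm]
  rw [← sq_abs, ← one_div_pow]
  exact pow_le_pow_left₀ (abs_nonneg _) h1 2

/-- A symmetric kernel with speed measure on a finite set for which the flux and the
Sobolev estimates of De Giorgi's iteration hold at scale `n`. -/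
structure IsDeGiorgiKernel {V : Type*} (K : Finset V) (a : V → V → ℝ) (m ρ : V → ℝ)
    (P s M n : ℝ) : Prop where
  symm : ∀ x y, a x y = a y x
  nonneg : ∀ x y, 0 ≤ a x y
  m_pos : ∀ x, 0 < m x
  lip : ∀ x y, a x y ≠ 0 → |ρ x - ρ y| ≤ 1
  one_le : 1 ≤ M
  mass : ∑ x ∈ K, m x ≤ M
  flux : ∀ f : V → ℝ, (∀ x, 0 ≤ f x) →
    ∑ x ∈ K, f x * ∑ y ∈ K, a x y ≤ M * (∑ x ∈ K, f x ^ P * m x) ^ (1 / P)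
  sobolev : ∀ f : V → ℝ, (∀ x, 0 ≤ f x) → (∀ x, 3 * n / 8 < ρ x → f x = 0) →
    (∑ x ∈ K, (f x ^ 2) ^ s * m x) ^ (1 / s) ≤ M * n ^ 2 * dirichletForm K a f

/-- `g` is a subsolution, with time derivative `g'`, at the points of `K` with `ρ ≤ R`. -/
structure IsSubsolutionOn {V : Type*} (K : Finset V) (a : V → V → ℝ) (m ρ : V → ℝ)
    (R : ℝ) (I : Set ℝ) (g g' : ℝ → V → ℝ) : Prop where
  cont : ∀ x ∈ K, ContinuousOn (fun t => g t x) I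
  deriv : ∀ t ∈ I, ∀ x ∈ K, ρ x ≤ R → HasDerivWithinAt (fun t => g t x) (g' t x) I t
  le : ∀ t ∈ I, ∀ x ∈ K, ρ x ≤ R → m x * g' t x ≤ ∑ y ∈ K, a x y * (g t y - g t x)

theorem IsSubsolutionOn.mono {V : Type*} {K : Finset V} {a : V → V → ℝ} {m ρ : V → ℝ}
    {R : ℝ} {I J : Set ℝ} {g g' : ℝ → V → ℝ} (h : IsSubsolutionOn K a m ρ R I g g') (hJ : J ⊆ I) :
    IsSubsolutionOn K a m ρ R J g g' :=
  ⟨fun x hx => (h.cont x hx).mono hJ, fun t ht x hx hR => (h.deriv t (hJ ht) x hx hR).mono hJ,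
    fun t ht => h.le t (hJ ht)⟩

/-- The `L^P(m)` norm of the positive part of `g - k` over the points with `ρ ≤ R`. -/
noncomputable def excessNorm {V : Type*} (K : Finset V) (m ρ : V → ℝ) (P R k : ℝ) (g : V → ℝ) :
    ℝ :=
  (∑ x ∈ K with ρ x ≤ R, max (g x - k) 0 ^ P * m x) ^ (1 / P)

section
variable {V : Type*} {K : Finset V} {a : V → V → ℝ} {m ρ : V → ℝ} {P s M n : ℝ}

theorem excessNorm_nonneg (hm : ∀ x, 0 < m x) (P R k : ℝ) (g : V → ℝ) :
    0 ≤ excessNorm K m ρ P R k g :=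
  Real.rpow_nonneg (Finset.sum_nonneg fun x _ =>
    mul_nonneg (Real.rpow_nonneg (le_max_right _ _) _) (hm x).le) _

theorem continuousOn_excessNorm {I : Set ℝ} {g : ℝ → V → ℝ} (hP : 1 ≤ P)
    (hg : ∀ x ∈ K, ContinuousOn (fun t => g t x) I) (R k : ℝ) :
    ContinuousOn (fun t => excessNorm K m ρ P R k (g t)) I := by
  have hP0 : 0 < P := by linarith
  refine ContinuousOn.rpow_const (continuousOn_finsetSum _ fun x hx => ?_)
    fun _ _ => Or.inr (by positivity)
  have h1 := hg x (Finset.mem_filter.1 hx).1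
  refine ContinuousOn.mul (ContinuousOn.rpow_const ?_ fun _ _ => Or.inr hP0.le) continuousOn_const
  exact ContinuousOn.sup (h1.sub continuousOn_const) continuousOn_const

theorem sum_indicator_posPart (P R k : ℝ) (hP : 1 ≤ P) (g : V → ℝ) :
    ∑ x ∈ K, (if ρ x ≤ R then max (g x - k) 0 else 0) ^ P * m x =
      ∑ x ∈ K with ρ x ≤ R, max (g x - k) 0 ^ P * m x := by
  rw [Finset.sum_filter]
  refine Finset.sum_congr rfl fun x _ => ?_
  split_ifs
  · rfl
  · rw [Real.zero_rpow (by linarith), zero_mul]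

/-- Along an edge the cutoff changes by at most 1/(R - R'), and not at all if both end points lie
beyond `R`. Both truncations are at most 1, so their product is bounded by the truncation at an end
point with ρ ≤ R. The error is thus linear in the excess, and the flux bound applies to it. -/
theorem IsDeGiorgiKernel.cross_term_le (hK : IsDeGiorgiKernel K a m ρ P s M n) (hP : 1 ≤ P)
    {R' R k : ℝ} (hR : R' < R) (hk : 0 ≤ k) {g : V → ℝ} (hg : ∀ x ∈ K, g x ≤ 1) :
    ∑ x ∈ K, ∑ y ∈ K, a x y * ((linearCutoff R' R (ρ x) - linearCutoff R' R (ρ y)) ^ 2 *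
      (max (g x - k) 0 * max (g y - k) 0)) ≤
      2 * M / (R - R') ^ 2 * excessNorm K m ρ P R k g := by
  set f : V → ℝ := fun x => if ρ x ≤ R then max (g x - k) 0 else 0 with hf
  set L : ℝ := 1 / (R - R') ^ 2 with hL
  have hL0 : 0 ≤ L := by positivity
  have hf0 : ∀ x, 0 ≤ f x := fun x => by rw [hf]; dsimp only; split_ifs <;> simp
  have hw1 : ∀ x ∈ K, max (g x - k) 0 ≤ 1 := fun x hx =>
    max_le (by linarith [hg x hx]) zero_le_one
  have hterm : ∀ x ∈ K, ∀ y ∈ K,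
      a x y * ((linearCutoff R' R (ρ x) - linearCutoff R' R (ρ y)) ^ 2 *
        (max (g x - k) 0 * max (g y - k) 0)) ≤ L * (a x y * f x) + L * (a y x * f y) := by
    intro x hx y hy
    rw [hK.symm y x, ← mul_add, ← mul_add, mul_left_comm L]
    by_cases ha : a x y = 0
    · simp [ha]
    refine mul_le_mul_of_nonneg_left ?_ (hK.nonneg x y)
    have hl := linearCutoff_sub_sq_le hR (hK.lip x y ha)
    have hwx : 0 ≤ max (g x - k) 0 := le_max_right _ _
    have hwy : 0 ≤ max (g y - k) 0 := le_max_right _ _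
    by_cases h1 : ρ x ≤ R
    · have e1 : f x = max (g x - k) 0 := if_pos h1
      refine mul_le_mul hl ?_ (mul_nonneg hwx hwy) hL0
      rw [e1]
      linarith [mul_le_of_le_one_right hwx (hw1 y hy), hf0 y]
    · by_cases h2 : ρ y ≤ R
      · have e1 : f y = max (g y - k) 0 := if_pos h2
        refine mul_le_mul hl ?_ (mul_nonneg hwx hwy) hL0
        rw [e1]
        linarith [mul_le_of_le_one_left hwy (hw1 x hx), hf0 x]
      · rw [linearCutoff_eq_zero hR (not_le.1 h1).le, linearCutoff_eq_zero hR (not_le.1 h2).le]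
        simpa using mul_nonneg hL0 (add_nonneg (hf0 x) (hf0 y))
  calc _ ≤ ∑ x ∈ K, ∑ y ∈ K, (L * (a x y * f x) + L * (a y x * f y)) :=
        Finset.sum_le_sum fun x hx => Finset.sum_le_sum fun y hy => hterm x hx y hy
    _ = 2 * L * ∑ x ∈ K, f x * ∑ y ∈ K, a x y := by
        simp only [Finset.sum_add_distrib]
        rw [Finset.sum_comm (f := fun x y => L * (a y x * f y)), ← two_mul, mul_assoc,
          Finset.mul_sum (s := K) (f := fun x => f x * _)]
        congr 1
        refine Finset.sum_congr rfl fun x _ => ?_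
        rw [Finset.mul_sum, Finset.mul_sum]
        exact Finset.sum_congr rfl fun y _ => by ring
    _ ≤ 2 * L * (M * (∑ x ∈ K, f x ^ P * m x) ^ (1 / P)) :=
        mul_le_mul_of_nonneg_left (hK.flux f hf0) (by positivity)
    _ = _ := by
        rw [hf, sum_indicator_posPart P R k hP, excessNorm, hL]; ring

/-- A truncation w with values in [0, 1] satisfies w² ≤ w, and Hölder against the finite mass passes
to the L^P norm. Hence both error terms of the energy inequality are linear in the same excess norm.
-/
theorem IsDeGiorgiKernel.sum_cutoff_sq_le (hK : IsDeGiorgiKernel K a m ρ P s M n) (hP : 1 ≤ P)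
    {R' R k : ℝ} (hR : R' < R) (hk : 0 ≤ k) {g : V → ℝ} (hg : ∀ x ∈ K, g x ≤ 1) :
    ∑ x ∈ K, linearCutoff R' R (ρ x) ^ 2 * m x * max (g x - k) 0 ^ 2 ≤
      M * excessNorm K m ρ P R k g := by
  have hP0 : 0 < P := by linarith
  set f : V → ℝ := fun x => if ρ x ≤ R then max (g x - k) 0 else 0 with hf
  have hf0 : ∀ x, 0 ≤ f x := fun x => by rw [hf]; dsimp only; split_ifs <;> simp
  have h1 : ∀ x ∈ K, linearCutoff R' R (ρ x) ^ 2 * m x * max (g x - k) 0 ^ 2 ≤ m x * f x := by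
    intro x hx
    by_cases h : R < ρ x
    · rw [linearCutoff_eq_zero hR h.le]
      simpa using mul_nonneg (hK.m_pos x).le (hf0 x)
    · have e1 : f x = max (g x - k) 0 := if_pos (not_lt.1 h)
      have hw0 : 0 ≤ max (g x - k) 0 := le_max_right _ _
      have hw1 : max (g x - k) 0 ≤ 1 := max_le (by linarith [hg x hx]) zero_le_one
      have hη := linearCutoff_le_one R' R (ρ x)
      have hη0 := linearCutoff_nonneg R' R (ρ x)
      rw [e1]
      calc linearCutoff R' R (ρ x) ^ 2 * m x * max (g x - k) 0 ^ 2
          ≤ 1 * m x * (max (g x - k) 0) := by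
            have := (hK.m_pos x).le
            gcongr
            · exact pow_le_one₀ hη0 hη
            · nlinarith
        _ = _ := by ring
  have h2 := Real.inner_le_weight_mul_Lp_of_nonneg K hP m f (fun x => (hK.m_pos x).le) hf0
  have hm0 : 0 ≤ ∑ x ∈ K, m x := Finset.sum_nonneg fun x _ => (hK.m_pos x).le
  have hP1 : P⁻¹ ≤ 1 := inv_le_one_of_one_le₀ hP
  have h3 : (∑ x ∈ K, m x) ^ (1 - P⁻¹) ≤ M := by
    calc (∑ x ∈ K, m x) ^ (1 - P⁻¹) ≤ M ^ (1 - P⁻¹) :=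
          Real.rpow_le_rpow hm0 hK.mass (by linarith)
      _ ≤ M ^ (1 : ℝ) :=
          Real.rpow_le_rpow_of_exponent_le hK.one_le (by linarith [inv_pos.2 hP0])
      _ = M := Real.rpow_one M
  have h4 : (∑ x ∈ K, m x * f x ^ P) ^ P⁻¹ = excessNorm K m ρ P R k g := by
    rw [excessNorm, ← sum_indicator_posPart P R k hP, one_div]
    congr 1
    exact Finset.sum_congr rfl fun x _ => mul_comm _ _
  refine (Finset.sum_le_sum h1).trans (h2.trans ?_)
  rw [h4]
  exact mul_le_mul_of_nonneg_right h3 (excessNorm_nonneg hK.m_pos _ _ _ _)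

theorem hasDerivWithinAt_sum_cutoff_sq {R' R k : ℝ} (hR : R' < R) {I : Set ℝ} {g g' : ℝ → V → ℝ}
    (hsub : IsSubsolutionOn K a m ρ R I g g') {t : ℝ} (ht : t ∈ I) :
    HasDerivWithinAt
      (fun t => ∑ x ∈ K, linearCutoff R' R (ρ x) ^ 2 * m x * max (g t x - k) 0 ^ 2)
      (∑ x ∈ K, linearCutoff R' R (ρ x) ^ 2 * m x * (2 * max (g t x - k) 0 * g' t x)) I t := by
  refine HasDerivWithinAt.fun_sum fun x hx => ?_
  by_cases h : R < ρ x
  · rw [linearCutoff_eq_zero hR h.le]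
    simpa using hasDerivWithinAt_const t I (0 : ℝ)
  · refine HasDerivWithinAt.const_mul _ ?_
    exact (hasDerivAt_max_zero_sq (g t x - k)).comp_hasDerivWithinAt t
      ((hsub.deriv t ht x hx (not_lt.1 h)).sub_const k)

theorem IsDeGiorgiKernel.caccioppoli (hK : IsDeGiorgiKernel K a m ρ P s M n) (hP : 1 ≤ P)
    {R' R k : ℝ} (hR : R' < R) (hk : 0 ≤ k) {I : Set ℝ} {g g' : ℝ → V → ℝ}
    (hsub : IsSubsolutionOn K a m ρ R I g g') {t : ℝ} (ht : t ∈ I) (hg : ∀ x ∈ K, g t x ≤ 1) :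
    ∑ x ∈ K, linearCutoff R' R (ρ x) ^ 2 * m x * (2 * max (g t x - k) 0 * g' t x) +
        dirichletForm K a (fun x => linearCutoff R' R (ρ x) * max (g t x - k) 0) ≤
      2 * M / (R - R') ^ 2 * excessNorm K m ρ P R k (g t) := by
  have h1 := sum_sq_mul_posPart_mul_laplacian_le K hK.symm hK.nonneg
    (fun x => linearCutoff R' R (ρ x)) (g t) k
  have h2 := hK.cross_term_le hP hR hk hg
  have h3 : ∑ x ∈ K, linearCutoff R' R (ρ x) ^ 2 * m x * (2 * max (g t x - k) 0 * g' t x) ≤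
      ∑ x ∈ K, 2 * linearCutoff R' R (ρ x) ^ 2 * max (g t x - k) 0 *
        ∑ y ∈ K, a x y * (g t y - g t x) := by
    refine Finset.sum_le_sum fun x hx => ?_
    by_cases h : R < ρ x
    · rw [linearCutoff_eq_zero hR h.le]; simp
    · have := mul_le_mul_of_nonneg_left (hsub.le t ht x hx (not_lt.1 h))
        (mul_nonneg (mul_nonneg zero_le_two (sq_nonneg (linearCutoff R' R (ρ x))))
          (le_max_right (g t x - k) 0))
      linarith
  linarith

/-- This is the nonlinear gain. Let e = 1/P - 1/s and let h be the cut-off truncation at level k.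
Where g ≥ k' and the cutoff is 1, h ≥ k' - k, so as in Chebyshev's inequality g - k' ≤ (k' -
k)^(-(1+2e)) (h²)^(1+e). Hölder then interpolates between the L¹ norm of h², controlled by `Z`, and
its L^s norm, controlled by the Sobolev inequality; P < s leaves the positive power e of `Z`. -/
theorem IsDeGiorgiKernel.excessNorm_le (hK : IsDeGiorgiKernel K a m ρ P s M n) (hP : 1 ≤ P)
    (hs : P < s) {R' R k k' Z : ℝ} (hR : R' < R) (hRn : R ≤ 3 * n / 8) (hk : k < k') {g : V → ℝ}
    (hZ : ∑ x ∈ K, linearCutoff R' R (ρ x) ^ 2 * m x * max (g x - k) 0 ^ 2 ≤ Z) :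
    excessNorm K m ρ P R' k' g ≤ (k' - k) ^ (-(1 + 2 * (1 / P - 1 / s))) * Z ^ (1 / P - 1 / s) *
      (M * n ^ 2) * dirichletForm K a (fun x => linearCutoff R' R (ρ x) * max (g x - k) 0) := by
  have hP0 : 0 < P := by linarith
  have hs0 : 0 < s := by linarith
  set e : ℝ := 1 / P - 1 / s with he
  have he0 : 0 < e := sub_pos.2 (one_div_lt_one_div_of_lt hP0 hs)
  set δ : ℝ := k' - k with hδ
  have hδ0 : 0 < δ := sub_pos.2 hk
  set h : V → ℝ := fun x => linearCutoff R' R (ρ x) * max (g x - k) 0 with hh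
  have hh0 : ∀ x, 0 ≤ h x := fun x => mul_nonneg (linearCutoff_nonneg _ _ _) (le_max_right _ _)
  have hsob := hK.sobolev h hh0 fun x hx => by
    rw [hh]; dsimp only; rw [linearCutoff_eq_zero hR (hRn.trans hx.le), zero_mul]
  have hm : ∀ x, 0 ≤ m x := fun x => (hK.m_pos x).le
  have hpt : ∀ x, ρ x ≤ R' →
      max (g x - k') 0 ≤ δ ^ (-(1 + 2 * e)) * (h x ^ 2) ^ (1 + e) := by
    intro x hx
    have e1 : h x = max (g x - k) 0 := by
      rw [hh]; dsimp only; rw [linearCutoff_eq_one hR hx, one_mul]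
    rcases le_total (g x) k' with h1 | h1
    · rw [max_eq_right (by linarith)]
      positivity
    · have h2 : h x = g x - k := by rw [e1]; exact max_eq_left (by linarith)
      have h3 : δ ≤ h x := by rw [h2, hδ]; linarith
      have h4 : 0 < h x := hδ0.trans_le h3
      rw [max_eq_left (by linarith)]
      calc g x - k' ≤ h x := by rw [h2]; linarith
        _ = h x ^ (-(1 + 2 * e)) * (h x ^ 2) ^ (1 + e) := by
            rw [← Real.rpow_natCast, ← Real.rpow_mul h4.le, ← Real.rpow_add h4]
            conv_lhs => rw [← Real.rpow_one (h x)]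
            congr 1
            push_cast; ring
        _ ≤ δ ^ (-(1 + 2 * e)) * (h x ^ 2) ^ (1 + e) := by
            refine mul_le_mul_of_nonneg_right ?_ (by positivity)
            exact Real.rpow_le_rpow_of_nonpos hδ0 h3 (by linarith)
  set c : ℝ := δ ^ (-(1 + 2 * e)) with hc
  have hc0 : 0 < c := Real.rpow_pos_of_pos hδ0 _
  have hsum : ∑ x ∈ K with ρ x ≤ R', max (g x - k') 0 ^ P * m x ≤
      c ^ P * ∑ x ∈ K, (h x ^ 2 * m x) ^ (e * P) * ((h x ^ 2) ^ s * m x) ^ (1 - e * P) := by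
    rw [Finset.mul_sum]
    refine (Finset.sum_le_sum fun x hx => ?_).trans
      (Finset.sum_le_sum_of_subset_of_nonneg (Finset.filter_subset _ _) fun x _ _ => ?_)
    · have h1 := Real.rpow_le_rpow (le_max_right _ _) (hpt x (Finset.mem_filter.1 hx).2) hP0.le
      rw [Real.mul_rpow hc0.le (by positivity)] at h1
      have h2 := mul_le_mul_of_nonneg_right h1 (hm x)
      refine h2.trans_eq ?_
      rw [mul_assoc]
      congr 1
      rw [Real.mul_rpow (sq_nonneg _) (hm x), Real.mul_rpow (by positivity) (hm x),
        mul_mul_mul_comm, ← Real.rpow_add (hK.m_pos x), ← Real.rpow_mul (sq_nonneg _),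
        ← Real.rpow_mul (sq_nonneg _), add_sub_cancel, Real.rpow_one]
      congr 1
      have hes : e * P * s = s - P := by rw [he]; field_simp
      have h3 : e * P + s * (1 - e * P) = (1 + e) * P := by linear_combination -hes
      rcases (sq_nonneg (h x)).eq_or_lt with h0 | h0
      · rw [← h0, Real.zero_rpow (by positivity), Real.zero_rpow (by positivity), zero_mul]
      · rw [← Real.rpow_add h0, h3]
    · exact mul_nonneg (by positivity) (mul_nonneg (Real.rpow_nonneg (mul_nonneg (sq_nonneg _)
        (hm x)) _) (Real.rpow_nonneg (mul_nonneg (by positivity) (hm x)) _))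
  have heP : e * P = 1 - P / s := by rw [he]; field_simp
  have heP1 : e * P ≤ 1 := by rw [heP]; linarith [div_pos hP0 hs0]
  have hhold := sum_rpow_mul_rpow_one_sub_le K (a := e * P) (by positivity) heP1
    (f := fun x => h x ^ 2 * m x) (g := fun x => (h x ^ 2) ^ s * m x)
    (fun x _ => mul_nonneg (sq_nonneg _) (hm x)) (fun x _ => mul_nonneg (by positivity) (hm x))
  have hZ' : ∑ x ∈ K, h x ^ 2 * m x ≤ Z := by
    refine le_trans (le_of_eq (Finset.sum_congr rfl fun x _ => ?_)) hZ
    rw [hh]; ring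
  have hX0 : 0 ≤ ∑ x ∈ K, h x ^ 2 * m x :=
    Finset.sum_nonneg fun x _ => mul_nonneg (sq_nonneg _) (hm x)
  have hY0 : 0 ≤ ∑ x ∈ K, (h x ^ 2) ^ s * m x :=
    Finset.sum_nonneg fun x _ => mul_nonneg (by positivity) (hm x)
  have hX1 : e * P * (1 / P) = e := by field_simp
  have hY1 : (1 - e * P) * (1 / P) = 1 / s := by rw [heP]; field_simp; ring
  calc excessNorm K m ρ P R' k' g
      ≤ (c ^ P * ((∑ x ∈ K, h x ^ 2 * m x) ^ (e * P) *
          (∑ x ∈ K, (h x ^ 2) ^ s * m x) ^ (1 - e * P))) ^ (1 / P) := by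
        refine Real.rpow_le_rpow (Finset.sum_nonneg fun x _ =>
          mul_nonneg (Real.rpow_nonneg (le_max_right _ _) _) (hm x)) ?_ (by positivity)
        exact hsum.trans (mul_le_mul_of_nonneg_left hhold (by positivity))
    _ = c * (∑ x ∈ K, h x ^ 2 * m x) ^ e * (∑ x ∈ K, (h x ^ 2) ^ s * m x) ^ (1 / s) := by
        rw [Real.mul_rpow (by positivity) (by positivity),
          Real.mul_rpow (by positivity) (by positivity), ← Real.rpow_mul hc0.le,
          ← Real.rpow_mul hX0, ← Real.rpow_mul hY0, mul_one_div_cancel hP0.ne', Real.rpow_one,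
          hX1, hY1, mul_assoc]
    _ ≤ c * Z ^ e * (M * n ^ 2 * dirichletForm K a h) := by
        have := hX0.trans hZ'
        gcongr
    _ = _ := by ring

/-- One step of De Giorgi's iteration. -/
theorem IsDeGiorgiKernel.iteration_step (hK : IsDeGiorgiKernel K a m ρ P s M n) (hP : 1 ≤ P)
    (hs : P < s) {R' R k k' σ σ' t₀ : ℝ} (hR : R' < R) (hRn : R ≤ 3 * n / 8) (hk0 : 0 ≤ k)
    (hk : k < k') (hσ : σ < σ') (hσ' : σ' ≤ t₀) {g g' : ℝ → V → ℝ}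
    (hsub : IsSubsolutionOn K a m ρ R (Set.Icc σ t₀) g g')
    (hg : ∀ t ∈ Set.Icc σ t₀, ∀ x ∈ K, g t x ≤ 1) {Z : ℝ}
    (hZ : ((t₀ - σ) * (2 * M / (R - R') ^ 2) + M) / (σ' - σ) *
      ∫ t in σ..t₀, excessNorm K m ρ P R k (g t) ≤ Z) :
    (∀ t ∈ Set.Icc σ' t₀,
      ∑ x ∈ K, linearCutoff R' R (ρ x) ^ 2 * m x * max (g t x - k) 0 ^ 2 ≤ Z) ∧
    ∫ t in σ'..t₀, excessNorm K m ρ P R' k' (g t) ≤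
      (k' - k) ^ (-(1 + 2 * (1 / P - 1 / s))) * Z ^ (1 / P - 1 / s) * (M * n ^ 2) * Z := by
  have hM0 : 0 ≤ M := zero_le_one.trans hK.one_le
  have hEc : ContinuousOn (fun t => dirichletForm K a
      (fun x => linearCutoff R' R (ρ x) * max (g t x - k) 0)) (Set.Icc σ t₀) := by
    have h1 : ∀ x ∈ K, ContinuousOn (fun t => linearCutoff R' R (ρ x) * max (g t x - k) 0)
        (Set.Icc σ t₀) := fun x hx =>
      continuousOn_const.mul
        (ContinuousOn.sup ((hsub.cont x hx).sub continuousOn_const) continuousOn_const)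
    exact continuousOn_finsetSum _ fun x hx => continuousOn_finsetSum _ fun y hy =>
      continuousOn_const.mul (((h1 x hx).sub (h1 y hy)).pow 2)
  obtain ⟨h1, h2⟩ := energy_time_integration hσ hσ'
    (fun t ht => hasDerivWithinAt_sum_cutoff_sq (k := k) hR hsub ht) hEc
    (continuousOn_excessNorm hP hsub.cont R k)
    (fun t ht => hK.caccioppoli hP hR hk0 hsub ht (hg t ht))
    (fun t ht => hK.sum_cutoff_sq_le hP hR hk0 (hg t ht))
    (fun t _ => Finset.sum_nonneg fun x _ => mul_nonneg (mul_nonneg (sq_nonneg _)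
      (hK.m_pos x).le) (sq_nonneg _))
    (fun t _ => dirichletForm_nonneg hK.nonneg _)
    (fun t _ => excessNorm_nonneg hK.m_pos _ _ _ _) (by positivity) hM0
  have h1' := fun t ht => (h1 t ht).trans hZ
  refine ⟨h1', ?_⟩
  have hsubset : Set.Icc σ' t₀ ⊆ Set.Icc σ t₀ := Set.Icc_subset_Icc hσ.le le_rfl
  set c : ℝ := (k' - k) ^ (-(1 + 2 * (1 / P - 1 / s))) * Z ^ (1 / P - 1 / s) * (M * n ^ 2) with hc
  have hZ0 : 0 ≤ Z := by
    refine le_trans ?_ (h1' t₀ ⟨hσ', le_rfl⟩)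
    exact Finset.sum_nonneg fun x _ => mul_nonneg (mul_nonneg (sq_nonneg _)
      (hK.m_pos x).le) (sq_nonneg _)
  have hc0 : 0 ≤ c := by
    have : 0 < k' - k := sub_pos.2 hk
    positivity
  calc ∫ t in σ'..t₀, excessNorm K m ρ P R' k' (g t)
      ≤ ∫ t in σ'..t₀, c * dirichletForm K a
          (fun x => linearCutoff R' R (ρ x) * max (g t x - k) 0) := by
        refine intervalIntegral.integral_mono_on hσ' ?_ ?_ fun t ht =>
          hK.excessNorm_le hP hs hR hRn hk (h1' t ht)
        · refine ContinuousOn.intervalIntegrable ?_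
          rw [Set.uIcc_of_le hσ']
          exact (continuousOn_excessNorm hP hsub.cont R' k').mono hsubset
        · refine ContinuousOn.intervalIntegrable ?_
          rw [Set.uIcc_of_le hσ']
          exact continuousOn_const.mul (hEc.mono hsubset)
    _ = c * ∫ t in σ'..t₀, dirichletForm K a
          (fun x => linearCutoff R' R (ρ x) * max (g t x - k) 0) :=
        intervalIntegral.integral_const_mul _ _
    _ ≤ c * Z := mul_le_mul_of_nonneg_left (h2.trans hZ) hc0
end

/-- The local maximum principle: a subsolution whose positive part is small in mean on the
larger cylinder is at most `1 / 2` on the smaller one. -/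
theorem exists_local_max_threshold {P s M : ℝ} (hP : 1 ≤ P) (hs : P < s) (hM : 1 ≤ M) :
    ∃ δ > 0, ∀ (V : Type) (K : Finset V) (a : V → V → ℝ) (m ρ : V → ℝ) (n t₀ : ℝ), 0 < n →
      IsDeGiorgiKernel K a m ρ P s M n → ∀ g g' : ℝ → V → ℝ,
      IsSubsolutionOn K a m ρ (3 * n / 8) (Set.Icc (t₀ - n ^ 2 / 8) t₀) g g' →
      (∀ t ∈ Set.Icc (t₀ - n ^ 2 / 8) t₀, ∀ x ∈ K, g t x ≤ 1) →
      ∫ t in (t₀ - n ^ 2 / 8)..t₀, excessNorm K m ρ P (3 * n / 8) 0 (g t) ≤ δ * n ^ 2 →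
      ∀ t ∈ Set.Icc (t₀ - n ^ 2 / 16) t₀, ∀ x ∈ K, ρ x ≤ n / 4 → g t x ≤ 1 / 2 := by
  have hP0 : 0 < P := by linarith
  have hM0 : 0 < M := by linarith
  set e : ℝ := 1 / P - 1 / s with he
  have he0 : 0 < e := sub_pos.2 (one_div_lt_one_div_of_lt hP0 hs)
  -- `D` and `b` are read off from one iteration step with Z = 2080 M 8^j Y_j and level gap
  -- 1/(4·2^j).
  obtain ⟨δ, hδ, hseq⟩ := exists_deGiorgi_threshold
    (D := 4 ^ (1 + 2 * e) * M * (2080 * M) ^ (1 + e)) (b := 2 ^ (1 + 2 * e) * 8 ^ (1 + e))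
    (κ := 1 + e) (by positivity) (by positivity) (by linarith)
  refine ⟨δ, hδ, ?_⟩
  intro V K a m ρ n t₀ hn hK g g' hsub hg hsmall
  have hn2 : 0 < n ^ 2 := by positivity
  set h : ℕ → ℝ := fun j => (1 / 2) ^ j with hh
  have hh0 : ∀ j, 0 < h j := fun j => by positivity
  have hh1 : ∀ j, h j ≤ 1 := fun j => pow_le_one₀ (by norm_num) (by norm_num)
  have hhs : ∀ j, h (j + 1) = h j / 2 := fun j => by simp only [hh, pow_succ]; ring
  -- Radii shrink from 3n/8 to n/4, initial times rise from t₀ - n²/8 to t₀ - n²/16 and levels rise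
  -- from 0 to 1/2, all at the rate 2^(-j).
  set R : ℕ → ℝ := fun j => n / 4 + n / 8 * h j with hR
  set σ : ℕ → ℝ := fun j => t₀ - n ^ 2 / 16 - n ^ 2 / 16 * h j with hσ
  set k : ℕ → ℝ := fun j => 1 / 2 * (1 - h j) with hk
  have hRlt : ∀ j, R (j + 1) < R j := fun j => by
    simp only [hR, hhs]; nlinarith [mul_pos hn (hh0 j)]
  have hRle : ∀ j, R j ≤ 3 * n / 8 := fun j => by
    simp only [hR]; nlinarith [hh1 j]
  have hσlt : ∀ j, σ j < σ (j + 1) := fun j => by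
    simp only [hσ, hhs]; nlinarith [mul_pos hn2 (hh0 j)]
  have hσle : ∀ j, σ (j + 1) ≤ t₀ := fun j => by
    simp only [hσ]; nlinarith [mul_pos hn2 (hh0 (j + 1))]
  have hσge : ∀ j, t₀ - n ^ 2 / 8 ≤ σ j := fun j => by
    simp only [hσ]; nlinarith [hh1 j]
  have hk0 : ∀ j, 0 ≤ k j := fun j => by simp only [hk]; linarith [hh1 j]
  have hklt : ∀ j, k j < k (j + 1) := fun j => by simp only [hk, hhs]; linarith [hh0 j]
  have hsubset : ∀ j, Set.Icc (σ j) t₀ ⊆ Set.Icc (t₀ - n ^ 2 / 8) t₀ := fun j =>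
    Set.Icc_subset_Icc (hσge j) le_rfl
  set X : ℕ → ℝ := fun j => ∫ t in (σ j)..t₀, excessNorm K m ρ P (R j) (k j) (g t) with hX
  set Y : ℕ → ℝ := fun j => X j / n ^ 2 with hY
  have hX0 : ∀ j, 0 ≤ X j := fun j =>
    intervalIntegral.integral_nonneg ((hσlt j).le.trans (hσle j))
      fun t _ => excessNorm_nonneg hK.m_pos _ _ _ _
  have hY0 : ∀ j, 0 ≤ Y j := fun j => div_nonneg (hX0 j) hn2.le
  have hstep : ∀ j, (∀ t ∈ Set.Icc (σ (j + 1)) t₀,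
      ∑ x ∈ K, linearCutoff (R (j + 1)) (R j) (ρ x) ^ 2 * m x * max (g t x - k j) 0 ^ 2 ≤
        2080 * M * 8 ^ j * Y j) ∧
      X (j + 1) ≤ (k (j + 1) - k j) ^ (-(1 + 2 * e)) * (2080 * M * 8 ^ j * Y j) ^ e *
        (M * n ^ 2) * (2080 * M * 8 ^ j * Y j) := by
    intro j
    have hsub' : IsSubsolutionOn K a m ρ (R j) (Set.Icc (σ j) t₀) g g' :=
      ⟨fun x hx => (hsub.mono (hsubset j)).cont x hx,
        fun t ht x hx hρ => (hsub.mono (hsubset j)).deriv t ht x hx (hρ.trans (hRle j)),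
        fun t ht x hx hρ => (hsub.mono (hsubset j)).le t ht x hx (hρ.trans (hRle j))⟩
    refine hK.iteration_step hP hs (hRlt j) (hRle j) (hk0 j) (hklt j) (hσlt j) (hσle j) hsub'
      (fun t ht => hg t (hsubset j ht)) ?_
    have e1 : R j - R (j + 1) = n / 16 * h j := by simp only [hR, hhs]; ring
    have e2 : σ (j + 1) - σ j = n ^ 2 / 32 * h j := by simp only [hσ, hhs]; ring
    have e3 : t₀ - σ j ≤ n ^ 2 / 8 := by linarith [hσge j]
    have e4 : h j * 2 ^ j = 1 := by rw [hh, ← mul_pow]; norm_num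
    have e5 : 1 / h j = 2 ^ j := by rw [div_eq_iff (hh0 j).ne', mul_comm, e4]
    have e6 : (8 : ℝ) ^ j = (2 ^ j) ^ 3 := by rw [← pow_mul, mul_comm, pow_mul]; norm_num
    rw [e1, e2]
    -- Here 64 = (1/8)·2·16², and 1 is added for the second `M`. Division by the time gap n² h/32
    -- gives 65·32 = 2080 and the total power h^(-3) = 8^j.
    have h1 : (t₀ - σ j) * (2 * M / (n / 16 * h j) ^ 2) + M ≤ 65 * M / h j ^ 2 := by
      have h2 : (t₀ - σ j) * (2 * M / (n / 16 * h j) ^ 2) ≤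
          n ^ 2 / 8 * (2 * M / (n / 16 * h j) ^ 2) :=
        mul_le_mul_of_nonneg_right e3 (by positivity)
      have h3 : n ^ 2 / 8 * (2 * M / (n / 16 * h j) ^ 2) = 64 * M / h j ^ 2 := by
        field_simp; norm_num
      have h4 : M ≤ M / h j ^ 2 := by
        rw [le_div_iff₀ (pow_pos (hh0 j) 2)]
        exact mul_le_of_le_one_right hM0.le (pow_le_one₀ (hh0 j).le (hh1 j))
      have h5 : 65 * M / h j ^ 2 = 64 * M / h j ^ 2 + M / h j ^ 2 := by ring
      linarith
    have hXj : 0 ≤ X j := hX0 j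
    calc ((t₀ - σ j) * (2 * M / (n / 16 * h j) ^ 2) + M) / (n ^ 2 / 32 * h j) * X j
        ≤ 65 * M / h j ^ 2 / (n ^ 2 / 32 * h j) * X j := by
          have := hh0 j
          gcongr
      _ = 2080 * M * (1 / h j) ^ 3 * (X j / n ^ 2) := by
          have := (hh0 j).ne'
          field_simp; ring
      _ = 2080 * M * 8 ^ j * Y j := by rw [e5, ← e6]
  have hrec : ∀ j, Y (j + 1) ≤ 4 ^ (1 + 2 * e) * M * (2080 * M) ^ (1 + e) *
      (2 ^ (1 + 2 * e) * 8 ^ (1 + e)) ^ j * Y j ^ (1 + e) := by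
    intro j
    have h1 := (hstep j).2
    have hkk : k (j + 1) - k j = (4 * 2 ^ j)⁻¹ := by
      simp only [hk, hhs]
      have e4 : h j * 2 ^ j = 1 := by rw [hh, ← mul_pow]; norm_num
      rw [eq_inv_of_mul_eq_one_left e4, mul_inv]
      ring
    have hkp : (k (j + 1) - k j) ^ (-(1 + 2 * e)) = 4 ^ (1 + 2 * e) * (2 ^ (1 + 2 * e)) ^ j := by
      rw [hkk, Real.inv_rpow (by positivity), ← Real.rpow_neg (by positivity), neg_neg,
        Real.mul_rpow (by positivity) (by positivity), ← Real.rpow_natCast, ← Real.rpow_natCast,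
        ← Real.rpow_mul (by positivity), ← Real.rpow_mul (by positivity), mul_comm (j : ℝ)]
    have hZ0 : 0 ≤ 2080 * M * 8 ^ j * Y j := by have := hY0 j; positivity
    have hZp : (2080 * M * 8 ^ j * Y j) ^ e * (2080 * M * 8 ^ j * Y j) =
        (2080 * M) ^ (1 + e) * (8 ^ (1 + e)) ^ j * Y j ^ (1 + e) := by
      have h8 : ((8 : ℝ) ^ j) ^ (1 + e) = (8 ^ (1 + e)) ^ j := by
        rw [← Real.rpow_natCast, ← Real.rpow_natCast, ← Real.rpow_mul (by positivity),
          ← Real.rpow_mul (by positivity), mul_comm (j : ℝ)]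
      rw [← h8, ← Real.mul_rpow (by positivity) (by positivity),
        ← Real.mul_rpow (by positivity) (hY0 j), add_comm 1 e,
        Real.rpow_add_of_nonneg hZ0 he0.le zero_le_one, Real.rpow_one]
    rw [hY]
    dsimp only
    rw [div_le_iff₀ hn2]
    refine h1.trans_eq ?_
    rw [hkp, mul_pow]
    linear_combination (4 ^ (1 + 2 * e) * (2 ^ (1 + 2 * e)) ^ j * (M * n ^ 2)) * hZp
  have hYdecay := hseq Y hY0 (by
    have e1 : σ 0 = t₀ - n ^ 2 / 8 := by simp only [hσ, hh]; ring
    have e2 : R 0 = 3 * n / 8 := by simp only [hR, hh]; ring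
    have e3 : k 0 = 0 := by simp only [hk, hh]; ring
    rw [hY]
    dsimp only
    rw [div_le_iff₀ hn2, hX]
    beta_reduce
    rw [e1, e2, e3]
    exact hsmall) hrec
  intro t ht x hx hρ
  by_contra! hlt
  -- On a discrete space the weighted sum of squares controls each single term, so the estimate at
  -- fixed time is already pointwise. The factor 8^j·16^(-j) sends it to zero, which excludes a
  -- value above 1/2.
  have hlow : ∀ j : ℕ, m x * (g t x - 1 / 2) ^ 2 ≤ 2080 * M * δ * (1 / 2) ^ j := by
    intro j
    have htj : t ∈ Set.Icc (σ (j + 1)) t₀ := ⟨by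
      refine le_trans ?_ ht.1
      simp only [hσ]; nlinarith [mul_pos hn2 (hh0 (j + 1))], ht.2⟩
    have h1 := (hstep j).1 t htj
    have h2 : linearCutoff (R (j + 1)) (R j) (ρ x) = 1 := by
      refine linearCutoff_eq_one (hRlt j) (hρ.trans ?_)
      simp only [hR]; nlinarith [mul_pos hn (hh0 (j + 1))]
    have h3 := Finset.single_le_sum (f := fun x =>
      linearCutoff (R (j + 1)) (R j) (ρ x) ^ 2 * m x * max (g t x - k j) 0 ^ 2)
      (fun y _ => mul_nonneg (mul_nonneg (sq_nonneg _) (hK.m_pos y).le) (sq_nonneg _)) hx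
    rw [h2, one_pow, one_mul] at h3
    have hkj : k j ≤ 1 / 2 := by simp only [hk]; linarith [hh0 j]
    have h4 : g t x - 1 / 2 ≤ max (g t x - k j) 0 := le_max_of_le_left (by linarith)
    calc m x * (g t x - 1 / 2) ^ 2 ≤ m x * max (g t x - k j) 0 ^ 2 :=
          mul_le_mul_of_nonneg_left (pow_le_pow_left₀ (by linarith) h4 2) (hK.m_pos x).le
      _ ≤ 2080 * M * 8 ^ j * Y j := h3.trans h1
      _ ≤ 2080 * M * 8 ^ j * (δ * (1 / 16) ^ j) :=
          mul_le_mul_of_nonneg_left (hYdecay j) (by positivity)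
      _ = 2080 * M * δ * (8 ^ j * (1 / 16) ^ j) := by ring
      _ = 2080 * M * δ * (1 / 2) ^ j := by rw [← mul_pow]; norm_num
  have hlim : Filter.Tendsto (fun j : ℕ => 2080 * M * δ * (1 / 2 : ℝ) ^ j) Filter.atTop
      (nhds (2080 * M * δ * 0)) :=
    (tendsto_pow_atTop_nhds_zero_of_lt_one (by norm_num) (by norm_num)).const_mul _
  have h0 := ge_of_tendsto' hlim hlow
  have hpos : 0 < m x * (g t x - 1 / 2) ^ 2 :=
    mul_pos (hK.m_pos x) (pow_pos (by linarith) 2)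
  linarith

/-! ### Lattice balls and the conductance kernel -/

theorem mem_latticeBall_iff_sum {d : ℕ} {x y : Fin d → ℤ} {r : ℝ} :
    y ∈ latticeBall x r ↔ ((∑ i, |x i - y i| : ℤ) : ℝ) ≤ r := by
  rw [mem_latticeBall, ← latticeGraph_dist]
  simp

theorem card_latticeBall_le {d : ℕ} (x : Fin d → ℤ) {r : ℝ} (hr : 1 ≤ r) :
    ((latticeBall x r).card : ℝ) ≤ (3 * r) ^ d := by
  set k := ⌊r⌋ with hk
  have hk0 : 0 ≤ k := Int.floor_nonneg.2 (by linarith)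
  have hsub : latticeBall x r ⊆ Finset.Icc (fun i => x i - k) (fun i => x i + k) := by
    intro y hy
    rw [mem_latticeBall_iff_sum] at hy
    have h1 : ∑ i, |x i - y i| ≤ k := Int.le_floor.2 hy
    have h2 : ∀ i, |x i - y i| ≤ k := fun i =>
      (Finset.single_le_sum (f := fun i => |x i - y i|)
        (fun i _ => abs_nonneg _) (Finset.mem_univ i)).trans h1
    rw [Finset.mem_Icc]
    exact ⟨fun i => by have := abs_le.1 (h2 i); dsimp only; omega,
      fun i => by have := abs_le.1 (h2 i); dsimp only; omega⟩
  have hcard : (Finset.Icc (fun i => x i - k) (fun i => x i + k)).card = (2 * k + 1).toNat ^ d := by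
    rw [Pi.card_Icc, Finset.prod_congr rfl (g := fun _ => (2 * k + 1).toNat) fun i _ => by
      rw [Int.card_Icc]; congr 1; ring]
    simp
  calc ((latticeBall x r).card : ℝ) ≤ ((2 * k + 1).toNat ^ d : ℕ) := by
        rw [← hcard]; exact_mod_cast Finset.card_le_card hsub
    _ = ((2 * k + 1 : ℤ) : ℝ) ^ d := by
        rw [Nat.cast_pow, ← Int.cast_natCast, Int.toNat_of_nonneg (by omega)]
    _ ≤ (3 * r) ^ d := by
        have h1 : (k : ℝ) ≤ r := Int.floor_le r
        have h2 : (0 : ℝ) ≤ k := by exact_mod_cast hk0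
        push_cast
        gcongr
        linarith

/-- The ball contains the cube with centre `x` and half side ⌊r/d⌋. -/
theorem le_card_latticeBall {d : ℕ} (hd : 0 < d) (x : Fin d → ℤ) {r : ℝ} (hr : 0 ≤ r) :
    (r / d) ^ d ≤ (latticeBall x r).card := by
  have hd' : (0 : ℝ) < d := by exact_mod_cast hd
  set k := ⌊r / d⌋ with hk
  have hk0 : 0 ≤ k := Int.floor_nonneg.2 (by positivity)
  have hsub : Finset.Icc (fun i => x i - k) (fun i => x i + k) ⊆ latticeBall x r := by
    intro y hy
    rw [Finset.mem_Icc] at hy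
    rw [mem_latticeBall_iff_sum]
    have h1 : ∀ i, |x i - y i| ≤ k := fun i => by
      have h1 := hy.1 i; have h2 := hy.2 i
      dsimp only at h1 h2
      rw [abs_le]; omega
    have h2 : ∑ i, |x i - y i| ≤ d * k := by
      refine (Finset.sum_le_sum fun i _ => h1 i).trans_eq ?_
      simp
    calc ((∑ i, |x i - y i| : ℤ) : ℝ) ≤ ((d * k : ℤ) : ℝ) := by exact_mod_cast h2
      _ = d * (k : ℝ) := by push_cast; ring
      _ ≤ d * (r / d) := mul_le_mul_of_nonneg_left (Int.floor_le _) hd'.le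
      _ = r := by field_simp
  have hcard : (Finset.Icc (fun i => x i - k) (fun i => x i + k)).card = (2 * k + 1).toNat ^ d := by
    rw [Pi.card_Icc, Finset.prod_congr rfl (g := fun _ => (2 * k + 1).toNat) fun i _ => by
      rw [Int.card_Icc]; congr 1; ring]
    simp
  calc (r / d) ^ d ≤ ((2 * k + 1 : ℤ) : ℝ) ^ d := by
        have h1 : r / d < k + 1 := Int.lt_floor_add_one _
        have h2 : (0 : ℝ) ≤ k := by exact_mod_cast hk0
        push_cast
        gcongr
        linarith
    _ = ((2 * k + 1).toNat ^ d : ℕ) := by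
        rw [Nat.cast_pow, ← Int.cast_natCast, Int.toNat_of_nonneg (by omega)]
    _ ≤ (latticeBall x r).card := by
        rw [← hcard]; exact_mod_cast Finset.card_le_card hsub

/-- Volume doubling for lattice balls. -/
theorem card_latticeBall_le_mul {d : ℕ} (hd : 0 < d) (x y : Fin d → ℤ) {n : ℝ} (hn : 1 ≤ n) :
    ((latticeBall x n).card : ℝ) ≤ (12 * d) ^ d * (latticeBall y (n / 4)).card := by
  have hd' : (0 : ℝ) < d := by exact_mod_cast hd
  calc ((latticeBall x n).card : ℝ) ≤ (3 * n) ^ d := card_latticeBall_le x hn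
    _ = (12 * d) ^ d * (n / 4 / d) ^ d := by rw [← mul_pow]; congr 1; field_simp; norm_num
    _ ≤ _ := mul_le_mul_of_nonneg_left (le_card_latticeBall hd y (by positivity)) (by positivity)

theorem mem_latticeBall_self {d : ℕ} (x : Fin d → ℤ) {r : ℝ} (hr : 0 ≤ r) :
    x ∈ latticeBall x r := by
  rw [mem_latticeBall_iff_sum]; simpa using hr

theorem latticeBall_mono {d : ℕ} (x : Fin d → ℤ) {r r' : ℝ} (h : r ≤ r') :
    latticeBall x r ⊆ latticeBall x r' := fun y hy => by
  rw [mem_latticeBall] at hy ⊢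
  exact hy.trans h

/-- The distance to a base point changes by at most one along an edge. -/
theorem abs_dist_sub_dist_le_one {d : ℕ} (x₀ : Fin d → ℤ) {x y : Fin d → ℤ}
    (h : (latticeGraph d).Adj x y) :
    |((latticeGraph d).dist x₀ x : ℝ) - (latticeGraph d).dist x₀ y| ≤ 1 := by
  have h1 : ∑ i, |x i - y i| = 1 := h
  have h2 : |((latticeGraph d).dist x₀ x : ℤ) - (latticeGraph d).dist x₀ y| ≤ 1 := by
    rw [latticeGraph_dist, latticeGraph_dist, ← Finset.sum_sub_distrib, ← h1]
    refine (Finset.abs_sum_le_sum_abs _ _).trans (Finset.sum_le_sum fun i _ => ?_)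
    refine (abs_abs_sub_abs_le_abs_sub _ _).trans_eq ?_
    rw [sub_sub_sub_cancel_left, abs_sub_comm]
  exact_mod_cast h2

theorem mem_latticeBall_of_adj {d : ℕ} {x₀ x y : Fin d → ℤ} {r r' : ℝ}
    (hx : x ∈ latticeBall x₀ r) (h : (latticeGraph d).Adj x y) (hr : r + 1 ≤ r') :
    y ∈ latticeBall x₀ r' := by
  rw [mem_latticeBall] at hx ⊢
  have := abs_le.1 (abs_dist_sub_dist_le_one x₀ h)
  linarith

open Classical in
/-- The conductances `c`, as a kernel on pairs of vertices which vanishes off the edges. -/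
noncomputable def latticeKernel {d : ℕ} (c : Sym2 (Fin d → ℤ) → ℝ) (x y : Fin d → ℤ) : ℝ :=
  if (latticeGraph d).Adj x y then c s(x, y) else 0

section
variable {d : ℕ} {c : Sym2 (Fin d → ℤ) → ℝ}

theorem latticeKernel_of_adj {x y : Fin d → ℤ} (h : (latticeGraph d).Adj x y) :
    latticeKernel c x y = c s(x, y) := if_pos h

theorem latticeKernel_of_not_adj {x y : Fin d → ℤ} (h : ¬ (latticeGraph d).Adj x y) :
    latticeKernel c x y = 0 := if_neg h

theorem latticeKernel_symm (x y : Fin d → ℤ) : latticeKernel c x y = latticeKernel c y x := by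
  by_cases h : (latticeGraph d).Adj x y
  · rw [latticeKernel_of_adj h, latticeKernel_of_adj h.symm, Sym2.eq_swap]
  · rw [latticeKernel_of_not_adj h, latticeKernel_of_not_adj fun h' => h h'.symm]

theorem latticeKernel_nonneg (hc : ∀ e ∈ (latticeGraph d).edgeSet, 0 < c e) (x y : Fin d → ℤ) :
    0 ≤ latticeKernel c x y := by
  by_cases h : (latticeGraph d).Adj x y
  · rw [latticeKernel_of_adj h]; exact (hc _ h).le
  · rw [latticeKernel_of_not_adj h]

theorem sum_latticeKernel_mul_eq (K : Finset (Fin d → ℤ)) (x : Fin d → ℤ)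
    (hx : (latticeGraph d).neighborFinset x ⊆ K) (φ : (Fin d → ℤ) → ℝ) :
    ∑ y ∈ K, latticeKernel c x y * φ y =
      ∑ y ∈ (latticeGraph d).neighborFinset x, c s(x, y) * φ y := by
  rw [← Finset.sum_subset hx fun y _ hy => by
    rw [latticeKernel_of_not_adj (by simpa using hy), zero_mul]]
  refine Finset.sum_congr rfl fun y hy => ?_
  rw [latticeKernel_of_adj (by simpa using hy)]

theorem sum_latticeKernel_le (hc : ∀ e ∈ (latticeGraph d).edgeSet, 0 < c e)
    (K : Finset (Fin d → ℤ)) (x : Fin d → ℤ) :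
    ∑ y ∈ K, latticeKernel c x y ≤ ∑ y ∈ (latticeGraph d).neighborFinset x, c s(x, y) := by
  classical
  have h := sum_latticeKernel_mul_eq (c := c) (K ∪ (latticeGraph d).neighborFinset x) x
    Finset.subset_union_right (fun _ => 1)
  simp only [mul_one] at h
  rw [← h]
  exact Finset.sum_le_sum_of_subset_of_nonneg Finset.subset_union_left
    fun y _ _ => latticeKernel_nonneg hc x y

end

/-! ### Poincaré and Sobolev inequalities in ℓ¹ on the lattice -/

/-- The `ℓ¹` norm of the gradient of `f` over the edges inside `K`, each counted twice. -/
noncomputable def gradientNorm {d : ℕ} (K : Finset (Fin d → ℤ)) (f : (Fin d → ℤ) → ℝ) : ℝ :=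
  ∑ x ∈ K, ∑ y ∈ K, latticeKernel (fun _ => 1) x y * |f x - f y|

theorem gradientNorm_term_nonneg {d : ℕ} (f : (Fin d → ℤ) → ℝ) (x y : Fin d → ℤ) :
    0 ≤ latticeKernel (fun _ => 1) x y * |f x - f y| := by
  refine mul_nonneg (latticeKernel_nonneg ?_ x y) (abs_nonneg _)
  intro e _
  exact one_pos

theorem gradientNorm_nonneg {d : ℕ} (K : Finset (Fin d → ℤ)) (f : (Fin d → ℤ) → ℝ) :
    0 ≤ gradientNorm K f :=
  Finset.sum_nonneg fun x _ => Finset.sum_nonneg fun y _ => gradientNorm_term_nonneg f x y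

theorem latticeGraph_adj_add_single {d : ℕ} (x : Fin d → ℤ) (i : Fin d) {s : ℤ} (hs : |s| = 1) :
    (latticeGraph d).Adj x (x + Pi.single i s) := by
  set z : Fin d → ℤ := x + Pi.single i s with hz
  have hzi : x i - z i = -s := by simp [hz]
  have hzj : ∀ j, j ≠ i → x j - z j = 0 := fun j hj => by simp [hz, hj]
  change ∑ j, |x j - z j| = 1
  rw [Finset.sum_eq_single i (fun j _ hj => by rw [hzj j hj, abs_zero]) (by simp), hzi, abs_neg, hs]

/-- The translation by `h` is broken into unit steps. Translations are injective, so one step uses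
each oriented edge at most once and costs at most one gradient norm. The box condition keeps the
path inside `K`, and it is inherited by the set A + e and the vector h - e in the induction. -/
theorem sum_abs_translate_sub_le {d : ℕ} (K : Finset (Fin d → ℤ)) (w : (Fin d → ℤ) → ℝ) (m : ℕ) :
    ∀ h : Fin d → ℤ, ∑ i, |h i| = m → ∀ A : Finset (Fin d → ℤ),
      (∀ x ∈ A, ∀ z : Fin d → ℤ, (∀ i, z i ∈ Set.uIcc (x i) (x i + h i)) → z ∈ K) →
      ∑ x ∈ A, |w (x + h) - w x| ≤ m * gradientNorm K w := by
  induction m with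
  | zero =>
    intro h hh A _
    have h0 : h = 0 := by
      funext i
      exact abs_eq_zero.1 ((Finset.sum_eq_zero_iff_of_nonneg
        (fun i _ => abs_nonneg (h i))).1 (by simpa using hh) i (Finset.mem_univ i))
    simp [h0]
  | succ m ih =>
    intro h hh A hA
    have hne : ∃ i, h i ≠ 0 := by
      by_contra hcon
      push Not at hcon
      have : ∑ i, |h i| = 0 := Finset.sum_eq_zero fun i _ => by simp [hcon i]
      push_cast at hh
      omega
    obtain ⟨i, hi⟩ := hne
    obtain ⟨s, hs1, hs2⟩ : ∃ s : ℤ, |s| = 1 ∧ ((s = 1 ∧ 1 ≤ h i) ∨ (s = -1 ∧ h i ≤ -1)) := by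
      rcases lt_or_gt_of_ne hi with h1 | h1
      · exact ⟨-1, by simp, Or.inr ⟨rfl, by omega⟩⟩
      · exact ⟨1, by simp, Or.inl ⟨rfl, by omega⟩⟩
    set e : Fin d → ℤ := Pi.single i s with he
    have hei : e i = s := by simp [he]
    have hej : ∀ j, j ≠ i → e j = 0 := fun j hj => by simp [he, hj]
    have hsum : ∑ j, |(h - e) j| = m := by
      have e1 := Finset.add_sum_erase Finset.univ (fun j => |(h - e) j|) (Finset.mem_univ i)
      have e2 := Finset.add_sum_erase Finset.univ (fun j => |h j|) (Finset.mem_univ i)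
      have e3 : ∑ j ∈ Finset.univ.erase i, |(h - e) j| = ∑ j ∈ Finset.univ.erase i, |h j| :=
        Finset.sum_congr rfl fun j hj => by
          rw [Pi.sub_apply, hej j (Finset.ne_of_mem_erase hj), sub_zero]
      simp only [Pi.sub_apply, hei] at e1 e3 ⊢
      have e4 : |h i - s| + 1 = |h i| := by
        rcases hs2 with ⟨rfl, h1⟩ | ⟨rfl, h1⟩
        · rw [abs_of_nonneg (by omega), abs_of_nonneg (by omega)]; ring
        · rw [abs_of_nonpos (by omega), abs_of_nonpos (by omega)]; ring
      push_cast at hh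
      omega
    have hstep := ih (h - e) hsum (A.map (addRightEmbedding e)) (by
      intro x' hx' z hz
      obtain ⟨x, hx, rfl⟩ := Finset.mem_map.1 hx'
      refine hA x hx z fun j => ?_
      have h1 := hz j
      simp only [addRightEmbedding_apply, Pi.add_apply, Pi.sub_apply, Set.mem_uIcc] at h1 ⊢
      by_cases hj : j = i
      · subst hj; rw [hei] at h1; omega
      · rw [hej j hj] at h1; omega)
    rw [Finset.sum_map] at hstep
    simp only [addRightEmbedding_apply] at hstep
    have hAK : A ⊆ K := fun x hx => hA x hx x fun j => Set.left_mem_uIcc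
    have hone : ∑ x ∈ A, |w (x + e) - w x| ≤ gradientNorm K w := by
      refine (Finset.sum_le_sum fun x hx => ?_).trans
        (Finset.sum_le_sum_of_subset_of_nonneg hAK fun x _ _ =>
          Finset.sum_nonneg fun y _ => gradientNorm_term_nonneg w x y)
      have hxe : x + e ∈ K := hA x hx _ fun j => by
        simp only [Pi.add_apply, Set.mem_uIcc]
        by_cases hj : j = i
        · subst hj; rw [hei]; omega
        · rw [hej j hj]; omega
      refine le_trans ?_ (Finset.single_le_sum
        (fun y _ => gradientNorm_term_nonneg w x y) hxe)
      rw [latticeKernel_of_adj (latticeGraph_adj_add_single x i hs1), one_mul, abs_sub_comm]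
    calc ∑ x ∈ A, |w (x + h) - w x|
        ≤ ∑ x ∈ A, (|w (x + e + (h - e)) - w (x + e)| + |w (x + e) - w x|) := by
          refine Finset.sum_le_sum fun x _ => ?_
          have : x + e + (h - e) = x + h := by abel
          rw [this]
          exact abs_sub_le _ _ _
      _ ≤ m * gradientNorm K w + gradientNorm K w := by
          rw [Finset.sum_add_distrib]; exact add_le_add hstep hone
      _ = _ := by push_cast; ring

/-- The weak `ℓ¹` Poincaré inequality on lattice balls. -/
theorem sum_sum_abs_sub_le {d : ℕ} (x₀ : Fin d → ℤ) {R : ℝ} (w : (Fin d → ℤ) → ℝ) :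
    ∑ x ∈ latticeBall x₀ R, ∑ y ∈ latticeBall x₀ R, |w y - w x| ≤
      (latticeBall (0 : Fin d → ℤ) (2 * R)).card * (2 * R) *
        gradientNorm (latticeBall x₀ (2 * R)) w := by
  classical
  set B := latticeBall x₀ R with hB
  set H := latticeBall (0 : Fin d → ℤ) (2 * R) with hH
  have hmem : ∀ x ∈ B, ∀ y ∈ B, y - x ∈ H := by
    intro x hx y hy
    rw [hB, mem_latticeBall_iff_sum] at hx hy
    rw [hH, mem_latticeBall_iff_sum]
    have h1 : ∑ i, |(0 : Fin d → ℤ) i - (y - x) i| ≤ ∑ i, |x₀ i - x i| + ∑ i, |x₀ i - y i| := by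
      rw [← Finset.sum_add_distrib]
      refine Finset.sum_le_sum fun i _ => ?_
      have : (0 : Fin d → ℤ) i - (y - x) i = (x₀ i - y i) - (x₀ i - x i) := by simp
      rw [this, add_comm]
      exact abs_sub _ _
    have h2 : ((∑ i, |(0 : Fin d → ℤ) i - (y - x) i| : ℤ) : ℝ) ≤
        ((∑ i, |x₀ i - x i| : ℤ) : ℝ) + ((∑ i, |x₀ i - y i| : ℤ) : ℝ) := by exact_mod_cast h1
    linarith
  -- Pairs are grouped by their difference `h`, so that the translation estimate is used once for
  -- each h ∈ H.
  have hrw : ∀ x ∈ B, ∑ y ∈ B, |w y - w x| = ∑ h ∈ H with x + h ∈ B, |w (x + h) - w x| := by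
    intro x hx
    refine Finset.sum_nbij' (fun y => y - x) (fun h => x + h) ?_ ?_ ?_ ?_ ?_
    · intro y hy
      rw [Finset.mem_filter]
      exact ⟨hmem x hx y hy, by rwa [add_sub_cancel]⟩
    · intro h hh; exact (Finset.mem_filter.1 hh).2
    · intro y _; simp
    · intro h _; simp
    · intro y _; simp
  have hswap : ∑ x ∈ B, ∑ y ∈ B, |w y - w x| =
      ∑ h ∈ H, ∑ x ∈ B with x + h ∈ B, |w (x + h) - w x| := by
    rw [Finset.sum_congr rfl hrw]
    simp only [Finset.sum_filter]
    exact Finset.sum_comm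
  rw [hswap]
  calc _ ≤ ∑ h ∈ H, 2 * R * gradientNorm (latticeBall x₀ (2 * R)) w := by
        refine Finset.sum_le_sum fun h hh => ?_
        have hnn : 0 ≤ ∑ i, |h i| := Finset.sum_nonneg fun i _ => abs_nonneg _
        have h1 := sum_abs_translate_sub_le (latticeBall x₀ (2 * R)) w (∑ i, |h i|).toNat h
          (Int.toNat_of_nonneg hnn).symm (B.filter fun x => x + h ∈ B) (by
            intro x hx z hz
            obtain ⟨hx1, hx2⟩ := Finset.mem_filter.1 hx
            rw [hB, mem_latticeBall_iff_sum] at hx1 hx2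
            rw [mem_latticeBall_iff_sum]
            -- Each coordinate of `z` lies between those of x and x + h, hence is no farther from
            -- that of x₀ than one of them. This is why the path stays in the ball of radius 2R.
            have h1 : ∑ i, |x₀ i - z i| ≤ ∑ i, |x₀ i - x i| + ∑ i, |x₀ i - (x + h) i| := by
              rw [← Finset.sum_add_distrib]
              refine Finset.sum_le_sum fun i _ => ?_
              have h3 := hz i
              rw [Set.mem_uIcc] at h3
              have e1 := neg_abs_le (x₀ i - x i)
              have e2 := le_abs_self (x₀ i - x i)
              have e3 := neg_abs_le (x₀ i - (x + h) i)
              have e4 := le_abs_self (x₀ i - (x + h) i)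
              simp only [Pi.add_apply] at e3 e4 ⊢
              rw [abs_le]
              omega
            have h2 : ((∑ i, |x₀ i - z i| : ℤ) : ℝ) ≤
                ((∑ i, |x₀ i - x i| : ℤ) : ℝ) + ((∑ i, |x₀ i - (x + h) i| : ℤ) : ℝ) := by
              exact_mod_cast h1
            linarith)
        refine h1.trans (mul_le_mul_of_nonneg_right ?_ (gradientNorm_nonneg _ _))
        have h2 : (((∑ i, |h i|).toNat : ℤ) : ℝ) = ((∑ i, |h i| : ℤ) : ℝ) := by
          rw [Int.toNat_of_nonneg hnn]
        rw [hH, mem_latticeBall_iff_sum] at hh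
        simp only [Pi.zero_apply, zero_sub, abs_neg] at hh
        calc (((∑ i, |h i|).toNat : ℕ) : ℝ) = ((∑ i, |h i| : ℤ) : ℝ) := by
              rw [← h2, Int.cast_natCast]
          _ ≤ 2 * R := hh
    _ = _ := by rw [Finset.sum_const, nsmul_eq_mul]; ring

/-- It allows integral inequalities on product spaces to be read as inequalities for sums over the
lattice. -/
theorem pi_count_eq_count (d : ℕ) :
    MeasureTheory.Measure.pi (fun _ : Fin d => (MeasureTheory.Measure.count : MeasureTheory.Measure ℤ)) =
      MeasureTheory.Measure.count := by
  refine MeasureTheory.Measure.ext_of_singleton fun x => ?_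
  rw [MeasureTheory.Measure.pi_singleton]
  simp

/-- The discrete Gagliardo–Nirenberg–Sobolev inequality, for extended nonnegative functions. -/
theorem tsum_rpow_le_of_le_line_sums {d : ℕ} (hd : 2 ≤ d) (F f : (Fin d → ℤ) → ℝ≥0∞)
    (hF : ∀ x i, F x ≤ ∑' z : ℤ, f (Function.update x i z)) :
    ∑' x, F x ^ ((d : ℝ) / (d - 1)) ≤ (∑' x, f x) ^ ((d : ℝ) / (d - 1)) := by
  have hd1 : (1 : ℝ) < d := by exact_mod_cast hd
  have hd0 : (0 : ℝ) < d - 1 := by linarith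
  have hconj : Real.HolderConjugate (Fintype.card (Fin d)) ((d : ℝ) / (d - 1)) := by
    rw [Fintype.card_fin, Real.holderConjugate_iff]
    refine ⟨hd1, ?_⟩
    field_simp; ring
  -- This is an inequality of Loomis–Whitney type for sums along coordinate lines. It applies after
  -- F^(d/(d-1)) is split into d factors F^(1/(d-1)), the i-th bounded through the line sum in
  -- direction i.
  have h := MeasureTheory.lintegral_prod_lintegral_pow_le
    (fun _ : Fin d => (MeasureTheory.Measure.count : MeasureTheory.Measure ℤ)) hconj
    (f := f) (measurable_of_countable f)
  rw [pi_count_eq_count] at h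
  simp only [MeasureTheory.lintegral_count, Fintype.card_fin] at h
  refine le_trans (ENNReal.tsum_le_tsum fun x => ?_) h
  calc F x ^ ((d : ℝ) / (d - 1)) = ∏ _i : Fin d, F x ^ ((1 : ℝ) / (d - 1)) := by
        rw [Finset.prod_const, Finset.card_univ, Fintype.card_fin, ← ENNReal.rpow_natCast,
          ← ENNReal.rpow_mul]
        congr 1
        field_simp
    _ ≤ _ := Finset.prod_le_prod' fun i _ =>
        ENNReal.rpow_le_rpow (hF x i) (by positivity)

/-- Telescope along the half line from x in direction i, which leaves the finite set `K`. The
gradient in all directions is summed at each point, so that one function serves for every i. -/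
theorem ofReal_abs_le_tsum_line {d : ℕ} (F : (Fin d → ℤ) → ℝ) (K : Finset (Fin d → ℤ))
    (hF : ∀ x ∉ K, F x = 0) (x : Fin d → ℤ) (i : Fin d) :
    ENNReal.ofReal |F x| ≤ ∑' z : ℤ, ENNReal.ofReal
      (∑ j, |F (Function.update x i z) - F (Function.update x i z + Pi.single j 1)|) := by
  set f : (Fin d → ℤ) → ℝ := fun x => ∑ j, |F x - F (x + Pi.single j 1)| with hf
  have hf0 : ∀ x, 0 ≤ f x := fun x => Finset.sum_nonneg fun j _ => abs_nonneg _
  have hline : ∀ N : ℕ, |F x| ≤ |F (Function.update x i (x i + N))| +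
      ∑ k ∈ Finset.range N, f (Function.update x i (x i + k)) := by
    intro N
    induction N with
    | zero => simp
    | succ N ih =>
      rw [Finset.sum_range_succ]
      have h1 : Function.update x i (x i + (N + 1 : ℕ)) =
          Function.update x i (x i + N) + Pi.single i 1 := by
        funext j
        by_cases hj : j = i
        · subst hj; simp [add_assoc]
        · simp [hj]
      have h2 := Finset.single_le_sum (f := fun j => |F (Function.update x i (x i + N)) -
        F (Function.update x i (x i + N) + Pi.single j 1)|) (fun j _ => abs_nonneg _)
        (Finset.mem_univ i)
      have h3 := abs_sub_abs_le_abs_sub (F (Function.update x i (x i + N)))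
        (F (Function.update x i (x i + N) + Pi.single i 1))
      rw [h1]
      have h4 : f (Function.update x i (x i + N)) = ∑ j, |F (Function.update x i (x i + N)) -
        F (Function.update x i (x i + N) + Pi.single j 1)| := rfl
      linarith
  obtain ⟨N, hN⟩ : ∃ N : ℕ, F (Function.update x i (x i + N)) = 0 := by
    by_contra! hcon
    have hinj : Function.Injective fun N : ℕ => Function.update x i (x i + N) := by
      intro a b hab
      have := congrFun hab i
      simpa using this
    refine Set.infinite_range_of_injective hinj (K.finite_toSet.subset ?_)
    rintro _ ⟨N, rfl⟩
    by_contra hx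
    exact hcon N (hF _ hx)
  have h1 := hline N
  rw [hN, abs_zero, zero_add] at h1
  calc ENNReal.ofReal |F x|
      ≤ ENNReal.ofReal (∑ k ∈ Finset.range N, f (Function.update x i (x i + k))) :=
        ENNReal.ofReal_le_ofReal h1
    _ = ∑ k ∈ Finset.range N, ENNReal.ofReal (f (Function.update x i (x i + k))) :=
        ENNReal.ofReal_sum_of_nonneg fun k _ => hf0 _
    _ ≤ ∑' k : ℕ, ENNReal.ofReal (f (Function.update x i (x i + k))) := ENNReal.sum_le_tsum _
    _ ≤ ∑' z : ℤ, ENNReal.ofReal (f (Function.update x i z)) :=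
        ENNReal.tsum_comp_le_tsum_of_injective (f := fun k : ℕ => x i + (k : ℤ))
          (fun a b hab => by simpa using hab) fun z => ENNReal.ofReal (f (Function.update x i z))

/-- The discrete Gagliardo–Nirenberg–Sobolev inequality for functions which vanish near the
boundary of `K`. -/
theorem sum_rpow_le_gradientNorm_rpow {d : ℕ} (hd : 2 ≤ d) (K : Finset (Fin d → ℤ))
    (F : (Fin d → ℤ) → ℝ) (hF : ∀ x, F x ≠ 0 → x ∈ K ∧ (latticeGraph d).neighborFinset x ⊆ K) :
    ∑ x ∈ K, |F x| ^ ((d : ℝ) / (d - 1)) ≤ gradientNorm K F ^ ((d : ℝ) / (d - 1)) := by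
  have hd1 : (1 : ℝ) < d := by exact_mod_cast hd
  have hp : 0 ≤ (d : ℝ) / (d - 1) := div_nonneg (by linarith) (by linarith)
  set f : (Fin d → ℤ) → ℝ := fun x => ∑ j, |F x - F (x + Pi.single j 1)| with hf
  have hf0 : ∀ x, 0 ≤ f x := fun x => Finset.sum_nonneg fun j _ => abs_nonneg _
  have h := tsum_rpow_le_of_le_line_sums hd (fun x => ENNReal.ofReal |F x|)
    (fun x => ENNReal.ofReal (f x))
    (fun x i => ofReal_abs_le_tsum_line F K (fun x hx => by
      by_contra h0; exact hx (hF x h0).1) x i)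
  -- Because `F` vanishes near the boundary of `K`, an edge with a nonzero difference has both end
  -- points in `K`; restricting the gradient to `K` loses nothing.
  have hedge : ∀ x j, F x - F (x + Pi.single j 1) ≠ 0 → x ∈ K ∧ x + Pi.single j 1 ∈ K := by
    intro x j hne
    have hadj := latticeGraph_adj_add_single x j (s := 1) (by simp)
    by_cases h0 : F x = 0
    · have h1 : F (x + Pi.single j 1) ≠ 0 := fun h1 => hne (by rw [h0, h1, sub_zero])
      exact ⟨(hF _ h1).2 (by simpa using hadj.symm), (hF _ h1).1⟩
    · exact ⟨(hF _ h0).1, (hF _ h0).2 (by simpa using hadj)⟩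
  have hfK : ∀ x ∉ K, f x = 0 := by
    intro x hx
    refine Finset.sum_eq_zero fun j _ => ?_
    by_contra hne
    exact hx (hedge x j (fun h0 => hne (by rw [h0, abs_zero]))).1
  have hfle : ∀ x ∈ K, f x ≤ ∑ y ∈ K, latticeKernel (fun _ => 1) x y * |F x - F y| := by
    intro x _
    have hinj : Set.InjOn (fun j : Fin d => x + Pi.single j (1 : ℤ))
        (Finset.univ.filter fun j => x + Pi.single j 1 ∈ K : Finset (Fin d)) := by
      intro j _ j' _ hjj
      have h1 : (Pi.single j (1 : ℤ) : Fin d → ℤ) = Pi.single j' 1 := add_left_cancel hjj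
      by_contra hne
      have h2 := congrFun h1 j
      simp [hne] at h2
    calc f x = ∑ j with x + Pi.single j 1 ∈ K, |F x - F (x + Pi.single j 1)| := by
          rw [Finset.sum_filter]
          refine Finset.sum_congr rfl fun j _ => ?_
          split_ifs with h1
          · rfl
          · by_contra hne
            exact h1 (hedge x j (fun h0 => hne (by rw [h0, abs_zero]))).2
      _ = ∑ y ∈ (Finset.univ.filter fun j => x + Pi.single j 1 ∈ K).image
            (fun j : Fin d => x + Pi.single j (1 : ℤ)),
            latticeKernel (fun _ => 1) x y * |F x - F y| := by
          rw [Finset.sum_image hinj]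
          refine Finset.sum_congr rfl fun j _ => ?_
          rw [latticeKernel_of_adj (latticeGraph_adj_add_single x j (by simp)), one_mul]
      _ ≤ _ := by
          refine Finset.sum_le_sum_of_subset_of_nonneg ?_ fun y _ _ =>
            gradientNorm_term_nonneg F x y
          intro y hy
          obtain ⟨j, hj, rfl⟩ := Finset.mem_image.1 hy
          exact (Finset.mem_filter.1 hj).2
  have hR : ∑' x, ENNReal.ofReal (f x) ≤ ENNReal.ofReal (gradientNorm K F) := by
    rw [tsum_eq_sum (s := K) fun x hx => by rw [hfK x hx, ENNReal.ofReal_zero],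
      ← ENNReal.ofReal_sum_of_nonneg fun x _ => hf0 x]
    exact ENNReal.ofReal_le_ofReal (Finset.sum_le_sum hfle)
  have hL : ENNReal.ofReal (∑ x ∈ K, |F x| ^ ((d : ℝ) / (d - 1))) ≤
      ∑' x, ENNReal.ofReal |F x| ^ ((d : ℝ) / (d - 1)) := by
    rw [ENNReal.ofReal_sum_of_nonneg fun x _ => Real.rpow_nonneg (abs_nonneg _) _]
    refine le_trans (le_of_eq (Finset.sum_congr rfl fun x _ => ?_)) (ENNReal.sum_le_tsum K)
    rw [ENNReal.ofReal_rpow_of_nonneg (abs_nonneg _) hp]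
  have := hL.trans (h.trans (ENNReal.rpow_le_rpow hR hp))
  rw [ENNReal.ofReal_rpow_of_nonneg (gradientNorm_nonneg K F) hp] at this
  exact (ENNReal.ofReal_le_ofReal_iff (Real.rpow_nonneg (gradientNorm_nonneg K F) _)).1 this

/-! ### The Sobolev inequality weighted by the conductances -/

/-- For b ≤ a, Bernoulli's inequality at b/a gives a^τ - b^τ ≤ τ a^(τ-1) (a - b); the other power is
added to make the bound symmetric. -/
theorem abs_rpow_sub_rpow_le {τ a b : ℝ} (hτ : 1 ≤ τ) (ha : 0 ≤ a) (hb : 0 ≤ b) :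
    |a ^ τ - b ^ τ| ≤ τ * (a ^ (τ - 1) + b ^ (τ - 1)) * |a - b| := by
  have key : ∀ {a b : ℝ}, 0 ≤ b → b ≤ a →
      |a ^ τ - b ^ τ| ≤ τ * (a ^ (τ - 1) + b ^ (τ - 1)) * |a - b| := by
    intro a b hb hab
    have hbτ : 0 ≤ b ^ (τ - 1) := Real.rpow_nonneg hb _
    rw [abs_of_nonneg (sub_nonneg.2 (Real.rpow_le_rpow hb hab (by linarith))),
      abs_of_nonneg (sub_nonneg.2 hab)]
    rcases (hb.trans hab).eq_or_lt with h0 | h0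
    · have : b = 0 := le_antisymm (h0 ▸ hab) hb
      rw [← h0, this]; simp
    have h1 := one_add_mul_self_le_rpow_one_add (s := b / a - 1) (p := τ)
      (by have : 0 ≤ b / a := div_nonneg hb h0.le
          linarith) hτ
    rw [add_sub_cancel, Real.div_rpow hb h0.le, le_div_iff₀ (Real.rpow_pos_of_pos h0 _)] at h1
    have h2 : a ^ τ = a ^ (τ - 1) * a := by rw [Real.rpow_sub_one h0.ne']; field_simp
    have h3 : (1 + τ * (b / a - 1)) * a ^ τ = a ^ τ - τ * a ^ (τ - 1) * (a - b) := by
      rw [h2]; field_simp; ring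
    have h4 : 0 ≤ τ * b ^ (τ - 1) * (a - b) :=
      mul_nonneg (mul_nonneg (by linarith) hbτ) (sub_nonneg.2 hab)
    rw [h3] at h1
    linarith
  rcases le_total b a with h | h
  · exact key hb h
  · rw [abs_sub_comm, abs_sub_comm a b, add_comm (a ^ (τ - 1))]
    exact key ha h

section
variable {d : ℕ} {ω : Sym2 (Fin d → ℤ) → ℝ}

theorem condNu_nonneg (hω : ∀ e ∈ (latticeGraph d).edgeSet, 0 < ω e) (x : Fin d → ℤ) :
    0 ≤ condNu ω x :=
  Finset.sum_nonneg fun y hy => one_div_nonneg.2 (hω s(x, y) (by simpa using hy)).le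

theorem condMu_nonneg (hω : ∀ e ∈ (latticeGraph d).edgeSet, 0 < ω e) (x : Fin d → ℤ) :
    0 ≤ condMu ω x :=
  Finset.sum_nonneg fun y hy => (hω s(x, y) (by simpa using hy)).le

/-- Cauchy–Schwarz between the gradient and the Dirichlet energy. -/
theorem sq_sum_mul_abs_sub_le (hω : ∀ e ∈ (latticeGraph d).edgeSet, 0 < ω e)
    (K : Finset (Fin d → ℤ)) (φ w : (Fin d → ℤ) → ℝ) :
    (∑ x ∈ K, ∑ y ∈ K, φ x * (latticeKernel (fun _ => 1) x y * |w x - w y|)) ^ 2 ≤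
      dirichletForm K (latticeKernel ω) w * ∑ x ∈ K, φ x ^ 2 * condNu ω x := by
  have hinv : ∀ e ∈ (latticeGraph d).edgeSet, 0 < 1 / ω e := fun e he => one_div_pos.2 (hω e he)
  have h := Finset.sum_sq_le_sum_mul_sum_of_sq_le_mul (K ×ˢ K)
    (r := fun z => φ z.1 * (latticeKernel (fun _ => 1) z.1 z.2 * |w z.1 - w z.2|))
    (f := fun z => latticeKernel ω z.1 z.2 * (w z.1 - w z.2) ^ 2)
    (g := fun z => φ z.1 ^ 2 * latticeKernel (fun e => 1 / ω e) z.1 z.2)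
    (fun z _ => mul_nonneg (latticeKernel_nonneg hω _ _) (sq_nonneg _))
    (fun z _ => mul_nonneg (sq_nonneg _) (latticeKernel_nonneg hinv _ _)) (fun z _ => by
      by_cases hz : (latticeGraph d).Adj z.1 z.2
      · have := (hω s(z.1, z.2) hz).ne'
        simp only [latticeKernel_of_adj hz]
        rw [one_mul, mul_pow, sq_abs]
        refine le_of_eq ?_
        field_simp
      · simp only [latticeKernel_of_not_adj hz]
        exact le_of_eq (by ring))
  rw [Finset.sum_product, Finset.sum_product, Finset.sum_product] at h
  refine h.trans (mul_le_mul_of_nonneg_left ?_ (dirichletForm_nonneg (latticeKernel_nonneg hω) w))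
  refine Finset.sum_le_sum fun x _ => ?_
  dsimp only
  rw [← Finset.mul_sum]
  exact mul_le_mul_of_nonneg_left (sum_latticeKernel_le hinv K x) (sq_nonneg _)

theorem gradientNorm_sq_le (hω : ∀ e ∈ (latticeGraph d).edgeSet, 0 < ω e)
    (K : Finset (Fin d → ℤ)) (w : (Fin d → ℤ) → ℝ) :
    gradientNorm K w ^ 2 ≤ dirichletForm K (latticeKernel ω) w * ∑ x ∈ K, condNu ω x := by
  have h := sq_sum_mul_abs_sub_le hω K (fun _ => 1) w
  simpa [gradientNorm] using h

/-- A discrete chain rule: the weights at the two end points of an edge contribute equally after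
exchanging x and y, whence the factor 2. -/
theorem gradientNorm_rpow_le (K : Finset (Fin d → ℤ)) {f : (Fin d → ℤ) → ℝ} (hf : ∀ x, 0 ≤ f x)
    {τ : ℝ} (hτ : 1 ≤ τ) :
    gradientNorm K (fun x => f x ^ τ) ≤ 2 * τ *
      ∑ x ∈ K, ∑ y ∈ K, f x ^ (τ - 1) * (latticeKernel (fun _ => 1) x y * |f x - f y|) := by
  set b : (Fin d → ℤ) → (Fin d → ℤ) → ℝ := latticeKernel (fun _ => 1) with hb
  have hb0 : ∀ x y, 0 ≤ b x y := fun x y => by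
    refine latticeKernel_nonneg ?_ x y
    intro e _
    exact one_pos
  have h1 : gradientNorm K (fun x => f x ^ τ) ≤
      ∑ x ∈ K, ∑ y ∈ K, (τ * (f x ^ (τ - 1) * (b x y * |f x - f y|)) +
        τ * (f y ^ (τ - 1) * (b y x * |f y - f x|))) := by
    refine Finset.sum_le_sum fun x _ => Finset.sum_le_sum fun y _ => ?_
    refine (mul_le_mul_of_nonneg_left (abs_rpow_sub_rpow_le hτ (hf x) (hf y)) (hb0 x y)).trans_eq ?_
    rw [abs_sub_comm (f y), hb, latticeKernel_symm y x]
    ring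
  refine h1.trans_eq ?_
  simp only [Finset.sum_add_distrib]
  rw [Finset.sum_comm (f := fun x y => τ * (f y ^ (τ - 1) * (b y x * |f y - f x|))), ← two_mul,
    mul_assoc]
  simp only [Finset.mul_sum]

/-- The weighted Sobolev inequality for functions vanishing near the boundary of `K`. -/
theorem sum_rpow_rpow_le_dirichletForm (hd : 2 ≤ d)
    (hω : ∀ e ∈ (latticeGraph d).edgeSet, 0 < ω e) (K : Finset (Fin d → ℤ))
    {f : (Fin d → ℤ) → ℝ} (hf : ∀ x, 0 ≤ f x)
    (hfK : ∀ x, f x ≠ 0 → x ∈ K ∧ (latticeGraph d).neighborFinset x ⊆ K) {q L : ℝ} (hq : 1 < q)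
    (hL : L = 1 - 2 / d + 1 / q) :
    (∑ x ∈ K, f x ^ (2 / L)) ^ L ≤
      4 * (2 / L) ^ 2 * dirichletForm K (latticeKernel ω) f *
        (∑ x ∈ K, condNu ω x ^ q) ^ (1 / q) := by
  have hd2 : (2 : ℝ) ≤ d := by exact_mod_cast hd
  have hd0 : (0 : ℝ) < d := by linarith
  have hq0 : 0 < q := by linarith
  have hL0 : 0 < L := by
    have : 2 / (d : ℝ) ≤ 1 := by rw [div_le_one hd0]; exact hd2
    have : 0 < 1 / q := by positivity
    rw [hL]; linarith
  set ρ : ℝ := 2 / L with hρ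
  have hρ0 : 0 < ρ := by positivity
  have hρL : ρ * L = 2 := by rw [hρ]; field_simp
  -- The ℓ¹ Sobolev inequality is applied to f^τ, and τ d/(d-1) = ρ. The choice ρL = 2 makes 2(τ -
  -- 1) = ρ(1 - 1/q), the exponent needed in Hölder's inequality with ν in ℓ^q. So the same sum `X`
  -- appears on both sides, and X^(1-1/q) can be cancelled.
  set τ : ℝ := ρ * ((d - 1) / d) with hτ
  have hτ2 : 2 * (τ - 1) = ρ * (1 - 1 / q) := by
    have : (d - 1) / (d : ℝ) = 1 - 1 / d := by field_simp
    have h2 : ρ * (1 - 2 / d + 1 / q) = 2 := by rw [← hL]; exact hρL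
    rw [hτ, this]
    linear_combination h2
  have hq1 : 1 / q < 1 := by rw [div_lt_one hq0]; exact hq
  have hτ1 : 1 ≤ τ := by nlinarith [mul_pos hρ0 (sub_pos.2 hq1)]
  have hτρ : τ ≤ ρ := by
    rw [hτ]
    refine mul_le_of_le_one_right hρ0.le ?_
    rw [div_le_one hd0]; linarith
  set X : ℝ := ∑ x ∈ K, f x ^ ρ with hX
  have hX0 : 0 ≤ X := Finset.sum_nonneg fun x _ => Real.rpow_nonneg (hf x) _
  set E := dirichletForm K (latticeKernel ω) f with hE
  have hE0 : 0 ≤ E := dirichletForm_nonneg (latticeKernel_nonneg hω) f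
  set S := (∑ x ∈ K, condNu ω x ^ q) ^ (1 / q) with hS
  have hS0 : 0 ≤ S := Real.rpow_nonneg
    (Finset.sum_nonneg fun x _ => Real.rpow_nonneg (condNu_nonneg hω x) _) _
  rcases hX0.eq_or_lt with h0 | hXpos
  · rw [← h0, Real.zero_rpow hL0.ne']; positivity
  set G := gradientNorm K (fun x => f x ^ τ) with hG
  have hG0 : 0 ≤ G := gradientNorm_nonneg _ _
  have hd1 : (0 : ℝ) < d - 1 := by linarith
  have h1 : X ≤ G ^ ((d : ℝ) / (d - 1)) := by
    refine le_trans (le_of_eq (Finset.sum_congr rfl fun x _ => ?_))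
      (sum_rpow_le_gradientNorm_rpow hd K (fun x => f x ^ τ) fun x hx => hfK x fun h0 => hx ?_)
    · rw [abs_of_nonneg (Real.rpow_nonneg (hf x) _), ← Real.rpow_mul (hf x)]
      congr 1
      rw [hτ]; field_simp
    · rw [h0, Real.zero_rpow (by linarith)]
  have h2 : X ^ (2 * ((d - 1) / d) : ℝ) ≤ G ^ 2 := by
    have := Real.rpow_le_rpow hX0 h1 (z := 2 * ((d - 1) / d)) (by positivity)
    rwa [← Real.rpow_mul hG0,
      show (d : ℝ) / (d - 1) * (2 * ((d - 1) / d)) = (2 : ℕ) by push_cast; field_simp,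
      Real.rpow_natCast] at this
  have h3 := gradientNorm_rpow_le K hf hτ1
  have h4 := sq_sum_mul_abs_sub_le hω K (fun x => f x ^ (τ - 1)) f
  have h5 : ∑ x ∈ K, (f x ^ (τ - 1)) ^ 2 * condNu ω x ≤ S * X ^ (1 - 1 / q) := by
    refine le_trans (le_of_eq (Finset.sum_congr rfl fun x _ => ?_))
      (sum_rpow_mul_rpow_one_sub_le K (by positivity) hq1.le
        (fun x _ => Real.rpow_nonneg (condNu_nonneg hω x) q) (fun x _ => Real.rpow_nonneg (hf x) ρ))
    rw [← Real.rpow_mul (condNu_nonneg hω x), mul_one_div_cancel hq0.ne', Real.rpow_one,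
      ← Real.rpow_mul (hf x), ← hτ2, ← Real.rpow_natCast, ← Real.rpow_mul (hf x), mul_comm]
    congr 2
    push_cast; ring
  have h6 : G ^ 2 ≤ 4 * τ ^ 2 * (E * (S * X ^ (1 - 1 / q))) := by
    calc G ^ 2 ≤ (2 * τ * ∑ x ∈ K, ∑ y ∈ K, f x ^ (τ - 1) *
          (latticeKernel (fun _ => 1) x y * |f x - f y|)) ^ 2 := pow_le_pow_left₀ hG0 h3 2
      _ = 4 * τ ^ 2 * (∑ x ∈ K, ∑ y ∈ K, f x ^ (τ - 1) *
          (latticeKernel (fun _ => 1) x y * |f x - f y|)) ^ 2 := by ring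
      _ ≤ _ := mul_le_mul_of_nonneg_left
          (h4.trans (mul_le_mul_of_nonneg_left h5 hE0)) (by positivity)
  have hXq : 0 < X ^ (1 - 1 / q) := Real.rpow_pos_of_pos hXpos _
  have h7 : X ^ L * X ^ (1 - 1 / q) = X ^ (2 * ((d - 1) / d) : ℝ) := by
    rw [← Real.rpow_add hXpos]
    congr 1
    rw [hL]; field_simp; ring
  have h8 : X ^ L * X ^ (1 - 1 / q) ≤ (4 * τ ^ 2 * E * S) * X ^ (1 - 1 / q) := by
    rw [h7]; exact (h2.trans h6).trans_eq (by ring)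
  refine (le_of_mul_le_mul_right h8 hXq).trans ?_
  gcongr
end

/-! ### From moment bounds to the De Giorgi kernel -/

/-- The moment bounds on the conductances and the speed measure in `B(x₀, n)`. -/
structure HasMomentBounds {d : ℕ} (ω : Sym2 (Fin d → ℤ) → ℝ) (θ : (Fin d → ℤ) → ℝ)
    (x₀ : Fin d → ℤ) (n p q r M : ℝ) : Prop where
  ω_pos : ∀ e ∈ (latticeGraph d).edgeSet, 0 < ω e
  θ_pos : ∀ x, 0 < θ x
  one_le : 1 ≤ M
  mu_le : ∑ x ∈ latticeBall x₀ n, (condMu ω x / θ x) ^ p * θ x ≤ (latticeBall x₀ n).card * M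
  nu_le : ∑ x ∈ latticeBall x₀ n, condNu ω x ^ q ≤ (latticeBall x₀ n).card * M
  theta_le : ∑ x ∈ latticeBall x₀ n, θ x ^ r ≤ (latticeBall x₀ n).card * M
  inv_theta_le : ∑ x ∈ latticeBall x₀ n, 1 / θ x ≤ (latticeBall x₀ n).card * M

theorem sum_le_of_sum_rpow_le {ι : Type*} (K : Finset ι) {f : ι → ℝ} (hf : ∀ x ∈ K, 0 ≤ f x)
    {N M q : ℝ} (hK : (K.card : ℝ) ≤ N) (hq : 1 < q) (hM : 1 ≤ M)
    (h : ∑ x ∈ K, f x ^ q ≤ N * M) : ∑ x ∈ K, f x ≤ N * M := by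
  have hq0 : 0 < q := by linarith
  have hN : 0 ≤ N := le_trans (Nat.cast_nonneg _) hK
  have hq1 : 1 / q ≤ 1 := by rw [div_le_one hq0]; exact hq.le
  have h1 := sum_rpow_mul_rpow_one_sub_le K (a := 1 / q) (by positivity) hq1
    (f := fun x => f x ^ q) (g := fun _ => 1) (fun x hx => Real.rpow_nonneg (hf x hx) q)
    (fun _ _ => zero_le_one)
  simp only [Real.one_rpow, mul_one, Finset.sum_const, nsmul_eq_mul] at h1
  calc ∑ x ∈ K, f x = ∑ x ∈ K, (f x ^ q) ^ (1 / q) := Finset.sum_congr rfl fun x hx => by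
        rw [← Real.rpow_mul (hf x hx), mul_one_div_cancel hq0.ne', Real.rpow_one]
    _ ≤ _ := h1
    _ ≤ (N * M) ^ (1 / q) * N ^ (1 - 1 / q) := by
        refine mul_le_mul (Real.rpow_le_rpow (Finset.sum_nonneg fun x hx =>
          Real.rpow_nonneg (hf x hx) _) h (by positivity))
          (Real.rpow_le_rpow (Nat.cast_nonneg _) hK (by linarith)) (by positivity) (by positivity)
    _ = N * M ^ (1 / q) := by
        rw [Real.mul_rpow hN (by linarith), mul_right_comm,
          ← Real.rpow_add_of_nonneg hN (by positivity) (by linarith), add_sub_cancel, Real.rpow_one]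
    _ ≤ N * M := by
        refine mul_le_mul_of_nonneg_left ?_ hN
        exact (Real.rpow_le_rpow_of_exponent_le hM hq1).trans_eq (Real.rpow_one M)

section
variable {d : ℕ} {ω : Sym2 (Fin d → ℤ) → ℝ} {θ : (Fin d → ℤ) → ℝ} {x₀ : Fin d → ℤ}
  {n p q r M : ℝ}

theorem card_latticeBall_pos (x₀ : Fin d → ℤ) (hn : 0 ≤ n) :
    (0 : ℝ) < (latticeBall x₀ n).card := by
  exact_mod_cast Finset.card_pos.2 ⟨x₀, mem_latticeBall_self x₀ hn⟩

theorem dirichletForm_latticeKernel_div (K : Finset (Fin d → ℤ)) (N : ℝ) (f : (Fin d → ℤ) → ℝ) :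
    dirichletForm K (latticeKernel fun e => ω e / N) f =
      dirichletForm K (latticeKernel ω) f / N := by
  rw [dirichletForm, dirichletForm, Finset.sum_div]
  refine Finset.sum_congr rfl fun x _ => ?_
  rw [Finset.sum_div]
  refine Finset.sum_congr rfl fun y _ => ?_
  by_cases h : (latticeGraph d).Adj x y
  · rw [latticeKernel_of_adj h, latticeKernel_of_adj h]; ring
  · rw [latticeKernel_of_not_adj h, latticeKernel_of_not_adj h]; ring

theorem mul_rpow_mul_rpow_one_sub {N M B a : ℝ} (hN : 0 < N) (hM : 0 ≤ M) (hB : 0 ≤ B) :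
    (N * M) ^ a * B ^ (1 - a) = N * (M ^ a * (B / N) ^ (1 - a)) := by
  have h2 : N ^ a * N ^ (1 - a) = N := by
    rw [← Real.rpow_add hN, add_sub_cancel, Real.rpow_one]
  have h3 : 0 < N ^ (1 - a) := Real.rpow_pos_of_pos hN _
  rw [Real.mul_rpow hN.le hM, Real.div_rpow hB hN.le, mul_div_assoc', mul_div_assoc',
    eq_div_iff h3.ne']
  linear_combination (M ^ a * B ^ (1 - a)) * h2

/-- Write f μ = f (μ/θ) θ and apply Hölder with respect to the measure θ, with exponent p on μ/θ;
the conjugate exponent 1/(1 - 1/p) falls on f. -/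
theorem HasMomentBounds.flux_le (h : HasMomentBounds ω θ x₀ n p q r M) (hn : 1 ≤ n) (hp : 1 < p)
    (f : (Fin d → ℤ) → ℝ) (hf : ∀ x, 0 ≤ f x) :
    ∑ x ∈ latticeBall x₀ n, f x * condMu ω x ≤ (latticeBall x₀ n).card * (M *
      (∑ x ∈ latticeBall x₀ n, f x ^ (1 / (1 - 1 / p)) * (θ x / (latticeBall x₀ n).card)) ^
        (1 - 1 / p)) := by
  set K := latticeBall x₀ n with hK
  set N : ℝ := (K.card : ℝ) with hN
  have hN0 : 0 < N := card_latticeBall_pos x₀ (by linarith)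
  have hp0 : 0 < p := by linarith
  have hp1 : 1 / p < 1 := by rw [div_lt_one hp0]; exact hp
  have hP : 0 < 1 - 1 / p := by linarith
  have hM0 : 0 ≤ M := zero_le_one.trans h.one_le
  have hμ : ∀ x, 0 ≤ condMu ω x / θ x := fun x =>
    div_nonneg (condMu_nonneg h.ω_pos x) (h.θ_pos x).le
  have h1 := sum_rpow_mul_rpow_one_sub_le K (a := 1 / p) (by positivity) hp1.le
    (f := fun x => (condMu ω x / θ x) ^ p * θ x) (g := fun x => f x ^ (1 / (1 - 1 / p)) * θ x)
    (fun x _ => mul_nonneg (Real.rpow_nonneg (hμ x) _) (h.θ_pos x).le)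
    (fun x _ => mul_nonneg (Real.rpow_nonneg (hf x) _) (h.θ_pos x).le)
  set B := ∑ x ∈ K, f x ^ (1 / (1 - 1 / p)) * θ x with hB
  have hB0 : 0 ≤ B := Finset.sum_nonneg fun x _ =>
    mul_nonneg (Real.rpow_nonneg (hf x) _) (h.θ_pos x).le
  have hBN : ∑ x ∈ K, f x ^ (1 / (1 - 1 / p)) * (θ x / N) = B / N := by
    rw [hB, Finset.sum_div]; exact Finset.sum_congr rfl fun x _ => by ring
  rw [hBN]
  calc ∑ x ∈ K, f x * condMu ω x
      = ∑ x ∈ K, ((condMu ω x / θ x) ^ p * θ x) ^ (1 / p) *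
          (f x ^ (1 / (1 - 1 / p)) * θ x) ^ (1 - 1 / p) := by
        refine Finset.sum_congr rfl fun x _ => ?_
        have hθ := h.θ_pos x
        rw [Real.mul_rpow (Real.rpow_nonneg (hμ x) _) hθ.le,
          Real.mul_rpow (Real.rpow_nonneg (hf x) _) hθ.le, ← Real.rpow_mul (hμ x),
          ← Real.rpow_mul (hf x), mul_one_div_cancel hp0.ne', one_div_mul_cancel hP.ne',
          Real.rpow_one, Real.rpow_one, mul_mul_mul_comm, ← Real.rpow_add hθ, add_sub_cancel,
          Real.rpow_one]
        field_simp
    _ ≤ _ := h1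
    _ ≤ (N * M) ^ (1 / p) * B ^ (1 - 1 / p) := by
        refine mul_le_mul_of_nonneg_right (Real.rpow_le_rpow (Finset.sum_nonneg fun x _ =>
          mul_nonneg (Real.rpow_nonneg (hμ x) _) (h.θ_pos x).le) h.mu_le (by positivity))
          (by positivity)
    _ = N * (M ^ (1 / p) * (B / N) ^ (1 - 1 / p)) := mul_rpow_mul_rpow_one_sub hN0 hM0 hB0
    _ ≤ _ := by
        have : M ^ (1 / p) ≤ M :=
          (Real.rpow_le_rpow_of_exponent_le h.one_le hp1.le).trans_eq (Real.rpow_one M)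
        gcongr

/-- Hölder removes θ in ℓ^r, and s is chosen so that the exponent left on f is the 2/L of the
Sobolev inequality without θ. The powers of the volume N combine to N^(2/d)/N: the denominator
normalises the energy, and N^(2/d) ≤ 9n² is the diffusive scaling. The constant is 36 = 4·9. -/
theorem HasMomentBounds.sobolev (h : HasMomentBounds ω θ x₀ n p q r M) (hd : 2 ≤ d) (hn : 1 ≤ n)
    (hq : 1 < q) (hr : 1 < r) {L s : ℝ} (hL : L = 1 - 2 / d + 1 / q) (hs : s = (1 - 1 / r) / L)
    (f : (Fin d → ℤ) → ℝ) (hf : ∀ x, 0 ≤ f x)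
    (hfK : ∀ x, f x ≠ 0 → x ∈ latticeBall x₀ n ∧
      (latticeGraph d).neighborFinset x ⊆ latticeBall x₀ n) :
    (∑ x ∈ latticeBall x₀ n, (f x ^ 2) ^ s * (θ x / (latticeBall x₀ n).card)) ^ (1 / s) ≤
      36 * (2 / L) ^ 2 * M ^ (1 / r / s + 1 / q) * n ^ 2 *
        dirichletForm (latticeBall x₀ n)
          (latticeKernel fun e => ω e / (latticeBall x₀ n).card) f := by
  set K := latticeBall x₀ n with hK
  set N : ℝ := (K.card : ℝ) with hN
  have hN0 : 0 < N := card_latticeBall_pos x₀ (by linarith)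
  have hd2 : (2 : ℝ) ≤ d := by exact_mod_cast hd
  have hd0 : (0 : ℝ) < d := by linarith
  have hq0 : 0 < q := by linarith
  have hr0 : 0 < r := by linarith
  have hM0 : 0 ≤ M := zero_le_one.trans h.one_le
  have hr1 : 1 / r < 1 := by rw [div_lt_one hr0]; exact hr
  have hL0 : 0 < L := by
    have : 2 / (d : ℝ) ≤ 1 := by rw [div_le_one hd0]; exact hd2
    have : 0 < 1 / q := by positivity
    rw [hL]; linarith
  have hs0 : 0 < s := by rw [hs]; exact div_pos (by linarith) hL0
  have hsL : (1 - 1 / r) * (1 / s) = L := by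
    have : 1 - 1 / r ≠ 0 := by linarith
    rw [hs, one_div_div, mul_div_cancel₀ _ this]
  have hsob := sum_rpow_rpow_le_dirichletForm hd h.ω_pos K hf hfK hq hL
  set X := ∑ x ∈ K, f x ^ (2 / L) with hX
  have hX0 : 0 ≤ X := Finset.sum_nonneg fun x _ => Real.rpow_nonneg (hf x) _
  set E := dirichletForm K (latticeKernel ω) f with hE
  have hE0 : 0 ≤ E := dirichletForm_nonneg (latticeKernel_nonneg h.ω_pos) f
  have h1 : ∑ x ∈ K, (f x ^ 2) ^ s * θ x ≤ (N * M) ^ (1 / r) * X ^ (1 - 1 / r) := by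
    refine le_trans (le_trans (le_of_eq (Finset.sum_congr rfl fun x _ => ?_))
      (sum_rpow_mul_rpow_one_sub_le K (a := 1 / r) (by positivity) hr1.le
        (fun x _ => Real.rpow_nonneg (h.θ_pos x).le r)
        (fun x _ => Real.rpow_nonneg (hf x) (2 / L)))) ?_
    · rw [← Real.rpow_mul (h.θ_pos x).le, mul_one_div_cancel hr0.ne', Real.rpow_one,
        ← Real.rpow_mul (hf x), ← Real.rpow_natCast, ← Real.rpow_mul (hf x), mul_comm]
      congr 2
      rw [hs]; push_cast; field_simp
    · exact mul_le_mul_of_nonneg_right (Real.rpow_le_rpow (Finset.sum_nonneg fun x _ =>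
        Real.rpow_nonneg (h.θ_pos x).le _) h.theta_le (by positivity)) (by positivity)
  have hdiv : ∑ x ∈ K, (f x ^ 2) ^ s * (θ x / N) = (∑ x ∈ K, (f x ^ 2) ^ s * θ x) / N := by
    rw [Finset.sum_div]; exact Finset.sum_congr rfl fun x _ => by ring
  have hsum0 : 0 ≤ ∑ x ∈ K, (f x ^ 2) ^ s * θ x := Finset.sum_nonneg fun x _ =>
    mul_nonneg (by positivity) (h.θ_pos x).le
  have h2 : (∑ x ∈ K, (f x ^ 2) ^ s * (θ x / N)) ^ (1 / s) ≤ M ^ (1 / r / s) * (X / N) ^ L := by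
    calc (∑ x ∈ K, (f x ^ 2) ^ s * (θ x / N)) ^ (1 / s)
        ≤ (M ^ (1 / r) * (X / N) ^ (1 - 1 / r)) ^ (1 / s) := by
          rw [hdiv]
          refine Real.rpow_le_rpow (div_nonneg hsum0 hN0.le) ?_ (by positivity)
          rw [div_le_iff₀ hN0]
          exact h1.trans_eq ((mul_rpow_mul_rpow_one_sub hN0 hM0 hX0).trans (mul_comm _ _))
      _ = _ := by
          rw [Real.mul_rpow (by positivity) (by positivity), ← Real.rpow_mul hM0,
            ← Real.rpow_mul (by positivity), hsL]
          congr 2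
          ring
  have h3 : (∑ x ∈ K, condNu ω x ^ q) ^ (1 / q) ≤ (N * M) ^ (1 / q) :=
    Real.rpow_le_rpow (Finset.sum_nonneg fun x _ =>
      Real.rpow_nonneg (condNu_nonneg h.ω_pos x) _) h.nu_le (by positivity)
  have h4 : N ^ (2 / (d : ℝ)) ≤ 9 * n ^ 2 := by
    calc N ^ (2 / (d : ℝ)) ≤ ((3 * n) ^ d) ^ (2 / (d : ℝ)) :=
          Real.rpow_le_rpow hN0.le (card_latticeBall_le x₀ hn) (by positivity)
      _ = (3 * n) ^ (2 : ℕ) := by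
          rw [← Real.rpow_natCast, ← Real.rpow_mul (by positivity), mul_div_cancel₀ _ hd0.ne',
            ← Real.rpow_natCast]
          norm_num
      _ = 9 * n ^ 2 := by ring
  have h5 : N ^ (1 / q) / N ^ L = N ^ (2 / (d : ℝ)) / N := by
    rw [← Real.rpow_sub hN0, ← Real.rpow_sub_one hN0.ne']
    congr 1
    rw [hL]; ring
  rw [dirichletForm_latticeKernel_div]
  calc _ ≤ M ^ (1 / r / s) * (X / N) ^ L := h2
    _ = M ^ (1 / r / s) * (X ^ L / N ^ L) := by rw [Real.div_rpow hX0 hN0.le]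
    _ ≤ M ^ (1 / r / s) * (4 * (2 / L) ^ 2 * E * (N * M) ^ (1 / q) / N ^ L) := by
        gcongr
        exact hsob.trans (mul_le_mul_of_nonneg_left h3 (by positivity))
    _ = 4 * (2 / L) ^ 2 * E * (M ^ (1 / r / s) * M ^ (1 / q)) * (N ^ (1 / q) / N ^ L) := by
        rw [Real.mul_rpow hN0.le hM0]; ring
    _ = 4 * (2 / L) ^ 2 * E * M ^ (1 / r / s + 1 / q) * (N ^ (2 / (d : ℝ)) / N) := by
        rw [h5, ← Real.rpow_add (by linarith [h.one_le])]
    _ ≤ 4 * (2 / L) ^ 2 * E * M ^ (1 / r / s + 1 / q) * (9 * n ^ 2 / N) := by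
        gcongr
    _ = _ := by ring

/-- Under moment bounds the variable speed kernel on a lattice ball is a De Giorgi kernel. -/
theorem HasMomentBounds.isDeGiorgiKernel (h : HasMomentBounds ω θ x₀ n p q r M) (hd : 2 ≤ d)
    (hn : 8 ≤ n) (hp : 1 < p) (hq : 1 < q) (hr : 1 < r) {L s : ℝ} (hL : L = 1 - 2 / d + 1 / q)
    (hs : s = (1 - 1 / r) / L) :
    IsDeGiorgiKernel (latticeBall x₀ n) (latticeKernel fun e => ω e / (latticeBall x₀ n).card)
      (fun x => θ x / (latticeBall x₀ n).card) (fun x => (latticeGraph d).dist x₀ x)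
      (1 / (1 - 1 / p)) s (M + 36 * (2 / L) ^ 2 * M ^ (1 / r / s + 1 / q)) n := by
  set K := latticeBall x₀ n with hK
  set N : ℝ := (K.card : ℝ) with hN
  have hN0 : 0 < N := card_latticeBall_pos x₀ (by linarith)
  have hM0 : 0 ≤ M := zero_le_one.trans h.one_le
  have hc0 : 0 ≤ 36 * (2 / L) ^ 2 * M ^ (1 / r / s + 1 / q) := by positivity
  have hωN : ∀ e ∈ (latticeGraph d).edgeSet, 0 < ω e / N := fun e he => div_pos (h.ω_pos e he) hN0
  refine ⟨latticeKernel_symm, latticeKernel_nonneg hωN, fun x => div_pos (h.θ_pos x) hN0,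
    fun x y ha => ?_, by linarith [h.one_le], ?_, fun f hf => ?_, fun f hf hfz => ?_⟩
  · by_cases hxy : (latticeGraph d).Adj x y
    · exact abs_dist_sub_dist_le_one x₀ hxy
    · exact absurd (latticeKernel_of_not_adj hxy) ha
  · rw [← Finset.sum_div, div_le_iff₀ hN0]
    have := sum_le_of_sum_rpow_le K (fun x _ => (h.θ_pos x).le) le_rfl hr h.one_le h.theta_le
    nlinarith
  · have h1 := h.flux_le (by linarith) hp f hf
    rw [one_div_one_div]
    have h2 : ∑ x ∈ K, f x * ∑ y ∈ K, latticeKernel (fun e => ω e / N) x y ≤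
        (∑ x ∈ K, f x * condMu ω x) / N := by
      rw [Finset.sum_div]
      refine Finset.sum_le_sum fun x _ => ?_
      rw [mul_div_assoc]
      refine mul_le_mul_of_nonneg_left ?_ (hf x)
      refine (sum_latticeKernel_le hωN K x).trans_eq ?_
      rw [condMu, Finset.sum_div]
    refine h2.trans ?_
    rw [div_le_iff₀ hN0]
    refine h1.trans ?_
    have h3 : 0 ≤ (∑ x ∈ K, f x ^ (1 / (1 - 1 / p)) * (θ x / N)) ^ (1 - 1 / p) :=
      Real.rpow_nonneg (Finset.sum_nonneg fun x _ => mul_nonneg (Real.rpow_nonneg (hf x) _)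
        (div_pos (h.θ_pos x) hN0).le) _
    rw [mul_comm]
    exact mul_le_mul_of_nonneg_right (mul_le_mul_of_nonneg_right (by linarith) h3) hN0.le
  · refine (h.sobolev hd (by linarith) hq hr hL hs f hf fun x hx => ?_).trans ?_
    · have h1 : x ∈ latticeBall x₀ (3 * n / 8) := by
        rw [mem_latticeBall]
        by_contra hcon
        exact hx (hfz x (not_le.1 hcon))
      refine ⟨latticeBall_mono x₀ (by linarith) h1, fun y hy => ?_⟩
      exact mem_latticeBall_of_adj h1 (by simpa using hy) (by linarith)
    · refine mul_le_mul_of_nonneg_right (mul_le_mul_of_nonneg_right (by linarith) (sq_nonneg _)) ?_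
      exact dirichletForm_nonneg (latticeKernel_nonneg hωN) f
end

/-! ### The logarithm of a positive solution -/

/-- `v` solves the heat equation, with time derivative `v'`, at the points of `K` with `ρ ≤ R`. -/
structure IsSolutionOn {V : Type*} (K : Finset V) (a : V → V → ℝ) (m ρ : V → ℝ)
    (R : ℝ) (I : Set ℝ) (v v' : ℝ → V → ℝ) : Prop where
  cont : ∀ x ∈ K, ContinuousOn (fun t => v t x) I
  deriv : ∀ t ∈ I, ∀ x ∈ K, ρ x ≤ R → HasDerivWithinAt (fun t => v t x) (v' t x) I t
  eq : ∀ t ∈ I, ∀ x ∈ K, ρ x ≤ R → m x * v' t x = ∑ y ∈ K, a x y * (v t y - v t x)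

section
variable {V : Type*} {K : Finset V} {a : V → V → ℝ} {m ρ : V → ℝ} {R : ℝ} {I : Set ℝ}
  {v v' : ℝ → V → ℝ} {Λ : ℝ}

theorem IsSolutionOn.continuousOn_log (h : IsSolutionOn K a m ρ R I v v')
    (hv : ∀ t ∈ I, ∀ x ∈ K, 0 < v t x) {x : V} (hx : x ∈ K) :
    ContinuousOn (fun t => -Real.log (v t x) / Λ) I :=
  (((h.cont x hx).log fun t ht => (hv t ht x hx).ne').neg).div_const _

theorem IsSolutionOn.hasDerivWithinAt_log (h : IsSolutionOn K a m ρ R I v v')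
    (hv : ∀ t ∈ I, ∀ x ∈ K, 0 < v t x) {t : ℝ} (ht : t ∈ I) {x : V} (hx : x ∈ K)
    (hR : ρ x ≤ R) : HasDerivWithinAt (fun t => -Real.log (v t x) / Λ)
      (-(v' t x / v t x) / Λ) I t :=
  (((h.deriv t ht x hx hR).log (hv t ht x hx).ne').neg).div_const _

theorem IsSolutionOn.mul_deriv_log_eq (h : IsSolutionOn K a m ρ R I v v') {t : ℝ} (ht : t ∈ I)
    {x : V} (hx : x ∈ K) (hR : ρ x ≤ R) : m x * (-(v' t x / v t x) / Λ) =
      -(1 / (Λ * v t x)) * ∑ y ∈ K, a x y * (v t y - v t x) := by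
  rw [← h.eq t ht x hx hR]
  simp only [div_eq_mul_inv, mul_inv]
  ring

/-- By convexity of -log, log(b/a) ≤ b/a - 1, used edge by edge with nonnegative conductances. -/
theorem IsSolutionOn.isSubsolutionOn_log (h : IsSolutionOn K a m ρ R I v v')
    (ha : ∀ x y, 0 ≤ a x y) (hΛ : 0 < Λ) (hv : ∀ t ∈ I, ∀ x ∈ K, 0 < v t x) :
    IsSubsolutionOn K a m ρ R I (fun t x => -Real.log (v t x) / Λ)
      (fun t x => -(v' t x / v t x) / Λ) := by
  refine ⟨fun x hx => h.continuousOn_log hv hx, fun t ht x hx hR =>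
    h.hasDerivWithinAt_log hv ht hx hR, fun t ht x hx hR => ?_⟩
  rw [h.mul_deriv_log_eq ht hx hR, Finset.mul_sum]
  refine Finset.sum_le_sum fun y hy => ?_
  have hx0 := hv t ht x hx
  have hy0 := hv t ht y hy
  have h1 := Real.log_le_sub_one_of_pos (div_pos hy0 hx0)
  rw [Real.log_div hy0.ne' hx0.ne'] at h1
  have h2 : -(1 / (Λ * v t x)) * (v t y - v t x) ≤
      -Real.log (v t y) / Λ - -Real.log (v t x) / Λ := by
    have e1 : -(1 / (Λ * v t x)) * (v t y - v t x) = -((v t y / v t x - 1) / Λ) := by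
      field_simp
    have e2 : -Real.log (v t y) / Λ - -Real.log (v t x) / Λ =
        -((Real.log (v t y) - Real.log (v t x)) / Λ) := by ring
    rw [e1, e2, neg_le_neg_iff]
    exact div_le_div_of_nonneg_right h1 hΛ.le
  calc _ = a x y * (-(1 / (Λ * v t x)) * (v t y - v t x)) := by ring
    _ ≤ _ := mul_le_mul_of_nonneg_left h2 (ha x y)

variable {P s M n : ℝ}

/-- The flux bound at the constant function 1, combined with the mass bound. It controls the cutoff
error in the logarithmic energy estimate. -/
theorem IsDeGiorgiKernel.sum_sum_le (hK : IsDeGiorgiKernel K a m ρ P s M n) (hP : 1 ≤ P) :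
    ∑ x ∈ K, ∑ y ∈ K, a x y ≤ M ^ 2 := by
  have h := hK.flux (fun _ => 1) fun _ => zero_le_one
  simp only [one_mul, Real.one_rpow] at h
  have hM0 : 0 ≤ M := zero_le_one.trans hK.one_le
  have hP1 : 1 / P ≤ 1 := by rw [div_le_one (by linarith)]; exact hP
  have hP0 : 0 ≤ 1 / P := by positivity
  have h1 : (∑ x ∈ K, m x) ^ (1 / P) ≤ M :=
    calc (∑ x ∈ K, m x) ^ (1 / P) ≤ M ^ (1 / P) :=
          Real.rpow_le_rpow (Finset.sum_nonneg fun x _ => (hK.m_pos x).le) hK.mass hP0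
      _ ≤ M := (Real.rpow_le_rpow_of_exponent_le hK.one_le hP1).trans_eq (Real.rpow_one M)
  rw [sq]
  exact h.trans (mul_le_mul_of_nonneg_left h1 hM0)

/-- The differential form of the logarithmic energy estimate. -/
theorem IsSolutionOn.log_energy_deriv_le (h : IsSolutionOn K a m ρ R I v v')
    (hK : IsDeGiorgiKernel K a m ρ P s M n) (hP : 1 ≤ P) (hn : 0 < n) (hΛ : 0 < Λ)
    (hv : ∀ t ∈ I, ∀ x ∈ K, 0 < v t x) {R' : ℝ} (hR : R' + n / 8 = R) {t : ℝ} (ht : t ∈ I) :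
    ∑ x ∈ K, linearCutoff R' R (ρ x) ^ 2 * m x * (-(v' t x / v t x) / Λ) ≤
      64 * M ^ 2 / (Λ * n ^ 2) - Λ / 4 *
        dirichletForm (K.filter fun x => ρ x ≤ R') a (fun x => -Real.log (v t x) / Λ) := by
  have hRR : R' < R := by linarith
  set η : V → ℝ := fun x => linearCutoff R' R (ρ x) with hη
  have hη0 : ∀ x, 0 ≤ η x := fun x => linearCutoff_nonneg _ _ _
  have h1 : ∑ x ∈ K, η x ^ 2 * m x * (-(v' t x / v t x) / Λ) =
      ∑ x ∈ K, (-(η x ^ 2 / v t x) / Λ) * ∑ y ∈ K, a x y * (v t y - v t x) := by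
    refine Finset.sum_congr rfl fun x hx => ?_
    by_cases hρ : ρ x ≤ R
    · rw [mul_assoc, h.mul_deriv_log_eq ht hx hρ]
      simp only [div_eq_mul_inv, mul_inv]
      ring
    · have : η x = 0 := linearCutoff_eq_zero hRR (not_le.1 hρ).le
      rw [this]; simp
  have h2 : ∑ x ∈ K, η x ^ 2 * m x * (-(v' t x / v t x) / Λ) =
      ∑ x ∈ K, ∑ y ∈ K, 1 / (2 * Λ) *
        (a x y * ((η x ^ 2 / v t x - η y ^ 2 / v t y) * (v t x - v t y))) := by
    rw [h1, sum_mul_laplacian_eq K hK.symm, Finset.mul_sum]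
    refine Finset.sum_congr rfl fun x _ => ?_
    rw [Finset.mul_sum]
    refine Finset.sum_congr rfl fun y _ => ?_
    field_simp
    ring
  set g : V → ℝ := fun x => -Real.log (v t x) / Λ with hg
  have h3 : ∑ x ∈ K, η x ^ 2 * m x * (-(v' t x / v t x) / Λ) ≤
      ∑ x ∈ K, ∑ y ∈ K, (1 / Λ * (64 / n ^ 2) * a x y -
        Λ / 4 * (η x * η y * (a x y * (g x - g y) ^ 2))) := by
    rw [h2]
    refine Finset.sum_le_sum fun x hx => Finset.sum_le_sum fun y hy => ?_
    by_cases ha : a x y = 0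
    · simp [ha]
    -- Multiplied by 1/(2Λ), the gain Λ²/2 becomes the coefficient Λ/4, and the error 2(η_x - η_y)²
    -- ≤ 2·64/n² becomes 64/(Λn²); 64 = 8² comes from R - R' = n/8.
    have e1 := log_edge_inequality (hη0 x) (hη0 y) (hv t ht x hx) (hv t ht y hy)
    have e2 : (η x - η y) ^ 2 ≤ 64 / n ^ 2 := by
      refine (linearCutoff_sub_sq_le hRR (hK.lip x y ha)).trans_eq ?_
      have : R - R' = n / 8 := by linarith
      rw [this]; field_simp; norm_num
    have e3 : (Real.log (v t x) - Real.log (v t y)) ^ 2 = Λ ^ 2 * (g x - g y) ^ 2 := by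
      simp only [hg]; field_simp; ring
    rw [e3] at e1
    have e4 : (η x ^ 2 / v t x - η y ^ 2 / v t y) * (v t x - v t y) ≤
        2 * (64 / n ^ 2) - η x * η y * (Λ ^ 2 * (g x - g y) ^ 2) / 2 := by linarith
    have e5 := mul_le_mul_of_nonneg_left (mul_le_mul_of_nonneg_left e4 (hK.nonneg x y))
      (show 0 ≤ 1 / (2 * Λ) by positivity)
    refine e5.trans_eq ?_
    field_simp
    ring
  refine h3.trans ?_
  simp only [Finset.sum_sub_distrib, ← Finset.mul_sum]
  have h4 := hK.sum_sum_le hP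
  have h5 : dirichletForm (K.filter fun x => ρ x ≤ R') a g ≤
      ∑ x ∈ K, ∑ y ∈ K, η x * η y * (a x y * (g x - g y) ^ 2) := by
    have hnn : ∀ x y, 0 ≤ η x * η y * (a x y * (g x - g y) ^ 2) := fun x y =>
      mul_nonneg (mul_nonneg (hη0 x) (hη0 y)) (mul_nonneg (hK.nonneg x y) (sq_nonneg _))
    calc dirichletForm (K.filter fun x => ρ x ≤ R') a g
        = ∑ x ∈ K with ρ x ≤ R', ∑ y ∈ K with ρ y ≤ R',
            η x * η y * (a x y * (g x - g y) ^ 2) := by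
          refine Finset.sum_congr rfl fun x hx => Finset.sum_congr rfl fun y hy => ?_
          have e1 : η x = 1 := linearCutoff_eq_one hRR (Finset.mem_filter.1 hx).2
          have e2 : η y = 1 := linearCutoff_eq_one hRR (Finset.mem_filter.1 hy).2
          rw [e1, e2, one_mul, one_mul]
      _ ≤ ∑ x ∈ K with ρ x ≤ R', ∑ y ∈ K, η x * η y * (a x y * (g x - g y) ^ 2) :=
          Finset.sum_le_sum fun x _ => Finset.sum_le_sum_of_subset_of_nonneg
            (Finset.filter_subset _ _) fun y _ _ => hnn x y
      _ ≤ _ := Finset.sum_le_sum_of_subset_of_nonneg (Finset.filter_subset _ _)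
            fun x _ _ => Finset.sum_nonneg fun y _ => hnn x y
  have h6 : 1 / Λ * (64 / n ^ 2) * ∑ x ∈ K, ∑ y ∈ K, a x y ≤ 64 * M ^ 2 / (Λ * n ^ 2) := by
    refine (mul_le_mul_of_nonneg_left h4 (by positivity)).trans_eq ?_
    field_simp
  have h7 := mul_le_mul_of_nonneg_left h5 (show 0 ≤ Λ / 4 by positivity)
  have h8 : ∑ x ∈ K, Λ / 4 * ∑ y ∈ K, η x * η y * (a x y * (g x - g y) ^ 2) =
      Λ / 4 * ∑ x ∈ K, ∑ y ∈ K, η x * η y * (a x y * (g x - g y) ^ 2) := by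
    rw [Finset.mul_sum]
  linarith

/-- The logarithmic energy estimate. -/
theorem IsSolutionOn.log_energy_le {t₁ t₀ : ℝ}
    (h : IsSolutionOn K a m ρ R (Set.Icc t₁ t₀) v v')
    (hK : IsDeGiorgiKernel K a m ρ P s M n) (hP : 1 ≤ P) (hn : 0 < n) (hΛ : 0 < Λ)
    (hv : ∀ t ∈ Set.Icc t₁ t₀, ∀ x ∈ K, 0 < v t x) {R' : ℝ} (hR : R' + n / 8 = R)
    (htime : t₀ ≤ t₁ + n ^ 2 / 8) {t : ℝ} (ht : t ∈ Set.Icc t₁ t₀) :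
    ∑ x ∈ K, linearCutoff R' R (ρ x) ^ 2 * m x * (-Real.log (v t x) / Λ) + Λ / 4 *
        ∫ τ in t₁..t, dirichletForm (K.filter fun x => ρ x ≤ R') a
          (fun x => -Real.log (v τ x) / Λ) ≤
      ∑ x ∈ K, linearCutoff R' R (ρ x) ^ 2 * m x * (-Real.log (v t₁ x) / Λ) + 8 * M ^ 2 / Λ := by
  have hRR : R' < R := by linarith
  have hDc : ContinuousOn (fun τ => dirichletForm (K.filter fun x => ρ x ≤ R') a
      (fun x => -Real.log (v τ x) / Λ)) (Set.Icc t₁ t₀) :=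
    continuousOn_finsetSum _ fun x hx => continuousOn_finsetSum _ fun y hy =>
      continuousOn_const.mul (((h.continuousOn_log hv (Finset.mem_filter.1 hx).1).sub
        (h.continuousOn_log hv (Finset.mem_filter.1 hy).1)).pow 2)
  have hder : ∀ τ ∈ Set.Icc t₁ t₀, HasDerivWithinAt
      (fun t => ∑ x ∈ K, linearCutoff R' R (ρ x) ^ 2 * m x * (-Real.log (v t x) / Λ))
      (∑ x ∈ K, linearCutoff R' R (ρ x) ^ 2 * m x * (-(v' τ x / v τ x) / Λ))
      (Set.Icc t₁ t₀) τ := by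
    intro τ hτ
    refine HasDerivWithinAt.fun_sum fun x hx => ?_
    by_cases hρ : ρ x ≤ R
    · exact (h.hasDerivWithinAt_log hv hτ hx hρ).const_mul _
    · rw [linearCutoff_eq_zero hRR (not_le.1 hρ).le]
      simpa using hasDerivWithinAt_const τ (Set.Icc t₁ t₀) (0 : ℝ)
  have h1 := sub_le_integral_of_hasDerivWithinAt_Icc le_rfl ht.1 ht.2 hder
    (φ := fun τ => 64 * M ^ 2 / (Λ * n ^ 2) - Λ / 4 *
        dirichletForm (K.filter fun x => ρ x ≤ R') a (fun x => -Real.log (v τ x) / Λ))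
    (continuousOn_const.sub (continuousOn_const.mul hDc))
    fun τ hτ => h.log_energy_deriv_le hK hP hn hΛ hv hR hτ
  have hii : IntervalIntegrable (fun τ => Λ / 4 * dirichletForm (K.filter fun x => ρ x ≤ R') a
      (fun x => -Real.log (v τ x) / Λ)) MeasureTheory.volume t₁ t := by
    refine ContinuousOn.intervalIntegrable ?_
    rw [Set.uIcc_of_le ht.1]
    exact (continuousOn_const.mul hDc).mono (Set.Icc_subset_Icc le_rfl ht.2)
  rw [intervalIntegral.integral_sub intervalIntegrable_const hii,
    intervalIntegral.integral_const_mul, intervalIntegral.integral_const, smul_eq_mul] at h1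
  have h2 : (t - t₁) * (64 * M ^ 2 / (Λ * n ^ 2)) ≤ 8 * M ^ 2 / Λ := by
    calc (t - t₁) * (64 * M ^ 2 / (Λ * n ^ 2)) ≤ n ^ 2 / 8 * (64 * M ^ 2 / (Λ * n ^ 2)) :=
          mul_le_mul_of_nonneg_right (by linarith [ht.2]) (by positivity)
      _ = 8 * M ^ 2 / Λ := by field_simp; norm_num
  linarith
end

/-! ### Poincaré inequality for functions vanishing on a set of positive density -/

/-- A weak form of Young's inequality: below a threshold the power is at most l, and above it the
quotient x^(b-1) is at most its value at the threshold. It trades a sublinear power of the energy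
for a small constant plus a multiple of the energy, which can be integrated in time. -/
theorem exists_mul_rpow_le_add_mul {b C l : ℝ} (hb0 : 0 < b) (hb1 : b ≤ 1) (hC : 0 ≤ C)
    (hl : 0 < l) : ∃ D, 0 ≤ D ∧ ∀ x, 0 ≤ x → C * x ^ b ≤ l + D * x := by
  set x₀ : ℝ := (l / (C + 1)) ^ (1 / b) with hx₀
  have hx₀0 : 0 < x₀ := Real.rpow_pos_of_pos (by positivity) _
  refine ⟨C * x₀ ^ (b - 1), by positivity, fun x hx => ?_⟩
  rcases le_total x x₀ with h | h
  · have h1 : x ^ b ≤ l / (C + 1) := by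
      refine (Real.rpow_le_rpow hx h hb0.le).trans_eq ?_
      rw [hx₀, ← Real.rpow_mul (by positivity), one_div_mul_cancel hb0.ne', Real.rpow_one]
    have h2 : C * x ^ b ≤ l := by
      calc C * x ^ b ≤ C * (l / (C + 1)) := mul_le_mul_of_nonneg_left h1 hC
        _ ≤ l := by
          rw [mul_div_assoc', div_le_iff₀ (by positivity)]
          nlinarith
    have : 0 ≤ C * x₀ ^ (b - 1) * x := by positivity
    linarith
  · have hx0 : 0 < x := hx₀0.trans_le h
    have h1 : x ^ b = x ^ (b - 1) * x := by rw [Real.rpow_sub_one hx0.ne']; field_simp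
    have h2 : x ^ (b - 1) ≤ x₀ ^ (b - 1) :=
      Real.rpow_le_rpow_of_nonpos hx₀0 h (by linarith)
    rw [h1, ← mul_assoc]
    have := mul_le_mul_of_nonneg_right (mul_le_mul_of_nonneg_left h2 hC) hx
    linarith

theorem filter_dist_le_eq_latticeBall {d : ℕ} (x₀ : Fin d → ℤ) {R n : ℝ} (hR : R ≤ n) :
    (latticeBall x₀ n).filter (fun x => ((latticeGraph d).dist x₀ x : ℝ) ≤ R) =
      latticeBall x₀ R := by
  ext x
  rw [Finset.mem_filter, mem_latticeBall, mem_latticeBall]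
  exact ⟨fun h => h.2, fun h => ⟨h.trans hR, h⟩⟩

theorem dirichletForm_max_zero_le {V : Type*} {K : Finset V} {a : V → V → ℝ}
    (ha : ∀ x y, 0 ≤ a x y) (g : V → ℝ) :
    dirichletForm K a (fun x => max (g x) 0) ≤ dirichletForm K a g := by
  refine Finset.sum_le_sum fun x _ => Finset.sum_le_sum fun y _ =>
    mul_le_mul_of_nonneg_left ?_ (ha x y)
  rw [sq_le_sq]
  refine (abs_max_sub_max_le_max _ _ _ _).trans ?_
  rw [sub_self, abs_zero, max_eq_left (abs_nonneg _)]

section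
variable {d : ℕ} {p q r M : ℝ}

/-- A set which carries a fixed part of the speed measure has a fixed part of the volume. -/
theorem HasMomentBounds.le_card_of_le_sum {ω : Sym2 (Fin d → ℤ) → ℝ} {θ : (Fin d → ℤ) → ℝ}
    {x₀ : Fin d → ℤ} {n κ : ℝ} (h : HasMomentBounds ω θ x₀ n p q r M) (hn : 0 ≤ n) (hr : 1 < r)
    (hκ : 0 < κ) {Z : Finset (Fin d → ℤ)} (hZ : Z ⊆ latticeBall x₀ n)
    (hsum : κ * (latticeBall x₀ n).card ≤ ∑ x ∈ Z, θ x) :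
    (κ / M ^ (1 / r)) ^ (1 / (1 - 1 / r)) * (latticeBall x₀ n).card ≤ Z.card := by
  set N : ℝ := ((latticeBall x₀ n).card : ℝ) with hN
  have hN0 : 0 < N := card_latticeBall_pos x₀ hn
  have hM0 : 0 < M := zero_lt_one.trans_le h.one_le
  have hr0 : 0 < r := by linarith
  have hr1 : 1 / r < 1 := by rw [div_lt_one hr0]; exact hr
  have hr2 : 0 < 1 - 1 / r := by linarith
  -- By Hölder, θ(Z) is at most the ℓ^r norm of θ times |Z|^(1-1/r), so a large mass cannot sit on
  -- few points.
  have h1 := sum_rpow_mul_rpow_one_sub_le Z (a := 1 / r) (by positivity) hr1.le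
    (f := fun x => θ x ^ r) (g := fun _ => 1) (fun x _ => Real.rpow_nonneg (h.θ_pos x).le r)
    (fun _ _ => zero_le_one)
  simp only [Real.one_rpow, mul_one, Finset.sum_const, nsmul_eq_mul] at h1
  have h2 : ∑ x ∈ Z, θ x ≤ N * (M ^ (1 / r) * (Z.card / N) ^ (1 - 1 / r)) := by
    rw [← mul_rpow_mul_rpow_one_sub hN0 hM0.le (Nat.cast_nonneg _)]
    calc ∑ x ∈ Z, θ x = ∑ x ∈ Z, (θ x ^ r) ^ (1 / r) := Finset.sum_congr rfl fun x _ => by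
          rw [← Real.rpow_mul (h.θ_pos x).le, mul_one_div_cancel hr0.ne', Real.rpow_one]
      _ ≤ _ := h1
      _ ≤ _ := by
        refine mul_le_mul_of_nonneg_right (Real.rpow_le_rpow (Finset.sum_nonneg fun x _ =>
          Real.rpow_nonneg (h.θ_pos x).le _) ?_ (by positivity)) (by positivity)
        exact (Finset.sum_le_sum_of_subset_of_nonneg hZ fun x _ _ =>
          Real.rpow_nonneg (h.θ_pos x).le _).trans h.theta_le
  have hMr : 0 < M ^ (1 / r) := Real.rpow_pos_of_pos hM0 _
  have h3 : κ / M ^ (1 / r) ≤ (Z.card / N) ^ (1 - 1 / r) := by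
    rw [div_le_iff₀' hMr]
    have := hsum.trans h2
    rw [mul_comm] at this
    exact le_of_mul_le_mul_left this hN0
  have h4 := Real.rpow_le_rpow (by positivity) h3 (show 0 ≤ 1 / (1 - 1 / r) by positivity)
  rw [← Real.rpow_mul (by positivity), mul_one_div_cancel hr2.ne', Real.rpow_one] at h4
  rwa [← le_div_iff₀ hN0]

/-- The Poincaré inequality for functions whose positive part vanishes on a set of positive
density. -/
theorem HasMomentBounds.sum_posPart_le {ω : Sym2 (Fin d → ℤ) → ℝ} {θ : (Fin d → ℤ) → ℝ}
    {x₀ : Fin d → ℤ} {n z : ℝ} (h : HasMomentBounds ω θ x₀ n p q r M) (hd : 2 ≤ d) (hn : 8 ≤ n)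
    (hq : 1 < q) (hz : 0 < z) (g : (Fin d → ℤ) → ℝ)
    (hZ : z * (latticeBall x₀ n).card ≤
      ((latticeBall x₀ (3 * n / 8)).filter fun x => g x ≤ 0).card) :
    (∑ x ∈ latticeBall x₀ (3 * n / 8), max (g x) 0) / (latticeBall x₀ n).card ≤
      (12 * d) ^ d / z * M * (n ^ 2 * dirichletForm (latticeBall x₀ (3 * n / 4))
        (latticeKernel fun e => ω e / (latticeBall x₀ n).card) g) ^ (1 / 2 : ℝ) := by
  set N : ℝ := ((latticeBall x₀ n).card : ℝ) with hN
  have hN0 : 0 < N := card_latticeBall_pos x₀ (by linarith)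
  set B := latticeBall x₀ (3 * n / 8) with hB
  set w : (Fin d → ℤ) → ℝ := fun x => max (g x) 0 with hw
  have hw0 : ∀ x, 0 ≤ w x := fun x => le_max_right _ _
  set Z := B.filter fun x => g x ≤ 0 with hZdef
  set D := dirichletForm (latticeBall x₀ (3 * n / 4)) (latticeKernel fun e => ω e / N) g with hD
  have hωN : ∀ e ∈ (latticeGraph d).edgeSet, 0 < ω e / N := fun e he => div_pos (h.ω_pos e he) hN0
  have hD0 : 0 ≤ D := dirichletForm_nonneg (latticeKernel_nonneg hωN) g
  have hM0 : 0 ≤ M := zero_le_one.trans h.one_le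
  have hd0 : 0 < d := by omega
  set G := gradientNorm (latticeBall x₀ (3 * n / 4)) w with hG
  have hG0 : 0 ≤ G := gradientNorm_nonneg _ _
  have h2R : 2 * (3 * n / 8) = 3 * n / 4 := by ring
  -- Since w = 0 on `Z`, the pairs (x, y) with y ∈ Z already account for |Z| ∑ w. The weak Poincaré
  -- inequality doubles the radius from 3n/8 to 3n/4.
  have h1 : (Z.card : ℝ) * ∑ x ∈ B, w x ≤ (12 * d) ^ d * N * (3 * n / 4) * G := by
    calc (Z.card : ℝ) * ∑ x ∈ B, w x = ∑ y ∈ Z, ∑ x ∈ B, |w x - w y| := by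
          rw [← nsmul_eq_mul, ← Finset.sum_const]
          refine Finset.sum_congr rfl fun y hy => Finset.sum_congr rfl fun x _ => ?_
          have : w y = 0 := max_eq_right (Finset.mem_filter.1 hy).2
          rw [this, sub_zero, abs_of_nonneg (hw0 x)]
      _ ≤ ∑ y ∈ B, ∑ x ∈ B, |w x - w y| :=
          Finset.sum_le_sum_of_subset_of_nonneg (Finset.filter_subset _ _)
            fun _ _ _ => Finset.sum_nonneg fun _ _ => abs_nonneg _
      _ ≤ _ := sum_sum_abs_sub_le x₀ w
      _ ≤ _ := by
          rw [h2R]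
          refine mul_le_mul_of_nonneg_right (mul_le_mul_of_nonneg_right ?_ (by positivity)) hG0
          refine (card_latticeBall_le_mul hd0 0 x₀ (by linarith)).trans ?_
          refine mul_le_mul_of_nonneg_left ?_ (by positivity)
          exact Nat.cast_le.2 (Finset.card_le_card (latticeBall_mono x₀ (by linarith)))
  have h2 : G ^ 2 ≤ (N * D) * (N * M) := by
    refine (gradientNorm_sq_le h.ω_pos _ w).trans ?_
    have e1 : dirichletForm (latticeBall x₀ (3 * n / 4)) (latticeKernel ω) w ≤ N * D := by
      rw [hD, dirichletForm_latticeKernel_div, mul_div_cancel₀ _ hN0.ne']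
      exact dirichletForm_max_zero_le (latticeKernel_nonneg h.ω_pos) g
    have e2 : ∑ x ∈ latticeBall x₀ (3 * n / 4), condNu ω x ≤ N * M :=
      (Finset.sum_le_sum_of_subset_of_nonneg (latticeBall_mono x₀ (by linarith))
        fun x _ _ => condNu_nonneg h.ω_pos x).trans
        (sum_le_of_sum_rpow_le _ (fun x _ => condNu_nonneg h.ω_pos x) le_rfl hq h.one_le h.nu_le)
    exact mul_le_mul e1 e2 (Finset.sum_nonneg fun x _ => condNu_nonneg h.ω_pos x) (by positivity)
  have h3 : n * G ≤ N * M * (n ^ 2 * D) ^ (1 / 2 : ℝ) := by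
    rw [← Real.sqrt_eq_rpow]
    refine abs_le_of_sq_le_sq' ?_ (by positivity) |>.2
    rw [mul_pow, mul_pow, mul_pow, Real.sq_sqrt (by positivity)]
    have hMM : M ≤ M ^ 2 := by nlinarith [h.one_le]
    calc n ^ 2 * G ^ 2 ≤ n ^ 2 * (N * D * (N * M)) := mul_le_mul_of_nonneg_left h2 (sq_nonneg n)
      _ = N ^ 2 * M * (n ^ 2 * D) := by ring
      _ ≤ N ^ 2 * M ^ 2 * (n ^ 2 * D) := by gcongr
  have hS0 : 0 ≤ ∑ x ∈ B, w x := Finset.sum_nonneg fun x _ => hw0 x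
  have h4 : z * N * ∑ x ∈ B, w x ≤ (12 * d) ^ d * N * (N * M * (n ^ 2 * D) ^ (1 / 2 : ℝ)) := by
    calc z * N * ∑ x ∈ B, w x ≤ Z.card * ∑ x ∈ B, w x := mul_le_mul_of_nonneg_right hZ hS0
      _ ≤ (12 * d) ^ d * N * (3 * n / 4) * G := h1
      _ ≤ (12 * d) ^ d * N * (n * G) := by
          rw [mul_assoc ((12 * (d : ℝ)) ^ d * N)]
          refine mul_le_mul_of_nonneg_left (mul_le_mul_of_nonneg_right ?_ hG0) (by positivity)
          linarith
      _ ≤ _ := mul_le_mul_of_nonneg_left h3 (by positivity)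
  rw [div_le_iff₀ hN0]
  have h5 : z * N * ∑ x ∈ B, w x ≤ z * N * ((12 * d) ^ d / z * M * (n ^ 2 * D) ^ (1 / 2 : ℝ) * N) := by
    refine h4.trans_eq ?_
    field_simp
  exact le_of_mul_le_mul_left h5 (by positivity)

/-- Mass on {g ≤ 0} gives a positive density of zeros of the positive part, so its mean is bounded
by the square root of the energy. Hölder in θ turns this into a bound of the excess by a power b/2 <
1 of the energy, and Young's inequality makes the constant term as small as desired. -/
theorem exists_excessNorm_le (hd : 2 ≤ d) (hq : 1 < q) (hr : 1 < r) (hM : 1 ≤ M) {P κ l : ℝ}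
    (hP : 1 ≤ P) (hκ : 0 < κ) (hl : 0 < l) :
    ∃ D, 0 ≤ D ∧ ∀ (ω : Sym2 (Fin d → ℤ) → ℝ) (θ : (Fin d → ℤ) → ℝ) (x₀ : Fin d → ℤ) (n : ℝ),
      8 ≤ n → HasMomentBounds ω θ x₀ n p q r M → ∀ g : (Fin d → ℤ) → ℝ,
      (∀ x ∈ latticeBall x₀ n, g x ≤ 1) →
      κ * (latticeBall x₀ n).card ≤ ∑ x ∈ latticeBall x₀ (3 * n / 8) with g x ≤ 0, θ x →
      excessNorm (latticeBall x₀ n) (fun x => θ x / (latticeBall x₀ n).card)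
          (fun x => (latticeGraph d).dist x₀ x) P (3 * n / 8) 0 g ≤
        l + D * (n ^ 2 * dirichletForm (latticeBall x₀ (3 * n / 4))
          (latticeKernel fun e => ω e / (latticeBall x₀ n).card) g) := by
  have hr0 : 0 < r := by linarith
  have hP0 : 0 < P := by linarith
  have hM0 : 0 < M := by linarith
  have hr1 : 1 / r < 1 := by rw [div_lt_one hr0]; exact hr
  have hr2 : 0 < 1 - 1 / r := by linarith
  set z : ℝ := (κ / M ^ (1 / r)) ^ (1 / (1 - 1 / r)) with hz
  have hz0 : 0 < z := by positivity
  set C : ℝ := (12 * d) ^ d / z * M with hC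
  have hC0 : 0 ≤ C := by positivity
  set b : ℝ := (1 - 1 / r) * (1 / P) with hb
  have hP1 : 1 / P ≤ 1 := by rw [div_le_one hP0]; exact hP
  have hb0 : 0 < b := by positivity
  have hb1 : b ≤ 1 := mul_le_one₀ (by linarith [one_div_pos.2 hr0]) (by positivity) hP1
  obtain ⟨D, hD0, hD⟩ := exists_mul_rpow_le_add_mul (b := b / 2)
    (C := M ^ (1 / r * (1 / P)) * C ^ b) (by positivity) (by linarith) (by positivity) hl
  refine ⟨D, hD0, fun ω θ x₀ n hn h g hg hsum => ?_⟩
  set N : ℝ := ((latticeBall x₀ n).card : ℝ) with hN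
  have hN0 : 0 < N := card_latticeBall_pos x₀ (by linarith)
  have hωN : ∀ e ∈ (latticeGraph d).edgeSet, 0 < ω e / N := fun e he => div_pos (h.ω_pos e he) hN0
  set E := dirichletForm (latticeBall x₀ (3 * n / 4)) (latticeKernel fun e => ω e / N) g with hE
  have hE0 : 0 ≤ E := dirichletForm_nonneg (latticeKernel_nonneg hωN) g
  set B := latticeBall x₀ (3 * n / 8) with hB
  have hBK : B ⊆ latticeBall x₀ n := latticeBall_mono x₀ (by linarith)
  have hcard := h.le_card_of_le_sum (by linarith) hr hκ
    ((Finset.filter_subset (fun x => g x ≤ 0) B).trans hBK) hsum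
  have hpoin := h.sum_posPart_le hd hn hq hz0 g hcard
  set w : (Fin d → ℤ) → ℝ := fun x => max (g x) 0 with hw
  have hw0 : ∀ x, 0 ≤ w x := fun x => le_max_right _ _
  have hw1 : ∀ x ∈ B, w x ≤ 1 := fun x hx => max_le (hg x (hBK hx)) zero_le_one
  set S := ∑ x ∈ B, w x with hS
  have hS0 : 0 ≤ S := Finset.sum_nonneg fun x _ => hw0 x
  have h1 : ∑ x ∈ B, w x ^ P * θ x ≤ N * (M ^ (1 / r) * (S / N) ^ (1 - 1 / r)) := by
    rw [← mul_rpow_mul_rpow_one_sub hN0 hM0.le hS0]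
    calc ∑ x ∈ B, w x ^ P * θ x ≤ ∑ x ∈ B, (θ x ^ r) ^ (1 / r) * w x ^ (1 - 1 / r) := by
          refine Finset.sum_le_sum fun x hx => ?_
          rw [← Real.rpow_mul (h.θ_pos x).le, mul_one_div_cancel hr0.ne', Real.rpow_one, mul_comm]
          refine mul_le_mul_of_nonneg_left ?_ (h.θ_pos x).le
          -- The values of w are at most 1, so the exponent P may be lowered to 1 - 1/r.
          exact Real.rpow_le_rpow_of_exponent_ge_of_imp (hw0 x) (hw1 x hx)
            (by linarith [one_div_pos.2 hr0]) fun _ h0 => absurd h0 hP0.ne'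
      _ ≤ (∑ x ∈ B, θ x ^ r) ^ (1 / r) * S ^ (1 - 1 / r) :=
          sum_rpow_mul_rpow_one_sub_le B (by positivity) hr1.le
            (fun x _ => Real.rpow_nonneg (h.θ_pos x).le r) fun x _ => hw0 x
      _ ≤ _ := by
        refine mul_le_mul_of_nonneg_right (Real.rpow_le_rpow (Finset.sum_nonneg fun x _ =>
          Real.rpow_nonneg (h.θ_pos x).le _) ?_ (by positivity)) (by positivity)
        exact (Finset.sum_le_sum_of_subset_of_nonneg hBK fun x _ _ =>
          Real.rpow_nonneg (h.θ_pos x).le _).trans h.theta_le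
  have h2 : ∑ x ∈ B, w x ^ P * (θ x / N) ≤ M ^ (1 / r) * (S / N) ^ (1 - 1 / r) := by
    have : ∑ x ∈ B, w x ^ P * (θ x / N) = (∑ x ∈ B, w x ^ P * θ x) / N := by
      rw [Finset.sum_div]; exact Finset.sum_congr rfl fun x _ => by ring
    rw [this, div_le_iff₀ hN0, mul_comm]
    exact h1
  have hSN : 0 ≤ S / N := div_nonneg hS0 hN0.le
  have hx0 : 0 ≤ n ^ 2 * E := by positivity
  refine le_trans ?_ (hD (n ^ 2 * E) hx0)
  rw [excessNorm, filter_dist_le_eq_latticeBall x₀ (by linarith)]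
  simp only [sub_zero]
  calc (∑ x ∈ B, w x ^ P * (θ x / N)) ^ (1 / P)
      ≤ (M ^ (1 / r) * (S / N) ^ (1 - 1 / r)) ^ (1 / P) :=
        Real.rpow_le_rpow (Finset.sum_nonneg fun x _ => mul_nonneg (Real.rpow_nonneg (hw0 x) _)
          (div_pos (h.θ_pos x) hN0).le) h2 (by positivity)
    _ = M ^ (1 / r * (1 / P)) * (S / N) ^ b := by
        rw [Real.mul_rpow (by positivity) (by positivity), ← Real.rpow_mul hM0.le,
          ← Real.rpow_mul hSN]
    _ ≤ M ^ (1 / r * (1 / P)) * (C * (n ^ 2 * E) ^ (1 / 2 : ℝ)) ^ b := by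
        gcongr
    _ = _ := by
        rw [Real.mul_rpow hC0 (by positivity), ← Real.rpow_mul hx0, mul_assoc]
        congr 3
        ring
end

/-! ### Persistence and growth of positivity -/

section
variable {d : ℕ} {p q r M : ℝ}

/-- The cutoff speed measure is bounded from below by the harmonic mean. -/
theorem HasMomentBounds.le_sum_cutoff {ω : Sym2 (Fin d → ℤ) → ℝ} {θ : (Fin d → ℤ) → ℝ}
    {x₀ : Fin d → ℤ} {n : ℝ} (h : HasMomentBounds ω θ x₀ n p q r M) (hd : 0 < d) (hn : 1 ≤ n) :
    1 / (((12 * d) ^ d) ^ 2 * M) ≤ ∑ x ∈ latticeBall x₀ n,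
      linearCutoff (n / 4) (3 * n / 8) ((latticeGraph d).dist x₀ x) ^ 2 *
        (θ x / (latticeBall x₀ n).card) := by
  set N : ℝ := ((latticeBall x₀ n).card : ℝ) with hN
  have hN0 : 0 < N := card_latticeBall_pos x₀ (by linarith)
  have hM0 : 0 < M := zero_lt_one.trans_le h.one_le
  have hd' : (0 : ℝ) < d := by exact_mod_cast hd
  set b : ℝ := ((latticeBall x₀ (n / 4)).card : ℝ) with hb
  have hbN : N ≤ (12 * d) ^ d * b := card_latticeBall_le_mul hd x₀ x₀ hn
  have hsub : latticeBall x₀ (n / 4) ⊆ latticeBall x₀ n := latticeBall_mono x₀ (by linarith)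
  have hθN : ∀ x, 0 < θ x / N := fun x => div_pos (h.θ_pos x) hN0
  -- Cauchy–Schwarz for 1 = θ·(1/θ): |B(n/4)|² ≤ θ(B(n/4)) ∑ 1/θ. Comparing |B(n/4)|² with |B(n)|²
  -- squares the doubling constant.
  have hcs := Finset.sum_sq_le_sum_mul_sum_of_sq_le_mul (latticeBall x₀ (n / 4))
    (r := fun _ => (1 : ℝ)) (f := θ) (g := fun x => 1 / θ x) (fun x _ => (h.θ_pos x).le)
    (fun x _ => (one_div_pos.2 (h.θ_pos x)).le)
    (fun x _ => by rw [mul_one_div_cancel (h.θ_pos x).ne', one_pow])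
  simp only [Finset.sum_const, nsmul_eq_mul, mul_one] at hcs
  have hinv : ∑ x ∈ latticeBall x₀ (n / 4), 1 / θ x ≤ N * M :=
    (Finset.sum_le_sum_of_subset_of_nonneg hsub fun x _ _ =>
      (one_div_pos.2 (h.θ_pos x)).le).trans h.inv_theta_le
  set T := ∑ x ∈ latticeBall x₀ (n / 4), θ x with hT
  have hT0 : 0 ≤ T := Finset.sum_nonneg fun x _ => (h.θ_pos x).le
  have h1 : b ^ 2 ≤ T * (N * M) := hcs.trans (mul_le_mul_of_nonneg_left hinv hT0)
  have h2 : T / N ≤ ∑ x ∈ latticeBall x₀ n,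
      linearCutoff (n / 4) (3 * n / 8) ((latticeGraph d).dist x₀ x) ^ 2 * (θ x / N) := by
    rw [hT, Finset.sum_div]
    refine le_trans (Finset.sum_le_sum fun x hx => ?_)
      (Finset.sum_le_sum_of_subset_of_nonneg hsub fun x _ _ =>
        mul_nonneg (sq_nonneg _) (hθN x).le)
    rw [linearCutoff_eq_one (by linarith) (mem_latticeBall.1 hx), one_pow, one_mul]
  refine le_trans ?_ h2
  rw [div_le_div_iff₀ (by positivity) hN0, one_mul]
  have h3 : N ^ 2 ≤ ((12 * (d : ℝ)) ^ d) ^ 2 * b ^ 2 := by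
    rw [← mul_pow]; exact pow_le_pow_left₀ hN0.le hbN 2
  have h4 : N * N ≤ N * (T * (((12 * (d : ℝ)) ^ d) ^ 2 * M)) := by
    calc N * N = N ^ 2 := (sq N).symm
      _ ≤ _ := h3
      _ ≤ ((12 * (d : ℝ)) ^ d) ^ 2 * (T * (N * M)) :=
          mul_le_mul_of_nonneg_left h1 (by positivity)
      _ = _ := by ring
  exact le_of_mul_le_mul_left h4 hN0

/-- Persistence: if a solution with values in `[exp (-Λ), 1]` is at least `1 / 2` on half of the
mass at the initial time, then `-log v / Λ ≤ 3 / 4` on a fixed part of the mass at all later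
times. -/
theorem IsSolutionOn.persistence {V : Type*} {K : Finset V} {a : V → V → ℝ} {m ρ : V → ℝ}
    {v v' : ℝ → V → ℝ} {Λ P s M n t₁ t₀ S : ℝ}
    (h : IsSolutionOn K a m ρ (3 * n / 8) (Set.Icc t₁ t₀) v v')
    (hK : IsDeGiorgiKernel K a m ρ P s M n) (hP : 1 ≤ P) (hn : 0 < n) (hΛ : 16 ≤ Λ)
    (hv : ∀ t ∈ Set.Icc t₁ t₀, ∀ x ∈ K, Real.exp (-Λ) ≤ v t x ∧ v t x ≤ 1)
    (htime : t₀ ≤ t₁ + n ^ 2 / 8) {t : ℝ} (ht : t ∈ Set.Icc t₁ t₀)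
    (hS : S = ∑ x ∈ K, linearCutoff (n / 4) (3 * n / 8) (ρ x) ^ 2 * m x)
    (hinit : S / 2 ≤
      ∑ x ∈ K with 1 / 2 ≤ v t₁ x, linearCutoff (n / 4) (3 * n / 8) (ρ x) ^ 2 * m x)
    (hΛM : 8 * M ^ 2 / Λ ≤ S / 16) :
    S / 6 ≤ ∑ x ∈ K with -Real.log (v t x) / Λ ≤ 3 / 4,
      linearCutoff (n / 4) (3 * n / 8) (ρ x) ^ 2 * m x := by
  have hΛ0 : 0 < Λ := by linarith
  have hvpos : ∀ t ∈ Set.Icc t₁ t₀, ∀ x ∈ K, 0 < v t x := fun t ht x hx =>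
    (Real.exp_pos _).trans_le (hv t ht x hx).1
  have ht₁ : t₁ ∈ Set.Icc t₁ t₀ := ⟨le_rfl, ht.1.trans ht.2⟩
  have henergy := h.log_energy_le hK hP hn hΛ0 hvpos (R' := n / 4) (by ring) htime ht
  have hint : 0 ≤ Λ / 4 * ∫ τ in t₁..t, dirichletForm (K.filter fun x => ρ x ≤ n / 4) a
      (fun x => -Real.log (v τ x) / Λ) :=
    mul_nonneg (by positivity) (intervalIntegral.integral_nonneg ht.1
      fun τ _ => dirichletForm_nonneg hK.nonneg _)
  set c : V → ℝ := fun x => linearCutoff (n / 4) (3 * n / 8) (ρ x) ^ 2 * m x with hc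
  have hc0 : ∀ x, 0 ≤ c x := fun x => mul_nonneg (sq_nonneg _) (hK.m_pos x).le
  have hg0 : ∀ t ∈ Set.Icc t₁ t₀, ∀ x ∈ K, 0 ≤ -Real.log (v t x) / Λ := fun t ht x hx =>
    div_nonneg (neg_nonneg.2 (Real.log_nonpos (hvpos t ht x hx).le (hv t ht x hx).2)) hΛ0.le
  have hg1 : ∀ t ∈ Set.Icc t₁ t₀, ∀ x ∈ K, -Real.log (v t x) / Λ ≤ 1 := fun t ht x hx => by
    rw [div_le_one hΛ0, neg_le]
    exact (Real.le_log_iff_exp_le (hvpos t ht x hx)).2 (hv t ht x hx).1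
  have hS0 : 0 ≤ S := by rw [hS]; exact Finset.sum_nonneg fun x _ => hc0 x
  -- Where v ≥ 1/2 one has -log v ≤ 1, so g ≤ 1/Λ ≤ 1/16; on the rest, at most half of the mass, g ≤
  -- 1. With the later growth S/16 the weighted sum of g stays below 5S/8. If {g ≤ 3/4} has mass Y,
  -- that sum is at least (3/4)(S - Y), hence Y ≥ S/6.
  have hF₁ : ∑ x ∈ K, c x * (-Real.log (v t₁ x) / Λ) ≤ S / 2 + S / 16 := by
    have hpt : ∀ x ∈ K, c x * (-Real.log (v t₁ x) / Λ) ≤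
        c x - (if 1 / 2 ≤ v t₁ x then c x else 0) + c x / 16 := by
      intro x hx
      split_ifs with hhalf
      · have h1 : -Real.log (v t₁ x) ≤ 1 := by
          rw [neg_le, Real.le_log_iff_exp_le (hvpos t₁ ht₁ x hx)]
          refine le_trans ?_ hhalf
          rw [Real.exp_neg, ← one_div]
          exact one_div_le_one_div_of_le two_pos (by linarith [Real.add_one_le_exp 1])
        have h2 : -Real.log (v t₁ x) / Λ ≤ 1 / 16 :=
          div_le_div₀ zero_le_one h1 (by norm_num) hΛ
        have := mul_le_mul_of_nonneg_left h2 (hc0 x)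
        linarith
      · have := mul_le_mul_of_nonneg_left (hg1 t₁ ht₁ x hx) (hc0 x)
        linarith [hc0 x]
    refine (Finset.sum_le_sum hpt).trans ?_
    rw [Finset.sum_add_distrib, Finset.sum_sub_distrib, ← Finset.sum_filter, ← Finset.sum_div,
      ← hS]
    linarith
  have hFt : 3 / 4 * (S - ∑ x ∈ K with -Real.log (v t x) / Λ ≤ 3 / 4, c x) ≤
      ∑ x ∈ K, c x * (-Real.log (v t x) / Λ) := by
    have hS' : S = ∑ x ∈ K, c x := hS
    rw [hS', Finset.sum_filter, ← Finset.sum_sub_distrib, Finset.mul_sum]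
    refine Finset.sum_le_sum fun x hx => ?_
    split_ifs with hx'
    · simpa using mul_nonneg (hc0 x) (hg0 t ht x hx)
    · have := mul_le_mul_of_nonneg_left (not_le.1 hx').le (hc0 x)
      linarith
  linarith

theorem IsSolutionOn.mono_radius {V : Type*} {K : Finset V} {a : V → V → ℝ} {m ρ : V → ℝ}
    {v v' : ℝ → V → ℝ} {R R' : ℝ} {I : Set ℝ} (h : IsSolutionOn K a m ρ R I v v') (hR : R' ≤ R) :
    IsSolutionOn K a m ρ R' I v v' :=
  ⟨h.cont, fun t ht x hx hx' => h.deriv t ht x hx (hx'.trans hR),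
    fun t ht x hx hx' => h.eq t ht x hx (hx'.trans hR)⟩

theorem dirichletForm_affine {V : Type*} (K : Finset V) (a : V → V → ℝ) (g : V → ℝ) (c e : ℝ) :
    dirichletForm K a (fun x => c * g x - e) = c ^ 2 * dirichletForm K a g := by
  simp only [dirichletForm, Finset.mul_sum]
  exact Finset.sum_congr rfl fun x _ => Finset.sum_congr rfl fun y _ => by ring

theorem IsSubsolutionOn.affine {V : Type*} {K : Finset V} {a : V → V → ℝ} {m ρ : V → ℝ}
    {g g' : ℝ → V → ℝ} {R : ℝ} {I : Set ℝ} (h : IsSubsolutionOn K a m ρ R I g g') {c : ℝ}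
    (hc : 0 ≤ c) (e : ℝ) : IsSubsolutionOn K a m ρ R I (fun t x => c * g t x - e)
      (fun t x => c * g' t x) := by
  refine ⟨fun x hx => (continuousOn_const.mul (h.cont x hx)).sub continuousOn_const,
    fun t ht x hx hR => ((h.deriv t ht x hx hR).const_mul c).sub_const e, fun t ht x hx hR => ?_⟩
  calc m x * (c * g' t x) = c * (m x * g' t x) := by ring
    _ ≤ c * ∑ y ∈ K, a x y * (g t y - g t x) := mul_le_mul_of_nonneg_left (h.le t ht x hx hR) hc
    _ = _ := by rw [Finset.mul_sum]; exact Finset.sum_congr rfl fun y _ => by ring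

set_option maxHeartbeats 2000000 in
/-- Growth of positivity: a solution with values in `[exp (-Λ), 1]` which is at least `1 / 2` on
half of the mass at the initial time is at least `exp (-7 Λ / 8)` on the smaller cylinder. -/
theorem exists_growth_of_positivity (hd : 2 ≤ d) (hp : 1 < p) (hq : 1 < q) (hr : 1 < r)
    (hM : 1 ≤ M) (hpqr : 1 / r + 1 / p * (1 - 1 / r) + 1 / q < 2 / d) :
    ∃ Λ : ℝ, 0 < Λ ∧ ∀ (ω : Sym2 (Fin d → ℤ) → ℝ) (θ : (Fin d → ℤ) → ℝ) (x₀ : Fin d → ℤ)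
      (n t₀ : ℝ), 8 ≤ n → HasMomentBounds ω θ x₀ n p q r M → ∀ v v' : ℝ → (Fin d → ℤ) → ℝ,
      IsSolutionOn (latticeBall x₀ n) (latticeKernel fun e => ω e / (latticeBall x₀ n).card)
        (fun x => θ x / (latticeBall x₀ n).card) (fun x => (latticeGraph d).dist x₀ x)
        (7 * n / 8) (Set.Icc (t₀ - n ^ 2 / 8) t₀) v v' →
      (∀ t ∈ Set.Icc (t₀ - n ^ 2 / 8) t₀, ∀ x ∈ latticeBall x₀ n,
        Real.exp (-Λ) ≤ v t x ∧ v t x ≤ 1) →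
      (∑ x ∈ latticeBall x₀ n,
        linearCutoff (n / 4) (3 * n / 8) ((latticeGraph d).dist x₀ x) ^ 2 *
          (θ x / (latticeBall x₀ n).card)) / 2 ≤
        ∑ x ∈ latticeBall x₀ n with 1 / 2 ≤ v (t₀ - n ^ 2 / 8) x,
          linearCutoff (n / 4) (3 * n / 8) ((latticeGraph d).dist x₀ x) ^ 2 *
            (θ x / (latticeBall x₀ n).card) →
      ∀ t ∈ Set.Icc (t₀ - n ^ 2 / 16) t₀, ∀ x ∈ latticeBall x₀ (n / 4),
        Real.exp (-(7 / 8 * Λ)) ≤ v t x := by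
  have hd2 : (2 : ℝ) ≤ d := by exact_mod_cast hd
  have hd0 : (0 : ℝ) < d := by linarith
  have hp0 : 0 < p := by linarith
  have hq0 : 0 < q := by linarith
  have hr0 : 0 < r := by linarith
  have hp1 : 1 / p < 1 := by rw [div_lt_one hp0]; exact hp
  have hr1 : 1 / r < 1 := by rw [div_lt_one hr0]; exact hr
  have hp2 : 0 < 1 - 1 / p := by linarith
  set L : ℝ := 1 - 2 / d + 1 / q with hL
  have hL0 : 0 < L := by
    have : 2 / (d : ℝ) ≤ 1 := by rw [div_le_one hd0]; exact hd2
    have : 0 < 1 / q := by positivity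
    rw [hL]; linarith
  set s : ℝ := (1 - 1 / r) / L with hs
  set P : ℝ := 1 / (1 - 1 / p) with hPdef
  have hP : 1 ≤ P := by
    rw [hPdef, one_le_div hp2]
    linarith [one_div_pos.2 hp0]
  -- Clearing denominators, P < s reads L < (1 - 1/p)(1 - 1/r), which is the condition on p, q, r
  -- rearranged.
  have hPs : P < s := by
    rw [hPdef, hs, div_lt_div_iff₀ hp2 hL0, hL]
    linarith
  set M₂ : ℝ := M + 36 * (2 / L) ^ 2 * M ^ (1 / r / s + 1 / q) with hM₂
  have hM₂1 : 1 ≤ M₂ := by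
    have : 0 ≤ 36 * (2 / L) ^ 2 * M ^ (1 / r / s + 1 / q) := by positivity
    linarith
  obtain ⟨δ, hδ, hmax⟩ := exists_local_max_threshold hP hPs hM₂1
  set S₀ : ℝ := 1 / (((12 * d) ^ d) ^ 2 * M) with hS₀
  have hS₀0 : 0 < S₀ := by positivity
  obtain ⟨D, hD0, hexc⟩ := exists_excessNorm_le (d := d) (q := q) (r := r) (M := M) (p := p)
    hd hq hr hM hP (show 0 < S₀ / 6 by positivity) hδ
  -- The first two summands serve persistence: Λ ≥ 16 and growth 8M₂²/Λ ≤ S/16. The third gives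
  -- 16D·36M₂²/Λ ≤ δ/2, where 16 = 4² comes from scaling g by 4 and 1152 = 2·16·36.
  set Λ : ℝ := 16 + 128 * M₂ ^ 2 / S₀ + 1152 * D * M₂ ^ 2 / δ with hΛdef
  have hΛ16 : 16 ≤ Λ := by
    have : 0 ≤ 128 * M₂ ^ 2 / S₀ := by positivity
    have : 0 ≤ 1152 * D * M₂ ^ 2 / δ := by positivity
    linarith
  have hΛS : 128 * M₂ ^ 2 ≤ Λ * S₀ := by
    rw [← div_le_iff₀ hS₀0]
    have : 0 ≤ 1152 * D * M₂ ^ 2 / δ := by positivity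
    linarith
  have hΛδ : 1152 * D * M₂ ^ 2 ≤ Λ * δ := by
    rw [← div_le_iff₀ hδ]
    have : 0 ≤ 128 * M₂ ^ 2 / S₀ := by positivity
    linarith
  clear_value Λ
  have hΛ0 : 0 < Λ := by linarith
  refine ⟨Λ, hΛ0, ?_⟩
  intro ω θ x₀ n t₀ hn h v v' hsol hv hinit
  have hn0 : 0 < n := by linarith
  have hn2 : 0 < n ^ 2 := by positivity
  have hK := h.isDeGiorgiKernel hd hn hp hq hr hL hs
  set K := latticeBall x₀ n with hKdef
  set N : ℝ := (K.card : ℝ) with hN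
  have hN0 : 0 < N := card_latticeBall_pos x₀ (by linarith)
  set a := latticeKernel fun e => ω e / N with ha
  set m : (Fin d → ℤ) → ℝ := fun x => θ x / N with hm
  set ρ : (Fin d → ℤ) → ℝ := fun x => (latticeGraph d).dist x₀ x with hρ
  set t₁ := t₀ - n ^ 2 / 8 with ht₁
  set S := ∑ x ∈ K, linearCutoff (n / 4) (3 * n / 8) (ρ x) ^ 2 * m x with hS
  have hSS₀ : S₀ ≤ S := h.le_sum_cutoff (by omega) (by linarith)
  have hvpos : ∀ t ∈ Set.Icc t₁ t₀, ∀ x ∈ K, 0 < v t x := fun t ht x hx =>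
    (Real.exp_pos _).trans_le (hv t ht x hx).1
  have htime : t₀ ≤ t₁ + n ^ 2 / 8 := by rw [ht₁]; linarith
  have ht₁₀ : t₁ ≤ t₀ := by rw [ht₁]; linarith
  set g : ℝ → (Fin d → ℤ) → ℝ := fun t x => -Real.log (v t x) / Λ with hg
  have hg0 : ∀ t ∈ Set.Icc t₁ t₀, ∀ x ∈ K, 0 ≤ g t x := fun t ht x hx =>
    div_nonneg (neg_nonneg.2 (Real.log_nonpos (hvpos t ht x hx).le (hv t ht x hx).2)) hΛ0.le
  have hg1 : ∀ t ∈ Set.Icc t₁ t₀, ∀ x ∈ K, g t x ≤ 1 := fun t ht x hx => by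
    rw [hg]
    dsimp only
    rw [div_le_one hΛ0, neg_le]
    exact (Real.le_log_iff_exp_le (hvpos t ht x hx)).2 (hv t ht x hx).1
  have hpersist : ∀ t ∈ Set.Icc t₁ t₀, S₀ / 6 * N ≤
      ∑ x ∈ latticeBall x₀ (3 * n / 8) with 4 * g t x - 3 ≤ 0, θ x := by
    intro t ht
    have h1 := (hsol.mono_radius (R' := 3 * n / 8) (by linarith)).persistence hK hP hn0 hΛ16 hv
      htime ht hS hinit (by
        rw [div_le_iff₀ hΛ0]
        have := mul_le_mul_of_nonneg_left hSS₀ hΛ0.le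
        linarith)
    have h2 : ∑ x ∈ K with -Real.log (v t x) / Λ ≤ 3 / 4,
        linearCutoff (n / 4) (3 * n / 8) (ρ x) ^ 2 * m x ≤
        (∑ x ∈ latticeBall x₀ (3 * n / 8) with 4 * g t x - 3 ≤ 0, θ x) / N := by
      rw [Finset.sum_div, ← filter_dist_le_eq_latticeBall x₀ (show 3 * n / 8 ≤ n by linarith),
        Finset.filter_filter, Finset.sum_filter, Finset.sum_filter]
      refine Finset.sum_le_sum fun x hx => ?_
      have hmx : 0 ≤ m x := (hK.m_pos x).le
      by_cases hx1 : -Real.log (v t x) / Λ ≤ 3 / 4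
      · rw [if_pos hx1]
        by_cases hx2 : ρ x ≤ 3 * n / 8
        · rw [if_pos ⟨hx2, by simp only [hg]; linarith⟩]
          exact mul_le_of_le_one_left hmx
            (pow_le_one₀ (linearCutoff_nonneg _ _ _) (linearCutoff_le_one _ _ _))
        · rw [if_neg fun h => hx2 h.1, linearCutoff_eq_zero (by linarith) (not_le.1 hx2).le]
          simp
      · rw [if_neg hx1]
        split_ifs
        · exact hmx
        · exact le_rfl
    have h3 := h1.trans h2
    rw [le_div_iff₀ hN0] at h3
    exact (mul_le_mul_of_nonneg_right (by linarith) hN0.le).trans h3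
  set E : ℝ → ℝ := fun τ => dirichletForm (latticeBall x₀ (3 * n / 4)) a (g τ) with hE
  have hgc : ∀ x ∈ K, ContinuousOn (fun t => g t x) (Set.Icc t₁ t₀) := fun x hx =>
    hsol.continuousOn_log hvpos hx
  have hEc : ContinuousOn E (Set.Icc t₁ t₀) := by
    have hsub : latticeBall x₀ (3 * n / 4) ⊆ K := latticeBall_mono x₀ (by linarith)
    exact continuousOn_finsetSum _ fun x hx => continuousOn_finsetSum _ fun y hy =>
      continuousOn_const.mul (((hgc x (hsub hx)).sub (hgc y (hsub hy))).pow 2)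
  -- The cutoff now falls between 3n/4 and 7n/8, because the Poincaré inequality needs the energy on
  -- twice the radius 3n/8. As 0 ≤ g ≤ 1, the energy estimate gives (Λ/4) ∫ E ≤ M₂ + 8M₂² ≤ 9M₂².
  have hEint : ∫ τ in t₁..t₀, E τ ≤ 36 * M₂ ^ 2 / Λ := by
    have h1 := hsol.log_energy_le hK hP hn0 hΛ0 hvpos (R' := 3 * n / 4) (by ring) htime
      ⟨ht₁₀, le_rfl⟩
    rw [filter_dist_le_eq_latticeBall x₀ (by linarith)] at h1
    have hη0 : ∀ x, 0 ≤ linearCutoff (3 * n / 4) (7 * n / 8) (ρ x) ^ 2 * m x := fun x =>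
      mul_nonneg (sq_nonneg _) (hK.m_pos x).le
    have h2 : 0 ≤ ∑ x ∈ K, linearCutoff (3 * n / 4) (7 * n / 8) (ρ x) ^ 2 * m x * g t₀ x :=
      Finset.sum_nonneg fun x hx => mul_nonneg (hη0 x) (hg0 t₀ ⟨ht₁₀, le_rfl⟩ x hx)
    have h3 : ∑ x ∈ K, linearCutoff (3 * n / 4) (7 * n / 8) (ρ x) ^ 2 * m x * g t₁ x ≤ M₂ := by
      refine (Finset.sum_le_sum fun x hx => ?_).trans hK.mass
      refine (mul_le_of_le_one_right (hη0 x) (hg1 t₁ ⟨le_rfl, ht₁₀⟩ x hx)).trans ?_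
      exact mul_le_of_le_one_left (hK.m_pos x).le
        (pow_le_one₀ (linearCutoff_nonneg _ _ _) (linearCutoff_le_one _ _ _))
    have h4 : 8 * M₂ ^ 2 / Λ ≤ 8 * M₂ ^ 2 := div_le_self (by positivity) (by linarith)
    have h5 : M₂ ≤ M₂ ^ 2 := by nlinarith
    have h6 : Λ / 4 * ∫ τ in t₁..t₀, E τ ≤ 9 * M₂ ^ 2 := by linarith
    rw [le_div_iff₀ hΛ0]
    linarith
  -- The map g ↦ 4g - 3 fixes 1 and sends 3/4 to 0, so the set from persistence becomes the zero set
  -- of the positive part; the conclusion 4g - 3 ≤ 1/2 means g ≤ 7/8.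
  have hsub : IsSubsolutionOn K a m ρ (3 * n / 8) (Set.Icc t₁ t₀) (fun t x => 4 * g t x - 3)
      (fun t x => 4 * (-(v' t x / v t x) / Λ)) :=
    ((hsol.mono_radius (by linarith)).isSubsolutionOn_log hK.nonneg hΛ0 hvpos).affine
      (by norm_num) 3
  have hsmall : ∫ t in t₁..t₀, excessNorm K m ρ P (3 * n / 8) 0 (fun x => 4 * g t x - 3) ≤
      δ * n ^ 2 := by
    calc ∫ t in t₁..t₀, excessNorm K m ρ P (3 * n / 8) 0 (fun x => 4 * g t x - 3)
        ≤ ∫ t in t₁..t₀, (δ + 16 * D * n ^ 2 * E t) := by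
          refine intervalIntegral.integral_mono_on ht₁₀ ?_ ?_ fun t ht => ?_
          · refine ContinuousOn.intervalIntegrable ?_
            rw [Set.uIcc_of_le ht₁₀]
            exact continuousOn_excessNorm hP hsub.cont _ _
          · refine ContinuousOn.intervalIntegrable ?_
            rw [Set.uIcc_of_le ht₁₀]
            exact continuousOn_const.add (continuousOn_const.mul hEc)
          · refine (hexc ω θ x₀ n hn h (fun x => 4 * g t x - 3)
              (fun x hx => by linarith [hg1 t ht x hx]) (hpersist t ht)).trans_eq ?_
            rw [dirichletForm_affine]
            simp only [hE]
            ring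
      _ = n ^ 2 / 8 * δ + 16 * D * n ^ 2 * ∫ t in t₁..t₀, E t := by
          rw [intervalIntegral.integral_add intervalIntegrable_const,
            intervalIntegral.integral_const, intervalIntegral.integral_const_mul, smul_eq_mul]
          · congr 2
            rw [ht₁]; ring
          · refine ContinuousOn.intervalIntegrable ?_
            rw [Set.uIcc_of_le ht₁₀]
            exact continuousOn_const.mul hEc
      _ ≤ n ^ 2 / 8 * δ + 16 * D * n ^ 2 * (36 * M₂ ^ 2 / Λ) := by gcongr
      _ = n ^ 2 * (δ / 8 + 1152 * D * M₂ ^ 2 / Λ / 2) := by ring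
      _ ≤ n ^ 2 * (δ / 8 + δ / 2) := by
          have : 1152 * D * M₂ ^ 2 / Λ ≤ δ := by rw [div_le_iff₀ hΛ0]; linarith
          gcongr
      _ ≤ δ * n ^ 2 := by nlinarith
  intro t ht x hx
  have hxK : x ∈ K := latticeBall_mono x₀ (by linarith) hx
  have htI : t ∈ Set.Icc t₁ t₀ := ⟨by rw [ht₁]; linarith [ht.1], ht.2⟩
  have hfin := hmax _ K a m ρ n t₀ hn0 hK _ _ hsub
    (fun t ht x hx => by linarith [hg1 t ht x hx]) hsmall t ht x hxK (mem_latticeBall.1 hx)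
  have h1 : -Real.log (v t x) / Λ ≤ 7 / 8 := by
    have : 4 * g t x - 3 ≤ 1 / 2 := hfin
    simp only [hg] at this
    linarith
  rw [div_le_iff₀ hΛ0] at h1
  rw [← Real.le_log_iff_exp_le (hvpos t htI x hxK)]
  linarith

end

/-! ### Averaged norms and reduction to finite exponents -/

theorem avgNorm_eq_avgNormW {V : Type*} (p : ℝ≥0∞) (B : Finset V) (f : V → ℝ) :
    avgNorm p B f = avgNormW p B (fun _ => 1) f := by
  simp [avgNorm, avgNormW]

section
variable {V : Type*} {p : ℝ≥0∞} {B : Finset V} {φ f : V → ℝ}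

theorem avgNormW_nonneg (hφ : ∀ x, 0 < φ x) : 0 ≤ avgNormW p B φ f := by
  rw [avgNormW]
  split_ifs
  · exact Real.iSup_nonneg fun x => abs_nonneg _
  · exact Real.rpow_nonneg (mul_nonneg (one_div_nonneg.2 (Finset.sum_nonneg fun x _ => (hφ x).le))
      (Finset.sum_nonneg fun x _ => mul_nonneg (Real.rpow_nonneg (abs_nonneg _) _) (hφ x).le)) _

theorem avgNorm_nonneg : 0 ≤ avgNorm p B f := by
  rw [avgNorm_eq_avgNormW]; exact avgNormW_nonneg fun _ => one_pos

theorem one_le_avgNormW (hB : B.Nonempty) (hφ : ∀ x, 0 < φ x) (hf : ∀ x, 1 ≤ f x) :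
    1 ≤ avgNormW p B φ f := by
  have hf' : ∀ x, 1 ≤ |f x| := fun x => (hf x).trans (le_abs_self _)
  rw [avgNormW]
  split_ifs
  · obtain ⟨x, hx⟩ := hB
    exact (hf' x).trans (le_ciSup (f := fun x : B => |f x|) (Set.finite_range _).bddAbove ⟨x, hx⟩)
  · have hΦ : 0 < ∑ x ∈ B, φ x := Finset.sum_pos (fun x _ => hφ x) hB
    refine Real.one_le_rpow ?_ (by positivity)
    rw [one_div, ← div_eq_inv_mul, one_le_div hΦ]
    exact Finset.sum_le_sum fun x _ => le_mul_of_one_le_left (hφ x).le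
      (Real.one_le_rpow (hf' x) ENNReal.toReal_nonneg)

/-- For p = ∞ any finite p' is admissible, since the maximum dominates every averaged norm. -/
theorem sum_rpow_le_of_avgNormW_le {M p' : ℝ} (hB : B.Nonempty) (hφ : ∀ x, 0 < φ x)
    (hp' : 0 < p') (hp : p = ∞ ∨ p' = p.toReal) (hM : avgNormW p B φ f ≤ M) :
    ∑ x ∈ B, |f x| ^ p' * φ x ≤ (∑ x ∈ B, φ x) * M ^ p' := by
  have hΦ : 0 < ∑ x ∈ B, φ x := Finset.sum_pos (fun x _ => hφ x) hB
  rw [avgNormW] at hM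
  split_ifs at hM with h
  · rw [Finset.sum_mul]
    refine Finset.sum_le_sum fun x hx => ?_
    rw [mul_comm]
    refine mul_le_mul_of_nonneg_left (Real.rpow_le_rpow (abs_nonneg _) ?_ hp'.le) (hφ x).le
    exact (le_ciSup (f := fun x : B => |f x|) (Set.finite_range _).bddAbove ⟨x, hx⟩).trans hM
  · have hpp : p' = p.toReal := hp.resolve_left h
    rw [← hpp] at hM
    have hS : 0 ≤ ∑ x ∈ B, |f x| ^ p' * φ x := Finset.sum_nonneg fun x _ =>
      mul_nonneg (Real.rpow_nonneg (abs_nonneg _) _) (hφ x).le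
    have hbase : 0 ≤ 1 / (∑ x ∈ B, φ x) * ∑ x ∈ B, |f x| ^ p' * φ x := by positivity
    have h1 := Real.rpow_le_rpow (Real.rpow_nonneg hbase _) hM hp'.le
    rw [← Real.rpow_mul hbase, one_div_mul_cancel hp'.ne', Real.rpow_one, one_div,
      ← div_eq_inv_mul, div_le_iff₀ hΦ, mul_comm] at h1
    exact h1

theorem sum_rpow_le_of_avgNorm_le {M p' : ℝ} (hB : B.Nonempty)
    (hp' : 0 < p') (hp : p = ∞ ∨ p' = p.toReal) (hM : avgNorm p B f ≤ M) :
    ∑ x ∈ B, |f x| ^ p' ≤ B.card * M ^ p' := by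
  rw [avgNorm_eq_avgNormW] at hM
  simpa using sum_rpow_le_of_avgNormW_le hB (fun _ => one_pos) hp' hp hM
end

/-- The iteration uses finite exponents. An infinite one is replaced by a large finite one, which
raises its reciprocal so little that a strict inequality between exponents survives. -/
theorem exists_real_exponent {p : ℝ≥0∞} (hp : 1 < p) {η : ℝ} (hη : 0 < η) :
    ∃ p' : ℝ, 1 < p' ∧ 1 / p' ≤ (p⁻¹).toReal + η ∧ (p = ∞ ∨ p' = p.toReal) := by
  by_cases h : p = ∞
  · refine ⟨max 2 (1 / η), lt_max_of_lt_left one_lt_two, ?_, Or.inl h⟩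
    have h1 : 1 / max 2 (1 / η) ≤ 1 / (1 / η) :=
      one_div_le_one_div_of_le (one_div_pos.2 hη) (le_max_right _ _)
    rw [one_div_one_div] at h1
    linarith [ENNReal.toReal_nonneg (a := p⁻¹)]
  · refine ⟨p.toReal, ?_, ?_, Or.inr rfl⟩
    · rw [← ENNReal.toReal_one]
      exact (ENNReal.toReal_lt_toReal ENNReal.one_ne_top h).2 hp
    · rw [ENNReal.toReal_inv, one_div]; linarith

/-- A bound on `A₂(n)` yields moment bounds. -/
theorem hasMomentBounds_of_coeffA2_le {d : ℕ} {ω : Sym2 (Fin d → ℤ) → ℝ} {θ : (Fin d → ℤ) → ℝ}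
    {x₀ : Fin d → ℤ} {n M p' q' r' : ℝ} {p q r : ℝ≥0∞}
    (hω : ∀ e ∈ (latticeGraph d).edgeSet, 0 < ω e) (hθ : ∀ x, 0 < θ x) (hn : 0 ≤ n) (hM : 1 ≤ M)
    (hp' : 1 < p') (hq' : 1 < q') (hr' : 1 < r') (hp : p = ∞ ∨ p' = p.toReal)
    (hq : q = ∞ ∨ q' = q.toReal) (hr : r = ∞ ∨ r' = r.toReal)
    (hA : coeffA2 p q r ω θ x₀ n ≤ M) :
    HasMomentBounds ω θ x₀ n p' q' r' (M ^ (p' + q' + r' + 1)) := by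
  have hM0 : 0 < M := by linarith
  set K := latticeBall x₀ n with hK
  have hKne : K.Nonempty := ⟨x₀, mem_latticeBall_self x₀ hn⟩
  rw [coeffA2] at hA
  set A := avgNormW p K θ (fun x => max 1 (condMu ω x / θ x)) with hAdef
  set B := avgNorm q K (fun x => max 1 (condNu ω x)) with hB
  set C := avgNorm r K (fun x => max 1 (θ x)) with hC
  set D := avgNorm 1 K (fun x => max 1 (1 / θ x)) with hD
  have hA1 : 1 ≤ A := one_le_avgNormW hKne hθ fun x => le_max_left _ _
  have hB1 : 1 ≤ B := by
    rw [hB, avgNorm_eq_avgNormW]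
    exact one_le_avgNormW hKne (fun _ => one_pos) fun x => le_max_left _ _
  have hC1 : 1 ≤ C := by
    rw [hC, avgNorm_eq_avgNormW]
    exact one_le_avgNormW hKne (fun _ => one_pos) fun x => le_max_left _ _
  have hD1 : 1 ≤ D := by
    rw [hD, avgNorm_eq_avgNormW]
    exact one_le_avgNormW hKne (fun _ => one_pos) fun x => le_max_left _ _
  -- The maxima with 1 in A₂ make every factor at least 1, so a bound on the product bounds each
  -- factor.
  have hC2 : 1 ≤ C ^ 2 := one_le_pow₀ hC1
  have hAB : 1 ≤ A * B := one_le_mul_of_one_le_of_one_le hA1 hB1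
  have hABC : 1 ≤ A * B * C ^ 2 := one_le_mul_of_one_le_of_one_le hAB hC2
  have hABCM : A * B * C ^ 2 ≤ M := (le_mul_of_one_le_right (by linarith) hD1).trans hA
  have hABM : A * B ≤ M := (le_mul_of_one_le_right (by linarith) hC2).trans hABCM
  have hAM : A ≤ M := (le_mul_of_one_le_right (by linarith) hB1).trans hABM
  have hBM : B ≤ M := (le_mul_of_one_le_left (by linarith) hA1).trans hABM
  have hCM : C ≤ M := by
    have h1 : C ≤ C ^ 2 := by nlinarith
    exact h1.trans ((le_mul_of_one_le_left (by linarith) hAB).trans hABCM)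
  have hDM : D ≤ M := (le_mul_of_one_le_left (by linarith) hABC).trans hA
  have hmono : ∀ {e : ℝ}, e ≤ p' + q' + r' + 1 → M ^ e ≤ M ^ (p' + q' + r' + 1) :=
    fun he => Real.rpow_le_rpow_of_exponent_le hM he
  have hbound : ∀ {e : ℝ} {f : (Fin d → ℤ) → ℝ} {s : ℝ≥0∞}, 0 < e → (s = ∞ ∨ e = s.toReal) →
      (∀ x, 0 ≤ f x) → avgNorm s K (fun x => max 1 (f x)) ≤ M →
      ∑ x ∈ K, f x ^ e ≤ K.card * M ^ e := by
    intro e f s he hs hf hs'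
    refine le_trans (Finset.sum_le_sum fun x _ => ?_) (sum_rpow_le_of_avgNorm_le hKne he hs hs')
    exact Real.rpow_le_rpow (hf x) ((le_max_right _ _).trans (le_abs_self _)) he.le
  have hθr : ∑ x ∈ K, θ x ^ r' ≤ K.card * M ^ r' :=
    hbound (by linarith) hr (fun x => (hθ x).le) hCM
  -- The norm of μ/θ is normalised by θ(B), whereas the moment bound is per point; this bound on the
  -- total mass converts one into the other.
  have hθ1 : ∑ x ∈ K, θ x ≤ K.card * M ^ r' :=
    sum_le_of_sum_rpow_le K (fun x _ => (hθ x).le) le_rfl hr'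
      (Real.one_le_rpow hM (by linarith)) hθr
  refine ⟨hω, hθ, Real.one_le_rpow hM (by linarith), ?_, ?_, ?_, ?_⟩
  · have h1 := sum_rpow_le_of_avgNormW_le hKne hθ (by linarith) hp hAM
    calc ∑ x ∈ K, (condMu ω x / θ x) ^ p' * θ x
        ≤ ∑ x ∈ K, |max 1 (condMu ω x / θ x)| ^ p' * θ x := by
          refine Finset.sum_le_sum fun x _ => mul_le_mul_of_nonneg_right ?_ (hθ x).le
          exact Real.rpow_le_rpow (div_nonneg (condMu_nonneg hω x) (hθ x).le)
            ((le_max_right _ _).trans (le_abs_self _)) (by linarith)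
      _ ≤ (∑ x ∈ K, θ x) * M ^ p' := h1
      _ ≤ K.card * M ^ r' * M ^ p' := by gcongr
      _ = K.card * M ^ (r' + p') := by rw [mul_assoc, ← Real.rpow_add hM0]
      _ ≤ _ := mul_le_mul_of_nonneg_left (hmono (by linarith)) (Nat.cast_nonneg _)
  · exact (hbound (by linarith) hq (condNu_nonneg hω) hBM).trans
      (mul_le_mul_of_nonneg_left (hmono (by linarith)) (Nat.cast_nonneg _))
  · exact hθr.trans (mul_le_mul_of_nonneg_left (hmono (by linarith)) (Nat.cast_nonneg _))
  · have h1 := hbound (e := 1) one_pos (Or.inr (by simp))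
      (fun x => (one_div_pos.2 (hθ x)).le) hDM
    simp only [Real.rpow_one] at h1
    refine h1.trans (mul_le_mul_of_nonneg_left ?_ (Nat.cast_nonneg _))
    exact (Real.rpow_one M).symm.le.trans (hmono (by linarith))

/-! ### Contraction of the oscillation -/

theorem IsCaloricOnCylinder.continuousOn {d : ℕ} {ω : Sym2 (Fin d → ℤ) → ℝ}
    {θ : (Fin d → ℤ) → ℝ} {t₀ n : ℝ} {x₀ : Fin d → ℤ} {u : ℝ → (Fin d → ℤ) → ℝ}
    (hu : IsCaloricOnCylinder ω θ t₀ x₀ n u) {x : Fin d → ℤ} (hx : x ∈ latticeBall x₀ n) :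
    ContinuousOn (fun t => u t x) (Set.Icc (t₀ - n ^ 2) t₀) :=
  fun t ht => (hu t x ⟨ht, hx⟩).continuousWithinAt

/-- Affine images of a caloric function are solutions for the normalised kernel. -/
theorem IsCaloricOnCylinder.isSolutionOn {d : ℕ} {ω : Sym2 (Fin d → ℤ) → ℝ}
    {θ : (Fin d → ℤ) → ℝ} {t₀ n : ℝ} {x₀ : Fin d → ℤ} {u : ℝ → (Fin d → ℤ) → ℝ}
    (hu : IsCaloricOnCylinder ω θ t₀ x₀ n u) (hθ : ∀ x, 0 < θ x) (hn : 8 ≤ n) (α β : ℝ) :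
    IsSolutionOn (latticeBall x₀ n) (latticeKernel fun e => ω e / (latticeBall x₀ n).card)
        (fun x => θ x / (latticeBall x₀ n).card) (fun x => (latticeGraph d).dist x₀ x)
        (7 * n / 8) (Set.Icc (t₀ - n ^ 2 / 8) t₀) (fun t x => α * u t x + β)
        (fun t x => α * generator ω θ (u t) x) := by
  have hsub : Set.Icc (t₀ - n ^ 2 / 8) t₀ ⊆ Set.Icc (t₀ - n ^ 2) t₀ :=
    Set.Icc_subset_Icc (by nlinarith [sq_nonneg n]) le_rfl
  refine ⟨fun x hx => (continuousOn_const.mul ((hu.continuousOn hx).mono hsub)).add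
    continuousOn_const, fun t ht x hx _ => (((hu t x ⟨hsub ht, hx⟩).mono hsub).const_mul α).add_const
      β, fun t _ x hx hρ => ?_⟩
  have hx' : x ∈ latticeBall x₀ (7 * n / 8) := mem_latticeBall.2 hρ
  -- The requirement n ≥ 8 enters here: 7n/8 + 1 ≤ n keeps all neighbours in the ball, so the kernel
  -- sum is the full generator.
  rw [sum_latticeKernel_mul_eq _ x fun y hy =>
    mem_latticeBall_of_adj hx' (by simpa using hy) (by linarith), generator]
  have := (hθ x).ne'
  simp only [Finset.mul_sum]
  refine Finset.sum_congr rfl fun y _ => ?_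
  field_simp
  ring

theorem oscOn_le {V : Type*} {Q : Set (ℝ × V)} {u : ℝ → V → ℝ} {A B : ℝ} (hQ : Q.Nonempty)
    (h : ∀ z ∈ Q, A ≤ u z.1 z.2 ∧ u z.1 z.2 ≤ B) : oscOn Q u ≤ B - A := by
  refine sub_le_sub (csSup_le (hQ.image _) ?_) (le_csInf (hQ.image _) ?_)
  · rintro _ ⟨z, hz, rfl⟩; exact (h z hz).2
  · rintro _ ⟨z, hz, rfl⟩; exact (h z hz).1

theorem IsCaloricOnCylinder.isBounded {d : ℕ} {ω : Sym2 (Fin d → ℤ) → ℝ}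
    {θ : (Fin d → ℤ) → ℝ} {t₀ n : ℝ} {x₀ : Fin d → ℤ} {u : ℝ → (Fin d → ℤ) → ℝ}
    (hu : IsCaloricOnCylinder ω θ t₀ x₀ n u) :
    BddAbove ((fun z : ℝ × (Fin d → ℤ) => u z.1 z.2) '' cylinder t₀ x₀ n) ∧
      BddBelow ((fun z : ℝ × (Fin d → ℤ) => u z.1 z.2) '' cylinder t₀ x₀ n) := by
  have hsub : (fun z : ℝ × (Fin d → ℤ) => u z.1 z.2) '' cylinder t₀ x₀ n ⊆
      ⋃ x ∈ (latticeBall x₀ n : Set (Fin d → ℤ)),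
        (fun t => u t x) '' Set.Icc (t₀ - n ^ 2) t₀ := by
    rintro _ ⟨⟨t, x⟩, ⟨ht, hx⟩, rfl⟩
    exact Set.mem_biUnion hx ⟨t, ht, rfl⟩
  have hcomp : IsCompact (⋃ x ∈ (latticeBall x₀ n : Set (Fin d → ℤ)),
      (fun t => u t x) '' Set.Icc (t₀ - n ^ 2) t₀) :=
    (latticeBall x₀ n).finite_toSet.isCompact_biUnion fun x hx =>
      isCompact_Icc.image_of_continuousOn (hu.continuousOn hx)
  exact ⟨hcomp.bddAbove.mono hsub, hcomp.bddBelow.mono hsub⟩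

set_option maxHeartbeats 2000000 in
/-- The oscillation inequality with a constant which depends on a bound for `A₂(n)`. -/
theorem exists_oscillation_contraction {d : ℕ} (hd : 2 ≤ d) {p q r : ℝ≥0∞} (hp : 1 < p)
    (hq : 1 < q) (hr : 1 < r)
    (hpqr : (r⁻¹).toReal + (p⁻¹).toReal * (1 - (r⁻¹).toReal) + (q⁻¹).toReal < 2 / (d : ℝ))
    {M : ℝ} (hM : 1 ≤ M) :
    ∃ c : ℝ, 0 < c ∧ c ≤ 1 ∧ ∀ ω : Sym2 (Fin d → ℤ) → ℝ,
      (∀ e ∈ (latticeGraph d).edgeSet, 0 < ω e) → ∀ θ : (Fin d → ℤ) → ℝ, (∀ x, 0 < θ x) →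
      ∀ (t₀ : ℝ) (x₀ : Fin d → ℤ) (n : ℝ), 8 ≤ n → ∀ u : ℝ → (Fin d → ℤ) → ℝ,
      IsCaloricOnCylinder ω θ t₀ x₀ n u → coeffA2 p q r ω θ x₀ n ≤ M →
      oscOn (cylinder t₀ x₀ (n / 4)) u ≤ (1 - c) * oscOn (cylinder t₀ x₀ n) u := by
  -- Each of the three reciprocals may grow by η, which raises the left side of the condition by at
  -- most 3η; a quarter of the gap keeps the inequality strict.
  set η : ℝ := (2 / (d : ℝ) -
    ((r⁻¹).toReal + (p⁻¹).toReal * (1 - (r⁻¹).toReal) + (q⁻¹).toReal)) / 4 with hη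
  have hη0 : 0 < η := by rw [hη]; linarith
  obtain ⟨p', hp', hpη, hpp⟩ := exists_real_exponent hp hη0
  obtain ⟨q', hq', hqη, hqq⟩ := exists_real_exponent hq hη0
  obtain ⟨r', hr', hrη, hrr⟩ := exists_real_exponent hr hη0
  have hinv1 : ∀ {s : ℝ≥0∞}, 1 < s → (s⁻¹).toReal ≤ 1 := fun hs => by
    rw [← ENNReal.toReal_one]
    exact ENNReal.toReal_mono ENNReal.one_ne_top (ENNReal.inv_le_one.2 hs.le)
  have hcond : 1 / r' + 1 / p' * (1 - 1 / r') + 1 / q' < 2 / d := by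
    have hp0 : 1 / p' < 1 := by rw [div_lt_one (by linarith)]; exact hp'
    have h1 := mul_nonneg (sub_nonneg.2 hrη) (sub_nonneg.2 hp0.le)
    have h2 := mul_nonneg (sub_nonneg.2 hpη) (sub_nonneg.2 (hinv1 hr))
    have h3 := mul_nonneg hη0.le (sub_nonneg.2 hp0.le)
    have h4 : 0 ≤ 1 / p' := by positivity
    have h5 : 0 ≤ (r⁻¹).toReal := ENNReal.toReal_nonneg
    have h6 := mul_nonneg hη0.le h4
    have h7 := mul_nonneg hη0.le h5
    nlinarith
  have hM3 : 1 ≤ M ^ (p' + q' + r' + 1) := Real.one_le_rpow hM (by linarith)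
  obtain ⟨Λ, hΛ0, hgrow⟩ := exists_growth_of_positivity hd hp' hq' hr' hM3 hcond
  set ε : ℝ := Real.exp (-Λ) with hε
  set ε' : ℝ := Real.exp (-(7 / 8 * Λ)) with hε'
  have hε0 : 0 < ε := Real.exp_pos _
  have hεε' : ε < ε' := Real.exp_lt_exp.2 (by linarith)
  have hε'1 : ε' < 1 := Real.exp_lt_one_iff.2 (by linarith)
  refine ⟨ε' - ε, by linarith, by linarith, ?_⟩
  intro ω hω θ hθ t₀ x₀ n hn u hu hA
  have hmom := hasMomentBounds_of_coeffA2_le hω hθ (by linarith) hM hp' hq' hr' hpp hqq hrr hA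
  set I := (fun z : ℝ × (Fin d → ℤ) => u z.1 z.2) '' cylinder t₀ x₀ n with hI
  obtain ⟨hba, hbb⟩ := hu.isBounded
  set lo := sInf I with hlo
  set hi := sSup I with hhi
  have hosc : oscOn (cylinder t₀ x₀ n) u = hi - lo := rfl
  have hbd : ∀ t ∈ Set.Icc (t₀ - n ^ 2) t₀, ∀ x ∈ latticeBall x₀ n, lo ≤ u t x ∧ u t x ≤ hi :=
    fun t ht x hx => ⟨csInf_le hbb ⟨(t, x), ⟨ht, hx⟩, rfl⟩, le_csSup hba ⟨(t, x), ⟨ht, hx⟩, rfl⟩⟩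
  have hsq : (n / 4) ^ 2 = n ^ 2 / 16 := by ring
  have hsub4 : ∀ z ∈ cylinder t₀ x₀ (n / 4), z.1 ∈ Set.Icc (t₀ - n ^ 2 / 16) t₀ ∧
      z.1 ∈ Set.Icc (t₀ - n ^ 2) t₀ ∧ z.2 ∈ latticeBall x₀ (n / 4) ∧ z.2 ∈ latticeBall x₀ n := by
    rintro ⟨t, x⟩ ⟨ht, hx⟩
    rw [hsq] at ht
    exact ⟨ht, ⟨by nlinarith [ht.1, sq_nonneg n], ht.2⟩, hx, latticeBall_mono x₀ (by linarith) hx⟩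
  have hne : (cylinder t₀ x₀ (n / 4)).Nonempty :=
    ⟨(t₀, x₀), ⟨⟨by nlinarith [sq_nonneg (n / 4)], le_rfl⟩, mem_latticeBall_self x₀ (by linarith)⟩⟩
  have hlohi : lo ≤ hi := by
    have := hbd t₀ ⟨by nlinarith [sq_nonneg n], le_rfl⟩ x₀ (mem_latticeBall_self x₀ (by linarith))
    exact this.1.trans this.2
  rw [hosc]
  rcases hlohi.eq_or_lt with heq | hlt
  · rw [← heq, sub_self, mul_zero]
    have := oscOn_le hne (A := lo) (B := hi) fun z hz =>
      hbd z.1 (hsub4 z hz).2.1 z.2 (hsub4 z hz).2.2.2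
    linarith
  have hD : 0 < hi - lo := sub_pos.2 hlt
  -- Both v = α(u - lo) + ε and its mirror image α(hi - u) + ε take values in [ε, 1]. A lower bound
  -- ε' on the first raises the minimum of u, one on the second lowers its maximum.
  set α : ℝ := (1 - ε) / (hi - lo) with hα
  have hα0 : 0 < α := div_pos (by linarith) hD
  have hαD : α * (hi - lo) = 1 - ε := by rw [hα]; field_simp
  have hsubI : Set.Icc (t₀ - n ^ 2 / 8) t₀ ⊆ Set.Icc (t₀ - n ^ 2) t₀ :=
    Set.Icc_subset_Icc (by nlinarith [sq_nonneg n]) le_rfl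
  set t₁ := t₀ - n ^ 2 / 8 with ht₁
  have ht₁I : t₁ ∈ Set.Icc (t₀ - n ^ 2) t₀ := hsubI ⟨le_rfl, by rw [ht₁]; nlinarith [sq_nonneg n]⟩
  set w : (Fin d → ℤ) → ℝ := fun x =>
    linearCutoff (n / 4) (3 * n / 8) ((latticeGraph d).dist x₀ x) ^ 2 *
      (θ x / (latticeBall x₀ n).card) with hw
  have hw0 : ∀ x, 0 ≤ w x := fun x =>
    mul_nonneg (sq_nonneg _) (div_nonneg (hθ x).le (Nat.cast_nonneg _))
  have hgain : ∀ y : ℝ, 0 ≤ y → ε' ≤ α * y + ε → (ε' - ε) * (hi - lo) ≤ y := by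
    intro y hy h
    have h1 : (ε' - ε) * (hi - lo) ≤ α * y * (hi - lo) :=
      mul_le_mul_of_nonneg_right (by linarith) hD.le
    have h2 : α * y * (hi - lo) = (1 - ε) * y := by rw [← hαD]; ring
    rw [h2] at h1
    nlinarith
  by_cases hcase : (∑ x ∈ latticeBall x₀ n, w x) / 2 ≤
      ∑ x ∈ latticeBall x₀ n with 1 / 2 ≤ α * u t₁ x + (ε - α * lo), w x
  · have h := hgrow ω θ x₀ n t₀ hn hmom _ _ (hu.isSolutionOn hθ hn α (ε - α * lo))
      (fun t ht x hx => by
        have hb := hbd t (hsubI ht) x hx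
        have h1 := mul_le_mul_of_nonneg_left hb.1 hα0.le
        have h2 := mul_le_mul_of_nonneg_left hb.2 hα0.le
        constructor <;> linarith) hcase
    have hfin := oscOn_le hne (A := lo + (ε' - ε) * (hi - lo)) (B := hi) fun z hz => by
      obtain ⟨hz1, hz2, hz3, hz4⟩ := hsub4 z hz
      have h1 := h z.1 hz1 z.2 hz3
      have hb := hbd z.1 hz2 z.2 hz4
      have h2 := hgain (u z.1 z.2 - lo) (by linarith) (by linarith)
      exact ⟨by linarith, hb.2⟩
    linarith
  · have hcase' : (∑ x ∈ latticeBall x₀ n, w x) / 2 ≤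
        ∑ x ∈ latticeBall x₀ n with 1 / 2 ≤ -α * u t₁ x + (ε + α * hi), w x := by
      have hsum := Finset.sum_filter_add_sum_filter_not (latticeBall x₀ n)
        (fun x => 1 / 2 ≤ α * u t₁ x + (ε - α * lo)) w
      have hle : ∑ x ∈ latticeBall x₀ n with ¬ 1 / 2 ≤ α * u t₁ x + (ε - α * lo), w x ≤
          ∑ x ∈ latticeBall x₀ n with 1 / 2 ≤ -α * u t₁ x + (ε + α * hi), w x := by
        -- The two functions add up to 1 + ε, so where the first is below 1/2 the second is above
        -- it. Hence at least one of them is at least 1/2 on half of the mass.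
        refine Finset.sum_le_sum_of_subset_of_nonneg (fun x hx => ?_) fun x _ _ => hw0 x
        rw [Finset.mem_filter] at hx ⊢
        refine ⟨hx.1, ?_⟩
        have := not_le.1 hx.2
        linarith
      rw [not_le] at hcase
      linarith
    have h := hgrow ω θ x₀ n t₀ hn hmom _ _ (hu.isSolutionOn hθ hn (-α) (ε + α * hi))
      (fun t ht x hx => by
        have hb := hbd t (hsubI ht) x hx
        have h1 := mul_le_mul_of_nonneg_left hb.1 hα0.le
        have h2 := mul_le_mul_of_nonneg_left hb.2 hα0.le
        constructor <;> linarith) hcase'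
    have hfin := oscOn_le hne (A := lo) (B := hi - (ε' - ε) * (hi - lo)) fun z hz => by
      obtain ⟨hz1, hz2, hz3, hz4⟩ := hsub4 z hz
      have h1 := h z.1 hz1 z.2 hz3
      have hb := hbd z.1 hz2 z.2 hz4
      have h2 := hgain (hi - u z.1 z.2) (by linarith) (by linarith)
      exact ⟨hb.1, by linarith⟩
    linarith

/-! ### Construction of γ and conclusion -/

/-- Every sequence of nonnegative numbers is dominated by a continuous monotone function. -/
theorem exists_continuous_monotone_ge (e : ℕ → ℝ) (he : ∀ j, 0 ≤ e j) :
    ∃ H : ℝ → ℝ, Continuous H ∧ Monotone H ∧ ∀ x, e ⌈x⌉₊ ≤ H x := by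
  -- Partial sums give a monotone step function above the sequence; averaging it over [x, x + 1]
  -- makes it continuous, keeps it monotone and does not decrease it.
  set E : ℝ → ℝ := fun x => ∑ j ∈ Finset.range (⌈x⌉₊ + 1), e j with hE
  have hmono : Monotone E := fun x y hxy =>
    Finset.sum_le_sum_of_subset_of_nonneg
      (Finset.range_mono (Nat.add_le_add_right (Nat.ceil_mono hxy) 1)) fun j _ _ => he j
  have hii : ∀ a b, IntervalIntegrable E MeasureTheory.volume a b := fun a b =>
    hmono.intervalIntegrable
  have hshift : ∀ x, ∫ t in (0 : ℝ)..1, E (x + t) = (∫ t in (0 : ℝ)..(x + 1), E t) -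
      ∫ t in (0 : ℝ)..x, E t := by
    intro x
    rw [intervalIntegral.integral_comp_add_left (fun t => E t) x, add_zero,
      intervalIntegral.integral_interval_sub_left (hii _ _) (hii _ _)]
  have hii' : ∀ x, IntervalIntegrable (fun t => E (x + t)) MeasureTheory.volume 0 1 := fun x =>
    (hmono.comp fun a b hab => add_le_add_right hab x).intervalIntegrable
  refine ⟨fun x => ∫ t in (0 : ℝ)..1, E (x + t), ?_, fun x y hxy => ?_, fun x => ?_⟩
  · simp only [hshift]
    have hc := intervalIntegral.continuous_primitive hii 0
    exact (hc.comp (continuous_id.add continuous_const)).sub hc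
  · exact intervalIntegral.integral_mono_on zero_le_one (hii' x) (hii' y)
      fun t _ => hmono (by linarith)
  · have h1 : e ⌈x⌉₊ ≤ E x := Finset.single_le_sum (fun j _ => he j) (by simp)
    have h2 : ∫ _t in (0 : ℝ)..1, E x ≤ ∫ t in (0 : ℝ)..1, E (x + t) :=
      intervalIntegral.integral_mono_on zero_le_one intervalIntegrable_const (hii' x)
        fun t ht => hmono (by linarith [ht.1])
    rw [intervalIntegral.integral_const] at h2
    simp only [sub_zero, one_smul] at h2
    exact h1.trans h2

theorem theorem2 (d : ℕ) (hd : 2 ≤ d) :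
    ∃ N₃ : ℕ, ∀ p q r : ℝ≥0∞, 1 < p → 1 < q → 1 < r →
      (r⁻¹).toReal + (p⁻¹).toReal * (1 - (r⁻¹).toReal) + (q⁻¹).toReal < 2 / (d : ℝ) →
      ∃ γ : (Fin 6 → ℝ) → ℝ,
        ContinuousOn γ {a | ∀ i, 0 < a i} ∧
        StrictMonoOn γ {a | ∀ i, 0 < a i} ∧
        (∀ a : Fin 6 → ℝ, (∀ i, 0 < a i) → γ a ∈ Set.Ioo (0 : ℝ) 1) ∧
        ∀ ω : Sym2 (Fin d → ℤ) → ℝ, (∀ e ∈ (latticeGraph d).edgeSet, 0 < ω e) →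
        ∀ θ : (Fin d → ℤ) → ℝ, (∀ x, 0 < θ x) →
        ∀ (t₀ : ℝ) (x₀ : Fin d → ℤ) (n : ℝ), (N₃ : ℝ) ≤ n → 1 ≤ n →
        ∀ u : ℝ → (Fin d → ℤ) → ℝ, IsCaloricOnCylinder ω θ t₀ x₀ n u →
          oscOn (cylinder t₀ x₀ (n / 4)) u ≤
            γ ![coeffA1 q r ω θ x₀ n, coeffA2 p q r ω θ x₀ n, coeffA3 θ x₀ n,
                avgNorm 1 (latticeBall x₀ n) (condMu ω),
                avgNorm 1 (latticeBall x₀ n) θ,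
                avgNorm 1 (latticeBall x₀ n) (fun x => 1 / θ x)] *
              oscOn (cylinder t₀ x₀ n) u := by
  refine ⟨8, fun p q r hp hq hr hpqr => ?_⟩
  -- One contraction constant is chosen for each integer bound j + 1 on A₂, to be used with j =
  -- ⌈A₂⌉; the shift guarantees that the bound is at least 1.
  choose c hc0 hc1 hosc using fun j : ℕ => exists_oscillation_contraction hd hp hq hr hpqr
    (M := (j : ℝ) + 1) (by linarith [Nat.cast_nonneg (α := ℝ) j])
  obtain ⟨H, hHc, hHm, hHe⟩ := exists_continuous_monotone_ge (fun j => 1 / c j)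
    fun j => (one_div_pos.2 (hc0 j)).le
  have hH1 : ∀ x, 1 ≤ H x := fun x =>
    le_trans (by rw [one_le_div (hc0 _)]; exact hc1 _) (hHe x)
  have hsum0 : ∀ a : Fin 6 → ℝ, (∀ i, 0 < a i) → 0 < ∑ i, a i := fun a ha =>
    Finset.sum_pos (fun i _ => ha i) Finset.univ_nonempty
  -- The coordinate `a 1` is A₂, and H(A₂) ≥ 1/c already gives the estimate. Adding the sum of all
  -- coordinates only increases γ, makes it strictly increasing in each of them, and keeps it in (0,
  -- 1) because H ≥ 1.
  refine ⟨fun a => 1 - 1 / (H (a 1) + ∑ i, a i), ?_, ?_, ?_, ?_⟩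
  · refine continuousOn_const.sub (continuousOn_const.div (Continuous.continuousOn ?_) ?_)
    · exact (hHc.comp (continuous_apply 1)).add
        (continuous_finsetSum _ fun i _ => continuous_apply i)
    · intro a ha
      have := hsum0 a ha
      linarith [hH1 (a 1)]
  · intro a ha b _ hab
    obtain ⟨hle, i, hi⟩ := Pi.lt_def.1 hab
    have h1 : ∑ i, a i < ∑ i, b i :=
      Finset.sum_lt_sum (fun j _ => hle j) ⟨i, Finset.mem_univ i, hi⟩
    have h2 := hHm (hle 1)
    have h3 := hsum0 a ha
    have h4 := hH1 (a 1)
    exact sub_lt_sub_left (one_div_lt_one_div_of_lt (by linarith) (by linarith)) 1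
  · intro a ha
    have h3 := hsum0 a ha
    have h4 := hH1 (a 1)
    have h5 : 0 < 1 / (H (a 1) + ∑ i, a i) := by
      have : 0 < H (a 1) + ∑ i, a i := by linarith
      positivity
    have h6 : 1 / (H (a 1) + ∑ i, a i) < 1 := by
      rw [div_lt_one (by linarith)]; linarith
    exact ⟨by linarith, by linarith⟩
  · intro ω hω θ hθ t₀ x₀ n hn _ u hu
    have hn8 : 8 ≤ n := by exact_mod_cast hn
    set A₂ := coeffA2 p q r ω θ x₀ n with hA₂
    have hA1 : 0 ≤ coeffA1 q r ω θ x₀ n :=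
      mul_nonneg (mul_nonneg (sq_nonneg _) (sq_nonneg _)) avgNorm_nonneg
    have hA2 : 0 ≤ A₂ := mul_nonneg (mul_nonneg (mul_nonneg (avgNormW_nonneg hθ) avgNorm_nonneg)
      (sq_nonneg _)) avgNorm_nonneg
    have hA3 : 0 ≤ coeffA3 θ x₀ n := mul_nonneg avgNorm_nonneg avgNorm_nonneg
    have h1 := hosc ⌈A₂⌉₊ ω hω θ hθ t₀ x₀ n hn8 u hu
      (by linarith [Nat.le_ceil A₂])
    have hne : 0 ≤ oscOn (cylinder t₀ x₀ n) u := by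
      have h0 : (t₀, x₀) ∈ cylinder t₀ x₀ n :=
        ⟨⟨by nlinarith [sq_nonneg n], le_rfl⟩, mem_latticeBall_self x₀ (by linarith)⟩
      exact sub_nonneg.2 ((csInf_le hu.isBounded.2 ⟨_, h0, rfl⟩).trans
        (le_csSup hu.isBounded.1 ⟨_, h0, rfl⟩))
    refine h1.trans (mul_le_mul_of_nonneg_right ?_ hne)
    refine sub_le_sub_left ?_ 1
    rw [one_div_le (lt_of_lt_of_le one_pos ?_) (hc0 _)]
    · refine (hHe A₂).trans ?_
      simp only [Matrix.cons_val_one, Matrix.cons_val_zero, Fin.sum_univ_six, Matrix.cons_val]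
      have e1 := avgNorm_nonneg (p := 1) (B := latticeBall x₀ n) (f := condMu ω)
      have e2 := avgNorm_nonneg (p := 1) (B := latticeBall x₀ n) (f := θ)
      have e3 := avgNorm_nonneg (p := 1) (B := latticeBall x₀ n) (f := fun x => 1 / θ x)
      linarith
    · simp only [Matrix.cons_val_one, Matrix.cons_val_zero, Fin.sum_univ_six, Matrix.cons_val]
      have e1 := avgNorm_nonneg (p := 1) (B := latticeBall x₀ n) (f := condMu ω)
      have e2 := avgNorm_nonneg (p := 1) (B := latticeBall x₀ n) (f := θ)
      have e3 := avgNorm_nonneg (p := 1) (B := latticeBall x₀ n) (f := fun x => 1 / θ x)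
      linarith [hH1 A₂]
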